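/- Let $X$ be a locally compact metric space and $k\in\mathbb N=\{0,1,2,\dots\}$. **Lipschitz functions and currents.** For a metric space $Y$ let $\mathrm{LIP}_\infty(Y)$ be the Banach space of bounded Lipschitz functions $Y\to\mathbb R$ with norm $L(f)=\max\{\mathrm{Lip}(f),\|f\|_\infty\}$, and $\overline{\mathrm{LIP}}_\infty(Y)$ its quotient by the constant functions with the quotient norm. Let $\mathrm{LIP}_c(X)$ be the space of compactly supported Lipschitz functions and $\mathscr D^k(X)=\mathrm{LIP}_c(X)\times\mathrm{LIP}_\infty(X)^k$. Write $f_n\to f$ in $\mathrm{LIP}_c(X)$ if $\sup_n\mathrm{Lip}(f_n)<\infty$, $\bigcup_n\operatorname{spt}f_n$ is precompact and $f_n\to f$ uniformly; write $f_n\to f$ in $\mathrm{LIP}_\infty(X)$ if $\sup_n\mathrm{Lip}(f_n)<\infty$ and $f_n\to f$ uniformly on compact sets. The space $\mathscr D_k(X)$ of metric $k$-currents consists of the $(k+1)$-linear maps $T:\mathscr D^k(X)\to\mathbb R$ that are sequentially continuous (for componentwise convergence) and satisfy $T(\pi_0,\dots,\pi_k)=0$ whenever some $\pi_i$ with $i\ge1$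 is constant in a neighbourhood of $\operatorname{spt}\pi_0$. A sequence $T_i$ converges to $T$ in $\mathscr D_k(X)$ if $T_i(\pi)\to T(\pi)$ for every $\pi\in\mathscr D^k(X)$. For $T\in\mathscr D_{k+1}(X)$ the boundary $\partial T\in\mathscr D_k(X)$ is $\partial T(\pi_0,\dots,\pi_k)=T(f,\pi_0,\dots,\pi_k)$ for any $f\in\mathrm{LIP}_c(X)$ with $f=1$ on $\operatorname{spt}\pi_0$. **Polylipschitz functions.** Let $\mathsf{Poly}^k(Y)$ be the completed projective tensor product of $k+1$ copies of $\mathrm{LIP}_\infty(Y)$, let $\overline{\mathsf{Poly}}{}^k(Y)$ be that of $\mathrm{LIP}_\infty(Y)$ and $k$ copies of $\overline{\mathrm{LIP}}_\infty(Y)$, and let $Q:\mathsf{Poly}^k(Y)\to\overline{\mathsf{Poly}}{}^k(Y)$ be the quotient map. A sequence $(p^j_0,\dots,p^j_k)_j$ represents $\pi\in\mathsf{Poly}^k(Y)$ if $\sum_jL(p_0^j)\cdots L(p_k^j)<\infty$ and $\pi=\sum_jp_0^j\otimes\cdots\otimes p_k^j$ in $\mathsf{Poly}^k(Y)$. One says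 $\pi^n\to\pi$ in $\mathsf{Poly}^k(Y)$ if for all compact $V_0,\dots,V_k\subset Y$ there are representations $(p^{j,n}_0,\dots,p^{j,n}_k)_j$ of $\pi^n-\pi$ with $\sum_j\sup_nL(p_0^{j,n})\cdots L(p_k^{j,n})<\infty$ and $\lim_n\sum_j\|p_0^{j,n}|_{V_0}\|_\infty\cdots\|p_k^{j,n}|_{V_k}\|_\infty=0$; and $\bar\pi^n\to\bar\pi$ in $\overline{\mathsf{Poly}}{}^k(Y)$ if there are lifts $\pi^n,\pi$ under $Q$ with $\pi^n\to\pi$ in $\mathsf{Poly}^k(Y)$. **Polylipschitz forms.** With the restriction maps, $U\mapsto\overline{\mathsf{Poly}}{}^k(U)$ is a presheaf on the open subsets of $X$; $[f]_x$ denotes the germ of $f$ at $x$. Let $\overline\Gamma{}^k_c(X)$ be the vector space of continuous sections $\omega$ of its étalé space whose support $\operatorname{spt}\omega=\overline{\{x:\omega(x)\neq0\}}$ is compact. One says $\omega_n\to\omega$ in $\overline\Gamma{}^k_c(X)$ if there are a compact set $K\subset X$ with $\operatorname{spt}(\omega_n-\omega)\subset K$ for all $n$, a locally finite cover $\mathcal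 U$ of $X$ by precompact open sets, and for each $n$ elements $c^n_U\in\overline{\mathsf{Poly}}{}^k(U)$ $(U\in\mathcal U)$ such that $c^n_U$ and $c^n_V$ have the same restriction to $U\cap V$ whenever $U\cap V\ne\varnothing$, every $(\omega_n-\omega)(x)$ is the germ at $x$ of some $c^n_U$ with $x\in U\in\mathcal U$, and $c^n_U\to0$ in $\overline{\mathsf{Poly}}{}^k(U)$ as $n\to\infty$ for every $U\in\mathcal U$. Let $\overline\Gamma{}^k_c(X)^*$ be the vector space of sequentially continuous linear functionals on $\overline\Gamma{}^k_c(X)$. Let $\bar\iota:\mathscr D^k(X)\to\overline\Gamma{}^k_c(X)$, $\bar\iota(\pi_0,\dots,\pi_k)(x)=[\pi_0\otimes\bar\pi_1\otimes\cdots\otimes\bar\pi_k]_x$. The exterior derivative $\bar d:\overline\Gamma{}^k_c(X)\to\overline\Gamma{}^{k+1}_c(X)$ is $(\bar d\omega)(x)=[\bar d_Uf]_x$ if $\omega(x)=[f]_x$ with $f\in\overline{\mathsf{Poly}}{}^k(U)$, where $\bar d_U:\overline{\mathsf{Poly}}{}^k(U)\to\overline{\mathsf{Poly}}{}^{k+1}(U)$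 is the unique continuous linear map with $\bar d_U\circ Q=Q\circ d_U$, and $d_U:\mathsf{Poly}^k(U)\to\mathsf{Poly}^{k+1}(U)$ is the continuous linear map with $d_U(\pi_0\otimes\cdots\otimes\pi_k)=\sum_{l=0}^{k+1}(-1)^l\,\pi_0\otimes\cdots\otimes\pi_{l-1}\otimes1\otimes\pi_l\otimes\cdots\otimes\pi_k$. **Theorem.** For every $T\in\mathscr D_k(X)$ there is a unique $\widehat T\in\overline\Gamma{}^k_c(X)^*$ with $\widehat T\circ\bar\iota=T$. The map $\mathscr D_k(X)\to\overline\Gamma{}^k_c(X)^*$, $T\mapsto\widehat T$, is linear, bijective and sequentially continuous: if $T_i\to T$ in $\mathscr D_k(X)$, then $\widehat T_i(\omega)\to\widehat T(\omega)$ for every $\omega\in\overline\Gamma{}^k_c(X)$. Moreover, $\widehat{\partial T}(\omega)=\widehat T(\bar d\omega)$ for all $T\in\mathscr D_{k+1}(X)$ and $\omega\in\overline\Gamma{}^k_c(X)$. -/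

import Mathlib

open Set Filter Topology TopologicalSpace
open scoped TensorProduct

noncomputable section

namespace Polylip

universe u

/-! ### Bounded Lipschitz functions -/

section Lip

variable {Y Z W : Type u} [MetricSpace Y] [MetricSpace Z] [MetricSpace W]

/-- The Lipschitz constant `sup_{x ≠ y} |f x - f y| / d (x, y)`; the pairs with `x = y` contribute
`0 / 0 = 0`. It is used for Lipschitz functions only. -/
def lipConst (f : Y → ℝ) : ℝ := ⨆ p : Y × Y, |f p.1 - f p.2| / dist p.1 p.2

/-- The sup norm of a bounded function on a set (`0` on the empty set). -/
def supNorm {S : Type u} (f : S → ℝ) : ℝ := ⨆ x, |f x|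

variable (Y) in
/-- The vector space of bounded Lipschitz functions, as a space of functions. -/
def lipSubmodule : Submodule ℝ (Y → ℝ) where
  carrier := {f | (∃ C, LipschitzWith C f) ∧ ∃ B : ℝ, ∀ x, |f x| ≤ B}
  zero_mem' := ⟨⟨0, LipschitzWith.const 0⟩, 0, fun x => by simp⟩
  add_mem' := by
    rintro f g ⟨⟨C, hC⟩, B, hB⟩ ⟨⟨C', hC'⟩, B', hB'⟩
    exact ⟨⟨C + C', hC.add hC'⟩, B + B', fun x => (abs_add_le _ _).trans (add_le_add (hB x) (hB' x))⟩
  smul_mem' := by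
    rintro c f ⟨⟨C, hC⟩, B, hB⟩
    refine ⟨⟨‖c‖₊ * C, LipschitzWith.of_dist_le_mul fun x y => ?_⟩, |c| * B, fun x => ?_⟩
    · have := hC.dist_le_mul x y
      simp only [Pi.smul_apply, smul_eq_mul, Real.dist_eq, ← mul_sub, abs_mul] at this ⊢
      simp only [NNReal.coe_mul, coe_nnnorm, Real.norm_eq_abs, mul_assoc]
      gcongr
    · simp only [Pi.smul_apply, smul_eq_mul, abs_mul]
      gcongr
      exact hB x

variable (Y) in
/-- `LIP_∞(Y)`: the space of bounded Lipschitz functions `Y → ℝ`. -/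
def LIP : Type u := lipSubmodule Y

instance : AddCommGroup (LIP Y) := inferInstanceAs (AddCommGroup (lipSubmodule Y))
instance : Module ℝ (LIP Y) := inferInstanceAs (Module ℝ (lipSubmodule Y))
instance : FunLike (LIP Y) Y ℝ where
  coe f := f.1
  coe_injective := fun _ _ h => Subtype.ext h

namespace LIP

@[ext] theorem ext {f g : LIP Y} (h : ∀ x, f x = g x) : f = g := DFunLike.ext _ _ h
theorem lip (f : LIP Y) : ∃ C, LipschitzWith C f := f.2.1
theorem bdd (f : LIP Y) : ∃ B : ℝ, ∀ x, |f x| ≤ B := f.2.2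
@[simp] theorem zero_apply (x : Y) : (0 : LIP Y) x = 0 := rfl
@[simp] theorem add_apply (f g : LIP Y) (x : Y) : (f + g) x = f x + g x := rfl
@[simp] theorem neg_apply (f : LIP Y) (x : Y) : (-f) x = -f x := rfl
@[simp] theorem sub_apply (f g : LIP Y) (x : Y) : (f - g) x = f x - g x := rfl
@[simp] theorem smul_apply (c : ℝ) (f : LIP Y) (x : Y) : (c • f) x = c * f x := rfl

theorem bddAbove_sup (f : LIP Y) : BddAbove (range fun x => |f x|) := by
  obtain ⟨B, hB⟩ := f.bdd
  exact ⟨B, by rintro _ ⟨x, rfl⟩; exact hB x⟩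

theorem quot_le {f : Y → ℝ} {C : ℝ} (hC0 : 0 ≤ C) (hC : ∀ x y, |f x - f y| ≤ C * dist x y)
    (p : Y × Y) : |f p.1 - f p.2| / dist p.1 p.2 ≤ C :=
  div_le_of_le_mul₀ dist_nonneg hC0 (hC _ _)

theorem bddAbove_lip (f : LIP Y) :
    BddAbove (range fun p : Y × Y => |f p.1 - f p.2| / dist p.1 p.2) := by
  obtain ⟨C, hC⟩ := f.lip
  exact ⟨C, by rintro _ ⟨p, rfl⟩; exact quot_le C.2 (fun x y => hC.dist_le_mul x y) p⟩

theorem abs_le_supNorm (f : LIP Y) (x : Y) : |f x| ≤ supNorm f := le_ciSup f.bddAbove_sup x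

theorem abs_sub_le (f : LIP Y) (x y : Y) : |f x - f y| ≤ lipConst f * dist x y := by
  rcases eq_or_ne x y with rfl | h
  · simp
  · rw [← div_le_iff₀ (dist_pos.2 h)]
    exact le_ciSup f.bddAbove_lip (x, y)

theorem supNorm_nonneg (f : LIP Y) : 0 ≤ supNorm f := Real.iSup_nonneg fun _ => abs_nonneg _
theorem lipConst_nonneg (f : LIP Y) : 0 ≤ lipConst f :=
  Real.iSup_nonneg fun _ => div_nonneg (abs_nonneg _) dist_nonneg

theorem supNorm_le {S : Type u} {f : S → ℝ} {B : ℝ} (hB : 0 ≤ B) (h : ∀ x, |f x| ≤ B) : supNorm f ≤ B :=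
  Real.iSup_le h hB

theorem lipConst_le {f : Y → ℝ} {C : ℝ} (hC0 : 0 ≤ C) (hC : ∀ x y, |f x - f y| ≤ C * dist x y) :
    lipConst f ≤ C :=
  Real.iSup_le (quot_le hC0 hC) hC0

/-- The norm `L(f) = max {Lip(f), ‖f‖_∞}`. -/
instance : Norm (LIP Y) := ⟨fun f => max (lipConst f) (supNorm f)⟩

theorem norm_def (f : LIP Y) : ‖f‖ = max (lipConst f) (supNorm f) := rfl

theorem norm_le {f : LIP Y} {B : ℝ} (hB : 0 ≤ B) (h₁ : ∀ x y, |f x - f y| ≤ B * dist x y)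
    (h₂ : ∀ x, |f x| ≤ B) : ‖f‖ ≤ B :=
  max_le (lipConst_le hB h₁) (supNorm_le hB h₂)

theorem norm_nonneg' (f : LIP Y) : 0 ≤ ‖f‖ := f.lipConst_nonneg.trans (le_max_left _ _)

theorem abs_le_norm (f : LIP Y) (x : Y) : |f x| ≤ ‖f‖ :=
  (f.abs_le_supNorm x).trans (le_max_right _ _)

theorem abs_sub_le_norm (f : LIP Y) (x y : Y) : |f x - f y| ≤ ‖f‖ * dist x y :=
  (f.abs_sub_le x y).trans (mul_le_mul_of_nonneg_right (le_max_left _ _) dist_nonneg)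

theorem norm_smul_le' (c : ℝ) (f : LIP Y) : ‖c • f‖ ≤ |c| * ‖f‖ := by
  refine norm_le (mul_nonneg (abs_nonneg _) f.norm_nonneg') (fun x y => ?_) fun x => ?_
  · rw [smul_apply, smul_apply, ← mul_sub, abs_mul, mul_assoc]
    exact mul_le_mul_of_nonneg_left (f.abs_sub_le_norm x y) (abs_nonneg _)
  · rw [smul_apply, abs_mul]
    exact mul_le_mul_of_nonneg_left (f.abs_le_norm x) (abs_nonneg _)

theorem core : NormedSpace.Core ℝ (LIP Y) where
  norm_nonneg := norm_nonneg'
  norm_smul c f := by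
    refine le_antisymm (norm_smul_le' c f) ?_
    rcases eq_or_ne c 0 with rfl | hc
    · simpa using norm_nonneg' _
    · have h := norm_smul_le' c⁻¹ (c • f)
      rw [inv_smul_smul₀ hc, abs_inv] at h
      rwa [Real.norm_eq_abs, ← le_inv_mul_iff₀ (abs_pos.2 hc)]
  norm_triangle f g := by
    refine norm_le (add_nonneg f.norm_nonneg' g.norm_nonneg') (fun x y => ?_) fun x => ?_
    · rw [add_apply, add_apply, add_sub_add_comm, add_mul]
      exact (abs_add_le _ _).trans (add_le_add (f.abs_sub_le_norm x y) (g.abs_sub_le_norm x y))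
    · exact (abs_add_le _ _).trans (add_le_add (f.abs_le_norm x) (g.abs_le_norm x))
  norm_eq_zero_iff f := by
    refine ⟨fun h => ext fun x => ?_, ?_⟩
    · have := f.abs_le_norm x
      rw [h] at this
      simpa using this
    · rintro rfl
      exact le_antisymm (norm_le le_rfl (by simp) (by simp)) (norm_nonneg' _)

instance : NormedAddCommGroup (LIP Y) := NormedAddCommGroup.ofCore core
instance : NormedSpace ℝ (LIP Y) := NormedSpace.ofCore core

variable (Y) in
/-- The constant functions, as a linear map. -/
def const : ℝ →ₗ[ℝ] LIP Y where
  toFun c := ⟨fun _ => c, ⟨0, LipschitzWith.const c⟩, |c|, fun _ => le_rfl⟩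
  map_add' _ _ := rfl
  map_smul' _ _ := rfl

@[simp] theorem const_apply (c : ℝ) (x : Y) : const Y c x = c := rfl

/-- Composition with a `1`-Lipschitz map; for an inclusion of subsets this is the restriction. -/
def comp (φ : Z → Y) (hφ : LipschitzWith 1 φ) : LIP Y →L[ℝ] LIP Z :=
  LinearMap.mkContinuous
    { toFun := fun f => ⟨fun z => f (φ z),
        ⟨f.lip.choose * 1, f.lip.choose_spec.comp hφ⟩, f.bdd.choose, fun z => f.bdd.choose_spec _⟩
      map_add' := fun _ _ => rfl
      map_smul' := fun _ _ => rfl } 1 fun f => by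
    rw [one_mul]
    refine norm_le (norm_nonneg f) (fun x y => ?_) fun x => f.abs_le_norm _
    refine (f.abs_sub_le_norm _ _).trans (mul_le_mul_of_nonneg_left ?_ (norm_nonneg f))
    simpa using hφ.dist_le_mul x y

@[simp] theorem comp_apply (φ : Z → Y) (hφ : LipschitzWith 1 φ) (f : LIP Y) (z : Z) :
    comp φ hφ f z = f (φ z) := rfl

end LIP

variable (Y) in
/-- The homogeneous space of bounded Lipschitz functions modulo constants, with the quotient
norm. -/
abbrev LIPBar : Type u := LIP Y ⧸ LinearMap.range (LIP.const Y)

namespace LIPBar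

variable (Y) in
/-- The quotient map `q`. -/
abbrev q : LIP Y →L[ℝ] LIPBar Y := (LinearMap.range (LIP.const Y)).mkQL

theorem q_const (c : ℝ) : q Y (LIP.const Y c) = 0 :=
  (Submodule.Quotient.mk_eq_zero _).2 ⟨c, rfl⟩

/-- The map induced on classes modulo constants by composition with a `1`-Lipschitz map. -/
def comp (φ : Z → Y) (hφ : LipschitzWith 1 φ) : LIPBar Y →L[ℝ] LIPBar Z :=
  Submodule.liftQL _ ((q Z).comp (LIP.comp φ hφ)) <| by
    rintro _ ⟨c, rfl⟩
    exact q_const c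

theorem comp_q (φ : Z → Y) (hφ : LipschitzWith 1 φ) (f : LIP Y) :
    comp φ hφ (q Y f) = q Z (LIP.comp φ hφ f) := rfl

end LIPBar

/-- The factors of the homogeneous tensor product: `LIP_∞(Y)` in position `0`, and bounded Lipschitz
functions modulo constants in the positions `1, …, k`. -/
def Slot (Y : Type u) [MetricSpace Y] : {k : ℕ} → Fin (k + 1) → Type u
  | _, ⟨0, _⟩ => LIP Y
  | _, ⟨_ + 1, _⟩ => LIPBar Y

instance Slot.seminormed : {k : ℕ} → (i : Fin (k + 1)) → SeminormedAddCommGroup (Slot Y i)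
  | _, ⟨0, _⟩ => inferInstanceAs (SeminormedAddCommGroup (LIP Y))
  | _, ⟨_ + 1, _⟩ => inferInstanceAs (SeminormedAddCommGroup (LIPBar Y))

instance Slot.normedSpace : {k : ℕ} → (i : Fin (k + 1)) → NormedSpace ℝ (Slot Y i)
  | _, ⟨0, _⟩ => inferInstanceAs (NormedSpace ℝ (LIP Y))
  | _, ⟨_ + 1, _⟩ => inferInstanceAs (NormedSpace ℝ (LIPBar Y))

variable (Y) in
/-- The map `id` in position `0` and the quotient map `q` in the other positions. -/
def Slot.q : {k : ℕ} → (i : Fin (k + 1)) → LIP Y →L[ℝ] Slot Y i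
  | _, ⟨0, _⟩ => ContinuousLinearMap.id ℝ (LIP Y)
  | _, ⟨_ + 1, _⟩ => LIPBar.q Y

/-- Composition with a `1`-Lipschitz map, on each factor. -/
def Slot.comp (φ : Z → Y) (hφ : LipschitzWith 1 φ) :
    {k : ℕ} → (i : Fin (k + 1)) → Slot Y i →L[ℝ] Slot Z i
  | _, ⟨0, _⟩ => LIP.comp φ hφ
  | _, ⟨_ + 1, _⟩ => LIPBar.comp φ hφ

theorem Slot.q_surjective {k : ℕ} (i : Fin (k + 1)) : Function.Surjective (Slot.q Y i) := by
  rcases i with ⟨_ | i, hi⟩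
  · exact fun f => ⟨f, rfl⟩
  · exact Submodule.mkQ_surjective _

theorem Slot.comp_q (φ : Z → Y) (hφ : LipschitzWith 1 φ) {k : ℕ} (i : Fin (k + 1)) (f : LIP Y) :
    Slot.comp φ hφ i (Slot.q Y i f) = Slot.q Z i (LIP.comp φ hφ f) := by
  rcases i with ⟨_ | i, hi⟩ <;> rfl

/-- The passage from a factor in position `i` to the factor in position `i + 1`. -/
def Slot.up : {k : ℕ} → (i : Fin (k + 1)) → Slot Y i →L[ℝ] Slot Y i.succ
  | _, ⟨0, _⟩ => LIPBar.q Y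
  | _, ⟨_ + 1, _⟩ => ContinuousLinearMap.id ℝ (LIPBar Y)

theorem Slot.up_q {k : ℕ} (i : Fin (k + 1)) (f : LIP Y) :
    Slot.up i (Slot.q Y i f) = Slot.q Y i.succ f := by
  rcases i with ⟨_ | i, hi⟩ <;> rfl

end Lip

/-! ### Polylipschitz functions and homogeneous polylipschitz functions -/

section Poly

open UniformSpace (Completion)

variable {Y Z W : Type u} [MetricSpace Y] [MetricSpace Z] [MetricSpace W] {k : ℕ}

/-- `k`-polylipschitz functions: the projective tensor product of `k + 1` copies of `LIP_∞(Y)`, that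
is, the completion of the algebraic tensor product for the projective norm. -/
abbrev Poly (k : ℕ) (Y : Type u) [MetricSpace Y] : Type u :=
  Completion (⨂[ℝ] _i : Fin (k + 1), LIP Y)

/-- Homogeneous `k`-polylipschitz functions: the projective tensor product of `LIP_∞(Y)` and `k`
copies of the space of bounded Lipschitz functions modulo constants. -/
abbrev PolyBar (k : ℕ) (Y : Type u) [MetricSpace Y] : Type u :=
  Completion (⨂[ℝ] i : Fin (k + 1), Slot Y i)

/-- `(π₀, …, π_k) ↦ π₀ ⊗ ⋯ ⊗ π_k` in the polylipschitz functions. -/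
def jmath (f : Fin (k + 1) → LIP Y) : Poly k Y :=
  ((PiTensorProduct.tprod ℝ f : ⨂[ℝ] _i : Fin (k + 1), LIP Y) : Completion _)

/-- The quotient map `Q = id ⊗ q ⊗ ⋯ ⊗ q`. -/
def Q (k : ℕ) (Y : Type u) [MetricSpace Y] : Poly k Y →L[ℝ] PolyBar k Y :=
  (PiTensorProduct.mapL fun i : Fin (k + 1) => Slot.q Y i).completion

/-- `(π₀, …, π_k) ↦ Q (π₀ ⊗ ⋯ ⊗ π_k)`, which is the tensor of `π₀` and the classes of
`π₁, …, π_k` (see `jmathBar_eq`). -/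
def jmathBar (f : Fin (k + 1) → LIP Y) : PolyBar k Y := Q k Y (jmath f)

theorem jmathBar_eq (f : Fin (k + 1) → LIP Y) :
    jmathBar f = ((PiTensorProduct.tprod ℝ fun i : Fin (k + 1) => Slot.q Y i (f i) :
      ⨂[ℝ] i : Fin (k + 1), Slot Y i) : Completion _) := by
  simp [jmathBar, jmath, Q]

/-- Continuous linear maps on polylipschitz functions are determined by elementary tensors. -/
theorem Poly.hom_ext {F : Type*} [NormedAddCommGroup F] [NormedSpace ℝ F] {A B : Poly k Y →L[ℝ] F}
    (h : ∀ f, A (jmath f) = B (jmath f)) : A = B := by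
  have key : (A.comp (Completion.toComplL (𝕜 := ℝ))).toLinearMap =
      (B.comp (Completion.toComplL (𝕜 := ℝ))).toLinearMap := by
    refine PiTensorProduct.ext (MultilinearMap.ext fun f => ?_)
    simpa [jmath] using h f
  ext p
  induction p using Completion.induction_on with
  | hp => exact isClosed_eq A.continuous B.continuous
  | ih t => simpa using LinearMap.congr_fun key t

/-- Continuous linear maps on homogeneous polylipschitz functions are determined by elementary
tensors. -/
theorem PolyBar.hom_ext {F : Type*} [NormedAddCommGroup F] [NormedSpace ℝ F]
    {A B : PolyBar k Y →L[ℝ] F} (h : ∀ f, A (jmathBar f) = B (jmathBar f)) : A = B := by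
  have key : (A.comp (Completion.toComplL (𝕜 := ℝ))).toLinearMap =
      (B.comp (Completion.toComplL (𝕜 := ℝ))).toLinearMap := by
    refine PiTensorProduct.ext (MultilinearMap.ext fun f => ?_)
    choose g hg using fun i => Slot.q_surjective (Y := Y) i (f i)
    obtain rfl : (fun i => Slot.q Y i (g i)) = f := funext hg
    have := h g
    rw [jmathBar_eq] at this
    simpa using this
  ext p
  induction p using Completion.induction_on with
  | hp => exact isClosed_eq A.continuous B.continuous
  | ih t => simpa using LinearMap.congr_fun key t

/-- The map on homogeneous polylipschitz functions induced by composition with a `1`-Lipschitz map;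
for an inclusion `U ⊆ V` this is the restriction map. -/
def PolyBar.comp (φ : Z → Y) (hφ : LipschitzWith 1 φ) (k : ℕ) : PolyBar k Y →L[ℝ] PolyBar k Z :=
  (PiTensorProduct.mapL fun i : Fin (k + 1) => Slot.comp φ hφ i).completion

theorem PolyBar.comp_jmathBar (φ : Z → Y) (hφ : LipschitzWith 1 φ) (f : Fin (k + 1) → LIP Y) :
    PolyBar.comp φ hφ k (jmathBar f) = jmathBar fun i => LIP.comp φ hφ (f i) := by
  rw [jmathBar_eq, jmathBar_eq]
  simp [PolyBar.comp, Slot.comp_q]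

/-! ### The exterior derivative of polylipschitz functions -/

/-- The map `π₀ ⊗ ⋯ ⊗ π_k ↦ π₀ ⊗ ⋯ ⊗ π_{l-1} ⊗ 1 ⊗ π_l ⊗ ⋯ ⊗ π_k`. -/
def insertOne (k : ℕ) (Y : Type u) [MetricSpace Y] (l : Fin (k + 2)) :
    Poly k Y →L[ℝ] Poly (k + 1) Y :=
  (PiTensorProduct.liftIsometry ℝ (fun _ : Fin (k + 1) => LIP Y) _
    (MultilinearMap.mkContinuous
      (MultilinearMap.curryMid l (PiTensorProduct.tprod ℝ (s := fun _ : Fin (k + 2) => LIP Y))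
        (LIP.const Y 1)) ‖LIP.const Y 1‖ fun f => by
      refine (PiTensorProduct.projectiveSeminorm_tprod_le _).trans ?_
      rw [Fin.prod_univ_succAbove _ l]
      simp)).completion

theorem insertOne_jmath (l : Fin (k + 2)) (f : Fin (k + 1) → LIP Y) :
    insertOne k Y l (jmath f) = jmath (l.insertNth (LIP.const Y 1) f) := by
  simp [insertOne, jmath]
  rfl

/-- The exterior derivative
`d (π₀ ⊗ ⋯ ⊗ π_k) = ∑_l (-1)^l π₀ ⊗ ⋯ ⊗ π_{l-1} ⊗ 1 ⊗ π_l ⊗ ⋯ ⊗ π_k` of polylipschitz functions. -/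
def dPoly (k : ℕ) (Y : Type u) [MetricSpace Y] : Poly k Y →L[ℝ] Poly (k + 1) Y :=
  ∑ l : Fin (k + 2), (-1 : ℝ) ^ (l : ℕ) • insertOne k Y l

/-- The exterior derivative of homogeneous polylipschitz functions: the continuous linear map induced
by `dPoly` on the quotients (`dBar_comp_Q`, `dBar_unique`). Since the class of the function `1` in the
positions `1, …, k + 1` is zero, it maps `π₀ ⊗ π₁ ⊗ ⋯ ⊗ π_k` to `1 ⊗ π₀ ⊗ π₁ ⊗ ⋯ ⊗ π_k`. -/
def dBar (k : ℕ) (Y : Type u) [MetricSpace Y] : PolyBar k Y →L[ℝ] PolyBar (k + 1) Y :=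
  (PiTensorProduct.liftIsometry ℝ (fun i : Fin (k + 1) => Slot Y i) _
    ((MultilinearMap.mkContinuous
      (MultilinearMap.curryLeft (PiTensorProduct.tprod ℝ (s := fun i : Fin (k + 2) => Slot Y i))
        (LIP.const Y 1)) ‖LIP.const Y 1‖ fun f => by
      refine (PiTensorProduct.projectiveSeminorm_tprod_le _).trans ?_
      rw [Fin.prod_univ_succ]
      rfl).compContinuousLinearMap fun i => Slot.up i)).completion

theorem dBar_jmathBar (f : Fin (k + 1) → LIP Y) :
    dBar k Y (jmathBar f) = jmathBar (Fin.cons (LIP.const Y 1) f) := by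
  rw [jmathBar_eq, jmathBar_eq]
  simp only [dBar, ContinuousLinearMap.completion_apply_coe, PiTensorProduct.liftIsometry_apply_apply,
    PiTensorProduct.lift.tprod]
  congr 1
  refine congrArg (PiTensorProduct.tprod ℝ) (funext fun i => ?_)
  cases i using Fin.cases with
  | zero => rfl
  | succ i => exact Slot.up_q i (f i)

theorem jmathBar_insertNth_one (l : Fin (k + 2)) (hl : l ≠ 0) (f : Fin (k + 1) → LIP Y) :
    jmathBar (l.insertNth (LIP.const Y 1) f) = 0 := by
  rw [jmathBar_eq, MultilinearMap.map_coord_zero _ l, Completion.coe_zero]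
  rw [Fin.insertNth_apply_same]
  rcases l with ⟨_ | l, h⟩
  · exact absurd rfl hl
  · exact LIPBar.q_const 1

theorem dBar_comp_Q (p : Poly k Y) : dBar k Y (Q k Y p) = Q (k + 1) Y (dPoly k Y p) := by
  refine DFunLike.congr_fun (F := Poly k Y →L[ℝ] PolyBar (k + 1) Y)
    (f := (dBar k Y).comp (Q k Y)) (g := (Q (k + 1) Y).comp (dPoly k Y)) (Poly.hom_ext fun f => ?_) p
  have h1 : dBar k Y (Q k Y (jmath f)) = jmathBar (Fin.cons (LIP.const Y 1) f) := dBar_jmathBar f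
  have h2 : ∀ l, Q (k + 1) Y (insertOne k Y l (jmath f)) =
      jmathBar (l.insertNth (LIP.const Y 1) f) := fun l => by rw [insertOne_jmath, jmathBar]
  simp only [ContinuousLinearMap.comp_apply, h1, dPoly, sum_apply,
    smul_apply, map_sum, map_smul, h2]
  rw [Fin.sum_univ_succ, Finset.sum_eq_zero fun l _ => by
    rw [jmathBar_insertNth_one _ (Fin.succ_ne_zero l), smul_zero]]
  simp

theorem dBar_unique (D : PolyBar k Y →L[ℝ] PolyBar (k + 1) Y)
    (hD : ∀ p, D (Q k Y p) = Q (k + 1) Y (dPoly k Y p)) : D = dBar k Y :=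
  PolyBar.hom_ext fun _ => (hD _).trans (dBar_comp_Q _).symm

theorem PolyBar.comp_dBar (φ : Z → Y) (hφ : LipschitzWith 1 φ) (p : PolyBar k Y) :
    PolyBar.comp φ hφ (k + 1) (dBar k Y p) = dBar k Z (PolyBar.comp φ hφ k p) := by
  refine DFunLike.congr_fun (F := PolyBar k Y →L[ℝ] PolyBar (k + 1) Z)
    (f := (PolyBar.comp φ hφ (k + 1)).comp (dBar k Y))
    (g := (dBar k Z).comp (PolyBar.comp φ hφ k)) (PolyBar.hom_ext fun f => ?_) p
  simp only [ContinuousLinearMap.comp_apply, dBar_jmathBar, PolyBar.comp_jmathBar]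
  congr 1
  funext i
  cases i using Fin.cases <;> rfl

theorem PolyBar.comp_id (p : PolyBar k Y) (h : LipschitzWith 1 (fun y : Y => y)) :
    PolyBar.comp (fun y => y) h k p = p := by
  refine DFunLike.congr_fun (F := PolyBar k Y →L[ℝ] PolyBar k Y)
    (f := PolyBar.comp (fun y => y) h k)
    (g := ContinuousLinearMap.id ℝ _) (PolyBar.hom_ext fun f => ?_) p
  rw [PolyBar.comp_jmathBar]
  rfl

theorem PolyBar.comp_comp (φ : Z → Y) (hφ : LipschitzWith 1 φ) (ψ : W → Z) (hψ : LipschitzWith 1 ψ)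
    (h : LipschitzWith 1 (fun w => φ (ψ w))) (p : PolyBar k Y) :
    PolyBar.comp ψ hψ k (PolyBar.comp φ hφ k p) = PolyBar.comp (fun w => φ (ψ w)) h k p := by
  refine DFunLike.congr_fun (F := PolyBar k Y →L[ℝ] PolyBar k W)
    (f := (PolyBar.comp ψ hψ k).comp (PolyBar.comp φ hφ k))
    (g := PolyBar.comp (fun w => φ (ψ w)) h k) (PolyBar.hom_ext fun f => ?_) p
  simp only [ContinuousLinearMap.comp_apply, PolyBar.comp_jmathBar]
  rfl

/-! ### Convergence of sequences of polylipschitz functions -/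

/-- The sequence of tuples `(p j 0, …, p j k)` represents `π`: the series `∑_j L(p j 0) ⋯ L(p j k)`
converges, and `π = ∑_j p j 0 ⊗ ⋯ ⊗ p j k` in the projective tensor product. -/
def Rep (p : ℕ → Fin (k + 1) → LIP Y) (π : Poly k Y) : Prop :=
  (Summable fun j => ∏ i, ‖p j i‖) ∧ HasSum (fun j => jmath (p j)) π

/-- Convergence of a sequence of polylipschitz functions: for every compact
`V = V 0 × ⋯ × V k`, the differences `πs n - π` have representations `p n` with
`∑_j sup_n L(p n j 0) ⋯ L(p n j k) < ∞` (that is, the products are at most `t j` for some summable `t`)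
and `∑_j ‖p n j 0‖_{∞, V 0} ⋯ ‖p n j k‖_{∞, V k} → 0` as `n → ∞`. -/
def PolyTendsto (πs : ℕ → Poly k Y) (π : Poly k Y) : Prop :=
  ∀ V : Fin (k + 1) → Set Y, (∀ i, IsCompact (V i)) →
    ∃ p : ℕ → ℕ → Fin (k + 1) → LIP Y,
      (∀ n, Rep (p n) (πs n - π)) ∧
      (∃ t : ℕ → ℝ, Summable t ∧ ∀ j n, ∏ i, ‖p n j i‖ ≤ t j) ∧
      Tendsto (fun n => ∑' j, ∏ i, supNorm fun x : V i => p n j i x) atTop (𝓝 0)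

/-- Convergence of a sequence of homogeneous polylipschitz functions: there are lifts that converge
as polylipschitz functions. -/
def PolyBarTendsto (πs : ℕ → PolyBar k Y) (π : PolyBar k Y) : Prop :=
  ∃ (ρs : ℕ → Poly k Y) (ρ : Poly k Y), (∀ n, Q k Y (ρs n) = πs n) ∧ Q k Y ρ = π ∧ PolyTendsto ρs ρ

end Poly

/-! ### The presheaf of homogeneous polylipschitz functions, germs and polylipschitz forms -/

section Forms

variable {X : Type u} [MetricSpace X] {k : ℕ}

/-- The restriction map of the presheaf `U ↦ PolyBar k U` on the open subsets of `X`. -/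
def res (k : ℕ) {U V : Opens X} (h : U ≤ V) : PolyBar k V →L[ℝ] PolyBar k U :=
  PolyBar.comp (Set.inclusion h) (LipschitzWith.mk_one fun _ _ => le_rfl) k

theorem res_self (U : Opens X) (p : PolyBar k U) : res k (le_refl U) p = p :=
  PolyBar.comp_id p _

theorem res_res {U V W : Opens X} (h : U ≤ V) (h' : V ≤ W) (p : PolyBar k W) :
    res k h (res k h' p) = res k (h.trans h') p :=
  PolyBar.comp_comp _ _ _ _ _ p

theorem res_dBar {U V : Opens X} (h : U ≤ V) (p : PolyBar k V) :
    res (k + 1) h (dBar k V p) = dBar k U (res k h p) :=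
  PolyBar.comp_dBar _ _ p

/-- The restriction maps between the open neighbourhoods of a point, ordered by reverse inclusion. -/
def nhdsRes (k : ℕ) (x : X) (U V : (OpenNhdsOf x)ᵒᵈ) (h : U ≤ V) :
    PolyBar k (OrderDual.ofDual U).toOpens →ₗ[ℝ] PolyBar k (OrderDual.ofDual V).toOpens :=
  (res k (U := (OrderDual.ofDual V).toOpens) (V := (OrderDual.ofDual U).toOpens) h).toLinearMap

instance nhdsRes_directed (k : ℕ) (x : X) :
    DirectedSystem (fun U : (OpenNhdsOf x)ᵒᵈ => PolyBar k (OrderDual.ofDual U).toOpens)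
      (fun U V h => nhdsRes k x U V h) where
  map_self _ p := res_self _ p
  map_map _ _ _ _ _ p := res_res _ _ p

/-- The stalk at `x`: two elements `f`, `g` over open neighbourhoods `U`, `V` of `x` are identified
if their restrictions to some open neighbourhood of `x` contained in `U` and `V` agree. -/
def Stalk (k : ℕ) (x : X) : Type u :=
  DirectLimit (fun U : (OpenNhdsOf x)ᵒᵈ => PolyBar k (OrderDual.ofDual U).toOpens)
    (fun U V h => nhdsRes k x U V h)

instance (k : ℕ) (x : X) : AddCommGroup (Stalk k x) :=
  inferInstanceAs (AddCommGroup (DirectLimit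
    (fun U : (OpenNhdsOf x)ᵒᵈ => PolyBar k (OrderDual.ofDual U).toOpens)
    (fun U V h => nhdsRes k x U V h)))

instance (k : ℕ) (x : X) : Module ℝ (Stalk k x) :=
  inferInstanceAs (Module ℝ (DirectLimit
    (fun U : (OpenNhdsOf x)ᵒᵈ => PolyBar k (OrderDual.ofDual U).toOpens)
    (fun U V h => nhdsRes k x U V h)))

/-- The germ `[f]_x` at `x ∈ U` of `f ∈ PolyBar k U`. -/
def germ (U : Opens X) (x : X) (hx : x ∈ U) : PolyBar k U →ₗ[ℝ] Stalk k x :=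
  DirectLimit.Module.of ℝ (OpenNhdsOf x)ᵒᵈ
    (fun U : (OpenNhdsOf x)ᵒᵈ => PolyBar k (OrderDual.ofDual U).toOpens)
    (fun U V h => nhdsRes k x U V h) (OrderDual.toDual ⟨U, hx⟩)

theorem germ_eq_iff {U V : Opens X} {x : X} {hU : x ∈ U} {hV : x ∈ V} {f : PolyBar k U}
    {g : PolyBar k V} : germ U x hU f = germ V x hV g ↔
      ∃ (D : Opens X) (_ : x ∈ D) (h₁ : D ≤ U) (h₂ : D ≤ V), res k h₁ f = res k h₂ g := by
  refine Quotient.eq.trans ⟨?_, ?_⟩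
  · rintro ⟨D, h₁, h₂, h⟩
    exact ⟨(OrderDual.ofDual D).toOpens, (OrderDual.ofDual D).mem, h₁, h₂, h⟩
  · rintro ⟨D, hD, h₁, h₂, h⟩
    exact ⟨OrderDual.toDual ⟨D, hD⟩, h₁, h₂, h⟩

theorem germ_res {U V : Opens X} (h : U ≤ V) {x : X} (hx : x ∈ U) (f : PolyBar k V) :
    germ U x hx (res k h f) = germ V x (h hx) f :=
  germ_eq_iff.2 ⟨U, hx, le_rfl, h, res_self _ _⟩

theorem exists_germ {x : X} (s : Stalk k x) :
    ∃ (U : Opens X) (hx : x ∈ U) (f : PolyBar k U), germ U x hx f = s := by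
  obtain ⟨U, f, h⟩ := DirectLimit.exists_eq_mk _ s
  exact ⟨(OrderDual.ofDual U).toOpens, (OrderDual.ofDual U).mem, f, h.symm⟩

/-- The étalé space: the disjoint union of the stalks. -/
structure Etale (k : ℕ) (X : Type u) [MetricSpace X] : Type u where
  /-- The base point. -/
  base : X
  /-- The germ at the base point. -/
  val : Stalk k base

/-- The étalé topology, generated by the sets `{[f]_x : x ∈ U}` for `U` open and `f` over `U`. -/
instance : TopologicalSpace (Etale k X) :=
  TopologicalSpace.generateFrom
    {O | ∃ (U : Opens X) (f : PolyBar k U), O = {s | ∃ hx : s.base ∈ U, s.val = germ U s.base hx f}}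

/-- A section is continuous for the étalé topology iff it is locally given by elements of the
presheaf. -/
theorem continuous_section_iff (ω : ∀ x : X, Stalk k x) :
    Continuous (fun x => (⟨x, ω x⟩ : Etale k X)) ↔
      ∀ x, ∃ (U : Opens X) (f : PolyBar k U), x ∈ U ∧ ∀ y (hy : y ∈ U), ω y = germ U y hy f := by
  constructor
  · intro h x
    obtain ⟨U, hx, f, hf⟩ := exists_germ (ω x)
    have ho : IsOpen {y | ∃ hy : y ∈ U, ω y = germ U y hy f} :=
      (TopologicalSpace.isOpen_generateFrom_of_mem ⟨U, f, rfl⟩ :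
        IsOpen {s : Etale k X | ∃ hx : s.base ∈ U, s.val = germ U s.base hx f}).preimage h
    refine ⟨⟨_, ho⟩, res k (U := ⟨_, ho⟩) (fun y hy => hy.1) f, ⟨hx, hf.symm⟩, fun y hy => ?_⟩
    rw [germ_res]
    exact hy.2
  · intro h
    refine continuous_generateFrom_iff.2 ?_
    rintro _ ⟨U, f, rfl⟩
    refine isOpen_iff_mem_nhds.2 ?_
    rintro x ⟨hx, hxf⟩
    obtain ⟨V, g, hxV, hg⟩ := h x
    obtain ⟨D, hD, h₁, h₂, he⟩ := germ_eq_iff.1 (hxf.symm.trans (hg x hxV))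
    filter_upwards [D.isOpen.mem_nhds hD] with y hy
    refine ⟨h₁ hy, ?_⟩
    show ω y = _
    rw [hg y (h₂ hy), ← germ_res h₁ hy, ← germ_res h₂ hy, he]

/-- The space of polylipschitz forms with compact support: the continuous sections `ω` of the étalé
space whose support, the closure of `{x | ω x ≠ 0}`, is compact. -/
def PolyForm (k : ℕ) (X : Type u) [MetricSpace X] : Submodule ℝ (∀ x : X, Stalk k x) where
  carrier := {ω | Continuous (fun x => (⟨x, ω x⟩ : Etale k X)) ∧ IsCompact (closure {x | ω x ≠ 0})}
  zero_mem' := by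
    refine ⟨(continuous_section_iff _).2 fun x => ⟨⊤, 0, Opens.mem_top x, fun y hy => ?_⟩, by simp⟩
    rw [map_zero, Pi.zero_apply]
  add_mem' := by
    rintro ω η ⟨hω, hω'⟩ ⟨hη, hη'⟩
    rw [continuous_section_iff] at hω hη
    refine ⟨(continuous_section_iff _).2 fun x => ?_, ?_⟩
    · obtain ⟨U, f, hx, hf⟩ := hω x
      obtain ⟨V, g, hx', hg⟩ := hη x
      refine ⟨U ⊓ V, res k inf_le_left f + res k inf_le_right g, ⟨hx, hx'⟩, fun y hy => ?_⟩
      rw [map_add, germ_res, germ_res, Pi.add_apply, hf y hy.1, hg y hy.2]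
    · refine (hω'.union hη').of_isClosed_subset isClosed_closure ?_
      rw [← closure_union]
      refine closure_mono fun x hx => ?_
      by_contra h
      simp only [mem_union, mem_ofPred_eq, not_or, not_not] at h
      exact hx (by rw [Pi.add_apply, h.1, h.2, add_zero])
  smul_mem' := by
    rintro c ω ⟨hω, hω'⟩
    rw [continuous_section_iff] at hω
    refine ⟨(continuous_section_iff _).2 fun x => ?_, ?_⟩
    · obtain ⟨U, f, hx, hf⟩ := hω x
      exact ⟨U, c • f, hx, fun y hy => by rw [map_smul, Pi.smul_apply, hf y hy]⟩
    · refine hω'.of_isClosed_subset isClosed_closure (closure_mono fun x hx h => hx ?_)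
      rw [Pi.smul_apply, h, smul_zero]

/-- The exterior derivative on stalks, `[f]_x ↦ [dBar f]_x`. -/
def dStalk (k : ℕ) (x : X) : Stalk k x →ₗ[ℝ] Stalk (k + 1) x :=
  DirectLimit.Module.lift ℝ (OpenNhdsOf x)ᵒᵈ
    (fun U : (OpenNhdsOf x)ᵒᵈ => PolyBar k (OrderDual.ofDual U).toOpens)
    (fun U V h => nhdsRes k x U V h)
    (fun U => (germ (OrderDual.ofDual U).toOpens x (OrderDual.ofDual U).mem).comp
      (dBar k (OrderDual.ofDual U).toOpens).toLinearMap)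
    fun U V h p => by
      have h' : (OrderDual.ofDual V).toOpens ≤ (OrderDual.ofDual U).toOpens := h
      exact (congrArg (germ _ x (OrderDual.ofDual V).mem) (res_dBar h' p).symm).trans
        (germ_res h' (OrderDual.ofDual V).mem (dBar k _ p))

theorem dStalk_germ {U : Opens X} {x : X} (hx : x ∈ U) (f : PolyBar k U) :
    dStalk k x (germ U x hx f) = germ U x hx (dBar k U f) := rfl

/-- The exterior derivative of polylipschitz forms with compact support. -/
def dForm (k : ℕ) (X : Type u) [MetricSpace X] : PolyForm k X →ₗ[ℝ] PolyForm (k + 1) X where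
  toFun ω := ⟨fun x => dStalk k x (ω.1 x), by
    refine ⟨(continuous_section_iff _).2 fun x => ?_, ?_⟩
    · obtain ⟨U, f, hx, hf⟩ := (continuous_section_iff _).1 ω.2.1 x
      exact ⟨U, dBar k U f, hx, fun y hy => by rw [hf y hy, dStalk_germ]⟩
    · refine ω.2.2.of_isClosed_subset isClosed_closure (closure_mono fun x hx h => hx ?_)
      exact (congrArg (dStalk k x) h).trans (map_zero _)⟩
  map_add' ω η := Subtype.ext (funext fun x => (dStalk k x).map_add (ω.1 x) (η.1 x))
  map_smul' c ω := Subtype.ext (funext fun x => (dStalk k x).map_smul c (ω.1 x))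

/-- The family `c` over the locally finite open cover `𝒰` is overlap-compatible with the section `ω`:
every `ω x` is the germ of some `c U` with `U ∈ 𝒰`, and any two members of the family agree on the
intersection of their domains. Only the values of `c` at the members of `𝒰` matter. -/
structure OverlapCompatible (𝒰 : Set (Opens X)) (c : ∀ U : Opens X, PolyBar k U)
    (ω : ∀ x : X, Stalk k x) : Prop where
  compatible : ∀ x, ∃ U ∈ 𝒰, ∃ hx : x ∈ U, ω x = germ U x hx (c U)
  overlap : ∀ U ∈ 𝒰, ∀ V ∈ 𝒰, ((U ⊓ V : Opens X) : Set X).Nonempty →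
    res k (inf_le_left : U ⊓ V ≤ U) (c U) = res k (inf_le_right : U ⊓ V ≤ V) (c V)

/-- `𝒰` is a locally finite cover of `X` by precompact open sets. -/
structure IsPrecompactCover (𝒰 : Set (Opens X)) : Prop where
  locallyFinite : LocallyFinite fun U : 𝒰 => ((U : Opens X) : Set X)
  covers : ∀ x, ∃ U ∈ 𝒰, x ∈ U
  precompact : ∀ U ∈ 𝒰, IsCompact (closure (U : Set X))

/-- Convergence of a sequence of polylipschitz forms with compact support: there are a compact set `K`
containing the supports of all `ωs n - ω`, and a locally finite precompact open cover with families
`c n` that are overlap-compatible with `ωs n - ω` and satisfy `c n U → 0` for every `U` in the cover. -/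
def FormTendsto (ωs : ℕ → PolyForm k X) (ω : PolyForm k X) : Prop :=
  ∃ (K : Set X) (𝒰 : Set (Opens X)) (c : ℕ → ∀ U : Opens X, PolyBar k U),
    IsCompact K ∧ IsPrecompactCover 𝒰 ∧
    (∀ n, OverlapCompatible 𝒰 (c n) (ωs n - ω).1) ∧
    (∀ n, closure {x | (ωs n - ω).1 x ≠ 0} ⊆ K) ∧
    ∀ U ∈ 𝒰, PolyBarTendsto (fun n => c n U) 0

/-- The sequential dual: the linear functionals on the polylipschitz forms with compact support that
are sequentially continuous. -/
def FormDual (k : ℕ) (X : Type u) [MetricSpace X] : Submodule ℝ (PolyForm k X →ₗ[ℝ] ℝ) where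
  carrier := {S | ∀ (ωs : ℕ → PolyForm k X) (ω : PolyForm k X), FormTendsto ωs ω →
    Tendsto (fun n => S (ωs n)) atTop (𝓝 (S ω))}
  zero_mem' _ _ _ := tendsto_const_nhds
  add_mem' hS hT ωs ω h := (hS ωs ω h).add (hT ωs ω h)
  smul_mem' a _ hS ωs ω h := (hS ωs ω h).const_mul a

end Forms

/-! ### Metric currents -/

section Currents

variable {X : Type u} [MetricSpace X] {k : ℕ}

/-- `LIP_c(X)`: the Lipschitz functions with compact support. -/
def LIPc (X : Type u) [MetricSpace X] : Submodule ℝ (LIP X) where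
  carrier := {f | HasCompactSupport f}
  zero_mem' := HasCompactSupport.zero
  add_mem' hf hg := HasCompactSupport.add hf hg
  smul_mem' c f hf := HasCompactSupport.mono hf fun x hx h => hx (by simp [h])

/-- Weak convergence of sequences in `LIP_c(X)`. -/
def LIPcTendsto (fs : ℕ → LIPc X) (f : LIPc X) : Prop :=
  BddAbove (range fun n => lipConst (fs n).1) ∧
  IsCompact (closure (⋃ n, tsupport (fs n).1)) ∧
  TendstoUniformly (fun n x => (fs n).1 x) f.1 atTop

/-- Convergence of sequences in `LIP_∞(X)`. -/
def LIPTendsto (fs : ℕ → LIP X) (f : LIP X) : Prop :=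
  BddAbove (range fun n => lipConst (fs n)) ∧
  ∀ K : Set X, IsCompact K → TendstoUniformlyOn (fun n x => fs n x) f atTop K

/-- The functionals on `LIP_c(X) × LIP_∞(X)^k` that are linear in each of the `k + 1` arguments. -/
abbrev TupleFunctional (k : ℕ) (X : Type u) [MetricSpace X] : Type u :=
  LIPc X →ₗ[ℝ] MultilinearMap ℝ (fun _ : Fin k => LIP X) ℝ

/-- Sequential continuity of a `(k + 1)`-linear functional. -/
def SeqContinuous (T : TupleFunctional k X) : Prop :=
  ∀ (fs : ℕ → LIPc X) (f : LIPc X) (gs : ℕ → Fin k → LIP X) (g : Fin k → LIP X),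
    LIPcTendsto fs f → (∀ i, LIPTendsto (fun n => gs n i) (g i)) →
      Tendsto (fun n => T (fs n) (gs n)) atTop (𝓝 (T f g))

/-- Locality: `T (π₀, …, π_k) = 0` if some `π_i`, `i ≥ 1`, is constant in a neighbourhood of the
support of `π₀`. -/
def IsLocal (T : TupleFunctional k X) : Prop :=
  ∀ (f : LIPc X) (g : Fin k → LIP X),
    (∃ (i : Fin k) (c : ℝ), ∀ᶠ x in 𝓝ˢ (tsupport f.1), g i x = c) → T f g = 0

/-- The vector space of metric `k`-currents. -/
def Current (k : ℕ) (X : Type u) [MetricSpace X] : Submodule ℝ (TupleFunctional k X) where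
  carrier := {T | SeqContinuous T ∧ IsLocal T}
  zero_mem' := ⟨fun _ _ _ _ _ _ => tendsto_const_nhds, fun _ _ _ => rfl⟩
  add_mem' {S T} hS hT := ⟨fun fs f gs g h h' => (hS.1 fs f gs g h h').add (hT.1 fs f gs g h h'),
    fun f g h => by
      rw [LinearMap.add_apply, add_apply, hS.2 f g h, hT.2 f g h, add_zero]⟩
  smul_mem' a T hT := ⟨fun fs f gs g h h' => (hT.1 fs f gs g h h').const_mul a, fun f g h => by
    rw [LinearMap.smul_apply, smul_apply, hT.2 f g h, smul_zero]⟩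

/-! ### The boundary of a current -/

/-- Soft thresholding of a function with compact support. -/
theorem exists_truncation (g : LIPc X) {ε : ℝ} (hε : 0 < ε) :
    ∃ h : LIPc X, lipConst h.1 ≤ lipConst g.1 ∧ (∀ x, |h.1 x - g.1 x| ≤ ε) ∧
      tsupport h.1 ⊆ tsupport g.1 ∧ tsupport h.1 ⊆ {x | ε ≤ |g.1 x|} := by
  have key : ∀ a b : ℝ,
      |(a - max (-ε) (min ε a)) - (b - max (-ε) (min ε b))| ≤ |a - b| := by
    intro a b
    rcases max_cases (-ε) (min ε a) with h1 | h1 <;> rcases min_cases ε a with h2 | h2 <;>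
    rcases max_cases (-ε) (min ε b) with h3 | h3 <;> rcases min_cases ε b with h4 | h4 <;>
    rcases abs_cases (a - b) with h5 | h5 <;> rw [abs_le] <;> constructor <;> linarith
  have small : ∀ a : ℝ, |max (-ε) (min ε a)| ≤ ε := fun a => by
    rw [abs_le]
    exact ⟨le_max_left _ _, max_le (by linarith) (min_le_left _ _)⟩
  have zero : ∀ a : ℝ, |a| ≤ ε → a - max (-ε) (min ε a) = 0 := fun a ha => by
    rw [abs_le] at ha
    rw [min_eq_right ha.2, max_eq_right ha.1, sub_self]
  obtain ⟨C, hC⟩ := g.1.lip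
  let h : LIP X := ⟨fun x => g.1 x - max (-ε) (min ε (g.1 x)),
    ⟨C, LipschitzWith.of_dist_le_mul fun x y => (key _ _).trans (hC.dist_le_mul x y)⟩,
    g.1.bdd.choose, fun x => by
      have := key (g.1 x) 0
      rw [zero 0 (by simpa using hε.le), sub_zero, sub_zero] at this
      exact this.trans (g.1.bdd.choose_spec x)⟩
  have hx : ∀ x, h x = g.1 x - max (-ε) (min ε (g.1 x)) := fun _ => rfl
  have hs : tsupport h ⊆ tsupport g.1 := closure_mono fun x hx' h0 => hx' (by
    rw [hx, h0, zero 0 (by simpa using hε.le)])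
  have hcont : Continuous g.1 := hC.continuous
  refine ⟨⟨h, g.2.of_isClosed_subset (isClosed_tsupport _) hs⟩, ?_, fun x => ?_, hs, ?_⟩
  · exact LIP.lipConst_le g.1.lipConst_nonneg fun x y => (key _ _).trans (g.1.abs_sub_le x y)
  · have : h x - g.1 x = -max (-ε) (min ε (g.1 x)) := by rw [hx]; ring
    exact (congrArg abs this).trans_le ((abs_neg _).trans_le (small _))
  · refine closure_minimal (fun x hx' => ?_) (isClosed_le continuous_const hcont.abs)
    by_contra hlt
    exact hx' ((hx x).trans (zero _ (not_le.1 hlt).le))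

theorem LIPTendsto.const (f : LIP X) : LIPTendsto (fun _ => f) f :=
  ⟨⟨lipConst f, by rintro _ ⟨_, rfl⟩; exact le_rfl⟩, fun _ _ =>
    tendstoUniformlyOn_iff_tendstoUniformly_comp_coe.2 fun u hu =>
      Eventually.of_forall fun _ _ => refl_mem_uniformity hu⟩

theorem LIPcTendsto.const (f : LIPc X) : LIPcTendsto (fun _ => f) f :=
  ⟨⟨lipConst f.1, by rintro _ ⟨_, rfl⟩; exact le_rfl⟩, by
    rw [iUnion_const, (isClosed_tsupport _).closure_eq]; exact f.2, fun _ hu =>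
      Eventually.of_forall fun _ _ => refl_mem_uniformity hu⟩

/-- A current vanishes if `π₀` is zero on the support of one of the other functions. -/
theorem Current.apply_eq_zero (T : Current k X) (f : LIPc X) (g : Fin k → LIP X) (i : Fin k)
    (h : ∀ x ∈ tsupport (g i), f.1 x = 0) : T.1 f g = 0 := by
  have hε : ∀ n : ℕ, (0 : ℝ) < 1 / ((n : ℝ) + 1) := fun n => by positivity
  choose fs h1 h2 h3 h4 using fun n => exists_truncation f (hε n)
  have hz : ∀ n, T.1 (fs n) g = 0 := fun n => by
    refine T.2.2 _ _ ⟨i, 0, ?_⟩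
    have hsub : tsupport (fs n).1 ⊆ (tsupport (g i))ᶜ := fun x hx hx' => by
      have := h4 n hx
      rw [mem_ofPred_eq, h x hx', abs_zero] at this
      exact absurd this (not_le.2 (hε n))
    filter_upwards [(isClosed_tsupport (g i)).isOpen_compl.mem_nhdsSet.2 hsub] with x hx
    exact image_eq_zero_of_notMem_tsupport hx
  have hlim : LIPcTendsto fs f := by
    refine ⟨⟨lipConst f.1, by rintro _ ⟨n, rfl⟩; exact h1 n⟩, ?_, ?_⟩
    · exact f.2.of_isClosed_subset isClosed_closure
        (closure_minimal (iUnion_subset h3) (isClosed_tsupport _))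
    · refine Metric.tendstoUniformly_iff.2 fun ε hε' => ?_
      filter_upwards [(tendsto_one_div_add_atTop_nhds_zero_nat (𝕜 := ℝ)).eventually
        (gt_mem_nhds hε')] with n hn x
      rw [dist_comm]
      exact (h2 n x).trans_lt hn
  have := T.2.1 fs f (fun _ => g) g hlim fun i => LIPTendsto.const _
  simp only [hz] at this
  exact (tendsto_nhds_unique this tendsto_const_nhds)

theorem Current.cutoff_indep (T : Current (k + 1) X) (f φ ψ : LIPc X) (g : Fin k → LIP X)
    (hφ : ∀ x ∈ tsupport f.1, φ.1 x = 1) (hψ : ∀ x ∈ tsupport f.1, ψ.1 x = 1) :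
    T.1 φ (Fin.cons f.1 g) = T.1 ψ (Fin.cons f.1 g) := by
  rw [← sub_eq_zero, ← sub_apply, ← map_sub]
  refine Current.apply_eq_zero T _ _ 0 fun x hx => ?_
  rw [Fin.cons_zero] at hx
  show φ.1 x - ψ.1 x = 0
  rw [hφ x hx, hψ x hx, sub_self]

variable [LocallyCompactSpace X]

/-- Lipschitz cut-off functions. -/
theorem exists_cutoff {K V : Set X} (hK : IsCompact K) (hV : IsOpen V) (hKV : K ⊆ V) :
    ∃ f : LIPc X, (∀ x ∈ K, f.1 x = 1) ∧ tsupport f.1 ⊆ V := by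
  obtain ⟨δ₁, hδ₁, h₁⟩ := hK.exists_cthickening_subset_open hV hKV
  obtain ⟨δ₂, hδ₂, h₂⟩ := hK.exists_isCompact_cthickening
  have hδ : 0 < min δ₁ δ₂ := lt_min hδ₁ hδ₂
  let φ := thickenedIndicator hδ K
  let f : LIP X := ⟨fun x => (φ x : ℝ), ⟨_, fun x y => lipschitzWith_thickenedIndicator hδ K x y⟩,
    1, fun x => by
      refine (abs_of_nonneg (φ x).2).trans_le ?_
      exact_mod_cast thickenedIndicator_le_one hδ K x⟩
  have hf : tsupport f ⊆ Metric.cthickening (min δ₁ δ₂) K := by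
    refine closure_minimal (fun x hx => ?_) Metric.isClosed_cthickening
    by_contra hx'
    refine hx ?_
    have : φ x = 0 := thickenedIndicator_zero hδ K fun h =>
      hx' (Metric.thickening_subset_cthickening _ _ h)
    show (φ x : ℝ) = 0
    rw [this, NNReal.coe_zero]
  refine ⟨⟨f, h₂.of_isClosed_subset (isClosed_tsupport _)
    (hf.trans (Metric.cthickening_mono (min_le_right _ _) _))⟩, fun x hx => ?_,
    hf.trans ((Metric.cthickening_mono (min_le_left _ _) _).trans h₁)⟩
  show (φ x : ℝ) = 1
  rw [show φ x = 1 from thickenedIndicator_one hδ K hx, NNReal.coe_one]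

/-- A Lipschitz function with compact support that is `1` on the support of `f`. -/
def cutoff (f : LIPc X) : LIPc X :=
  (exists_cutoff f.2 isOpen_univ (subset_univ _)).choose

theorem cutoff_eq_one (f : LIPc X) : ∀ x ∈ tsupport f.1, (cutoff f).1 x = 1 :=
  (exists_cutoff f.2 isOpen_univ (subset_univ _)).choose_spec.1

/-- The functional `(π₀, …, π_k) ↦ T (f, π₀, …, π_k)`, where `f` has compact support and is `1` on the
support of `π₀`. -/
def boundaryFunctional (T : Current (k + 1) X) : TupleFunctional k X where
  toFun f := (T.1 (cutoff f)).curryLeft f.1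
  map_add' f f' := by
    ext g
    obtain ⟨φ, hφ, -⟩ := exists_cutoff (f.2.union f'.2) isOpen_univ (subset_univ _)
    have h1 := Current.cutoff_indep T f (cutoff f) φ g (cutoff_eq_one f) fun x hx => hφ x (Or.inl hx)
    have h2 := Current.cutoff_indep T f' (cutoff f') φ g (cutoff_eq_one f') fun x hx => hφ x (Or.inr hx)
    have h3 := Current.cutoff_indep T (f + f') (cutoff (f + f')) φ g (cutoff_eq_one _) fun x hx =>
      hφ x (tsupport_add _ _ hx)
    simp only [MultilinearMap.curryLeft_apply, add_apply, h1, h2, h3]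
    exact MultilinearMap.cons_add (T.1 φ) g f.1 f'.1
  map_smul' c f := by
    ext g
    have hs : tsupport (c • f).1 ⊆ tsupport f.1 := closure_mono fun y hy h0 => hy (by
      show c * f.1 y = 0
      rw [h0, mul_zero])
    have h3 := Current.cutoff_indep T (c • f) (cutoff (c • f)) (cutoff f) g (cutoff_eq_one _) fun x hx =>
      cutoff_eq_one f x (hs hx)
    simp only [MultilinearMap.curryLeft_apply, smul_apply, h3, RingHom.id_apply]
    exact MultilinearMap.cons_smul (T.1 (cutoff f)) g c f.1

theorem boundaryFunctional_eq (T : Current (k + 1) X) (f φ : LIPc X) (g : Fin k → LIP X)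
    (hφ : ∀ x ∈ tsupport f.1, φ.1 x = 1) :
    boundaryFunctional T f g = T.1 φ (Fin.cons f.1 g) :=
  Current.cutoff_indep T f _ _ g (cutoff_eq_one f) hφ

/-- The boundary `∂T` of a current: `∂T (π₀, …, π_k) = T (f, π₀, …, π_k)` for every Lipschitz function
`f` with compact support that is `1` on the support of `π₀` (see `boundary_apply`). -/
def boundary (T : Current (k + 1) X) : Current k X :=
  ⟨boundaryFunctional T, by
    constructor
    · intro fs f gs g hf hg
      obtain ⟨φ, hφ, -⟩ := exists_cutoff hf.2.1 isOpen_univ (subset_univ _)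
      have hn : ∀ n, ∀ x ∈ tsupport (fs n).1, φ.1 x = 1 := fun n x hx =>
        hφ x (subset_closure (mem_iUnion.2 ⟨n, hx⟩))
      have hs : tsupport f.1 ⊆ closure (⋃ n, tsupport (fs n).1) := by
        refine closure_minimal (fun x hx => ?_) isClosed_closure
        by_contra hx'
        refine hx (tendsto_nhds_unique (hf.2.2.tendsto_at x) ?_)
        have : ∀ n, (fs n).1 x = 0 := fun n => image_eq_zero_of_notMem_tsupport fun h =>
          hx' (subset_closure (mem_iUnion.2 ⟨n, h⟩))
        simp only [this]
        exact tendsto_const_nhds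
      rw [boundaryFunctional_eq T f φ g fun x hx => hφ x (hs hx)]
      simp only [fun n => boundaryFunctional_eq T (fs n) φ (gs n) (hn n)]
      refine T.2.1 _ _ _ _ (LIPcTendsto.const φ) fun i => ?_
      cases i using Fin.cases with
      | zero => exact ⟨hf.1, fun K _ => hf.2.2.tendstoUniformlyOn⟩
      | succ i => exact hg i
    · rintro f g ⟨i, c, hc⟩
      obtain ⟨V, hV, hfV, hVc⟩ := mem_nhdsSet_iff_exists.1 hc
      obtain ⟨φ, hφ, hφV⟩ := exists_cutoff f.2 hV hfV
      rw [boundaryFunctional_eq T f φ g hφ]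
      refine T.2.2 _ _ ⟨i.succ, c, ?_⟩
      rw [Fin.cons_succ]
      exact mem_of_superset (hV.mem_nhdsSet.2 hφV) hVc⟩

theorem boundary_apply (T : Current (k + 1) X) (f φ : LIPc X) (g : Fin k → LIP X)
    (hφ : ∀ x ∈ tsupport f.1, φ.1 x = 1) :
    (boundary T).1 f g = T.1 φ (Fin.cons f.1 g) :=
  boundaryFunctional_eq T f φ g hφ

end Currents

/-! ### The action of tuples of Lipschitz functions as polylipschitz forms -/

section Iota

variable {X : Type u} [MetricSpace X] {k : ℕ}

/-- The restriction of a function on `X` to an open subset. -/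
def restrict (U : Opens X) : LIP X →L[ℝ] LIP U :=
  LIP.comp Subtype.val (LipschitzWith.subtype_val _)

/-- The element `π₀ ⊗ π₁ ⊗ ⋯ ⊗ π_k` over the open set `U`. -/
def tensorOn (U : Opens X) (g : Fin (k + 1) → LIP X) : PolyBar k U :=
  jmathBar fun i => restrict U (g i)

theorem res_tensorOn {U V : Opens X} (h : U ≤ V) (g : Fin (k + 1) → LIP X) :
    res k h (tensorOn V g) = tensorOn U g :=
  PolyBar.comp_jmathBar _ _ _

/-- The polylipschitz form `x ↦ [π₀ ⊗ π₁ ⊗ ⋯ ⊗ π_k]_x` of a tuple in `LIP_c(X) × LIP_∞(X)^k`. -/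
def iota (f : LIPc X) (g : Fin k → LIP X) : PolyForm k X :=
  ⟨fun x => germ ⊤ x (Opens.mem_top x) (tensorOn ⊤ (Fin.cons f.1 g)), by
    refine ⟨(continuous_section_iff _).2 fun x => ⟨⊤, _, Opens.mem_top x, fun _ _ => rfl⟩, ?_⟩
    refine f.2.of_isClosed_subset isClosed_closure
      (closure_minimal (fun x hx => ?_) (isClosed_tsupport _))
    by_contra hx'
    refine hx ?_
    let U : Opens X := ⟨(tsupport f.1)ᶜ, (isClosed_tsupport _).isOpen_compl⟩
    have hU : x ∈ U := hx'
    have h0 : tensorOn U (Fin.cons f.1 g : Fin (k + 1) → LIP X) = 0 := by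
      have : restrict U f.1 = 0 := LIP.ext fun y => image_eq_zero_of_notMem_tsupport (f := f.1) y.2
      rw [tensorOn, jmathBar, jmath, MultilinearMap.map_coord_zero _ 0 this,
        UniformSpace.Completion.coe_zero, map_zero]
    refine (germ_res le_top hU (tensorOn ⊤ (Fin.cons f.1 g))).symm.trans ?_
    rw [res_tensorOn, h0, map_zero]⟩

end Iota

end Polylip

end

open Polylip

/-! A current `T` is studied through its localizations `(π₀, …, π_k) ↦ T(φπ₀, π₁, …, π_k)`, where
`φ` is Lipschitz with compact support. These are multilinear on bounded Lipschitz functions and see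
only the values on `spt φ`. By Arzelà–Ascoli a bounded sequence of tuples subconverges uniformly on
`spt φ`, and the localized values converge along with it (`exists_subseq_tendsto_localize`). Two
compactness arguments follow. A localized current is bounded by a multiple of `∏ L(π_i)`
(`exists_bound_localize`), and it tends to zero along tuples with bounded norm products whose
products of values on `spt φ` tend to zero (`tendsto_localize_zero`).

The first fact, with the vanishing on tuples in which some `π_i`, `i ≥ 1`, is constant on `spt φ`,
turns the localization into a continuous functional on `PolyBar k U` for open `U ⊇ spt φ`
(`exists_localizeBar`). The second, with dominated convergence over representing series, makes this
functional sequentially continuous (`tendsto_localizeBar`). It is additive in `φ` and compatible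
with restriction, so by Lipschitz partitions it depends only on germs (`localizeOn_eq_zero`). The
extension of `T` at `ω` is the localization by any `φ` equal to `1` near `spt ω`, evaluated at a
global representative of `ω` (`exists_extension_current`).

For uniqueness, a partition and the series description of projective tensor products show that forms
given by absolutely convergent series of tuples, with supports in a compact set, span all forms
(`mem_span_isSeries`). Partial sums of such a series converge as forms (`formTendsto_series`), so a
sequentially continuous functional is determined on tuples. Conversely `iota` is sequentially
continuous and local, so each functional restricts to a current, and restriction is inverse to
extension.

If `T_n → T` pointwise, Banach–Steinhaus bounds the localizations uniformly in `n`, and limit and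
series may be interchanged. The boundary formula follows from uniqueness: both sides are
sequentially continuous in `ω` and agree on tuples, because `d(f ⊗ g₁ ⊗ ⋯ ⊗ g_k) = φ ⊗ f ⊗ g₁ ⊗ ⋯ ⊗
g_k` for `φ = 1` near `spt f`. -/

noncomputable section

namespace Polylip

universe u

/-! ### Operations on bounded Lipschitz functions -/

namespace LIP

variable {Y Z : Type u} [MetricSpace Y] [MetricSpace Z]

/-- A bounded function that satisfies a Lipschitz estimate, as an element of `LIP Y`. -/
def ofBound (f : Y → ℝ) (C B : ℝ) (hC : ∀ x y, |f x - f y| ≤ C * dist x y)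
    (hB : ∀ x, |f x| ≤ B) : LIP Y :=
  ⟨f, ⟨C.toNNReal, LipschitzWith.of_dist_le_mul fun x y => (hC x y).trans
    (mul_le_mul_of_nonneg_right (Real.le_coe_toNNReal C) dist_nonneg)⟩, B, hB⟩

@[simp] theorem ofBound_apply (f : Y → ℝ) (C B : ℝ) (hC : ∀ x y, |f x - f y| ≤ C * dist x y)
    (hB : ∀ x, |f x| ≤ B) (x : Y) : ofBound f C B hC hB x = f x := rfl

theorem continuous (f : LIP Y) : Continuous f := f.lip.choose_spec.continuous

theorem abs_mul_sub_mul_le (f g : LIP Y) (x y : Y) :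
    |f x * g x - f y * g y| ≤ 2 * ‖f‖ * ‖g‖ * dist x y := by
  have h : f x * g x - f y * g y = f x * (g x - g y) + (f x - f y) * g y := by ring
  calc |f x * g x - f y * g y| ≤ |f x| * |g x - g y| + |f x - f y| * |g y| := by
        rw [h, ← abs_mul, ← abs_mul]; exact abs_add_le _ _
    _ ≤ ‖f‖ * (‖g‖ * dist x y) + ‖f‖ * dist x y * ‖g‖ := by
        refine add_le_add
          (mul_le_mul (f.abs_le_norm x) (g.abs_sub_le_norm x y) (abs_nonneg _) (norm_nonneg f))
          (mul_le_mul (f.abs_sub_le_norm x y) (g.abs_le_norm y) (abs_nonneg _)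
            (mul_nonneg (norm_nonneg f) dist_nonneg))
    _ = _ := by ring

theorem abs_mul_le (f g : LIP Y) (x : Y) : |f x * g x| ≤ ‖f‖ * ‖g‖ := by
  rw [abs_mul]
  exact mul_le_mul (f.abs_le_norm x) (g.abs_le_norm x) (abs_nonneg _) (norm_nonneg f)

/-- Multiplication by a bounded Lipschitz function. -/
def mul (f : LIP Y) : LIP Y →L[ℝ] LIP Y :=
  LinearMap.mkContinuous
    { toFun := fun g => ofBound (fun x => f x * g x) _ _ (f.abs_mul_sub_mul_le g) (f.abs_mul_le g)
      map_add' := fun g h => ext fun x => mul_add _ _ _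
      map_smul' := fun c g => ext fun x => mul_left_comm _ _ _ } (2 * ‖f‖) fun g => by
    refine norm_le (by positivity) (f.abs_mul_sub_mul_le g) fun x => (f.abs_mul_le g x).trans ?_
    nlinarith [mul_nonneg (norm_nonneg f) (norm_nonneg g)]

@[simp] theorem mul_apply (f g : LIP Y) (x : Y) : mul f g x = f x * g x := rfl

theorem norm_mul_le (f g : LIP Y) : ‖mul f g‖ ≤ 2 * ‖f‖ * ‖g‖ :=
  (LinearMap.mkContinuous_norm_le _ (by positivity) _ |> fun h =>
    (mul f).le_of_opNorm_le h g)

theorem abs_clamp_sub_clamp_le (ε a b : ℝ) :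
    |max (-ε) (min ε a) - max (-ε) (min ε b)| ≤ |a - b| := by
  refine (abs_max_sub_max_le_max _ _ _ _).trans ?_
  rw [sub_self, abs_zero, max_eq_right (abs_nonneg _)]
  refine (abs_min_sub_min_le_max _ _ _ _).trans ?_
  rw [sub_self, abs_zero, max_eq_right (abs_nonneg _)]

theorem abs_clamp_le {ε : ℝ} (hε : 0 ≤ ε) (a : ℝ) : |max (-ε) (min ε a)| ≤ ε :=
  abs_le.2 ⟨le_max_left _ _, max_le (by linarith) (min_le_left _ _)⟩

theorem clamp_of_abs_le {ε a : ℝ} (h : |a| ≤ ε) : max (-ε) (min ε a) = a := by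
  rw [abs_le] at h
  rw [min_eq_right h.2, max_eq_right h.1]

/-- Truncation of a function to the interval `[-ε, ε]`. -/
def clamp (ε : ℝ) (hε : 0 ≤ ε) (f : LIP Y) : LIP Y :=
  ofBound (fun x => max (-ε) (min ε (f x))) (lipConst f) ε
    (fun x y => (abs_clamp_sub_clamp_le _ _ _).trans (f.abs_sub_le x y)) fun _ => abs_clamp_le hε _

theorem lipConst_clamp_le (ε : ℝ) (hε : 0 ≤ ε) (f : LIP Y) :
    lipConst (clamp ε hε f) ≤ lipConst f :=
  lipConst_le f.lipConst_nonneg fun x y => (abs_clamp_sub_clamp_le _ _ _).trans (f.abs_sub_le x y)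

theorem abs_clamp_apply_le (ε : ℝ) (hε : 0 ≤ ε) (f : LIP Y) (x : Y) : |clamp ε hε f x| ≤ ε :=
  abs_clamp_le hε _

theorem clamp_apply_of_le (ε : ℝ) (hε : 0 ≤ ε) (f : LIP Y) {x : Y} (h : |f x| ≤ ε) :
    clamp ε hε f x = f x := clamp_of_abs_le h

theorem norm_comp_le (φ : Z → Y) (hφ : LipschitzWith 1 φ) (f : LIP Y) : ‖comp φ hφ f‖ ≤ ‖f‖ := by
  have h := (comp φ hφ).le_of_opNorm_le (LinearMap.mkContinuous_norm_le _ zero_le_one _) f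
  rwa [one_mul] at h

theorem lipConst_le_norm (f : LIP Y) : lipConst f ≤ ‖f‖ := le_max_left _ _

theorem lipConst_add_le (f g : LIP Y) : lipConst (f + g) ≤ lipConst f + lipConst g := by
  refine lipConst_le (add_nonneg f.lipConst_nonneg g.lipConst_nonneg) fun x y => ?_
  rw [add_apply, add_apply, add_sub_add_comm, add_mul]
  exact (abs_add_le _ _).trans (add_le_add (f.abs_sub_le x y) (g.abs_sub_le x y))

theorem lipConst_neg (f : LIP Y) : lipConst (-f) = lipConst f := by
  refine congrArg iSup (funext fun p => ?_)
  rw [neg_apply, neg_apply, ← neg_sub', abs_neg]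

theorem norm_const_le (c : ℝ) : ‖const Y c‖ ≤ |c| :=
  norm_le (abs_nonneg c) (fun x y => by
    simpa using mul_nonneg (abs_nonneg c) dist_nonneg)
    fun x => le_rfl

/-- Bounded Lipschitz functions extend along isometries with the same norm. -/
theorem exists_extension (e : Z → Y) (he : Isometry e) (f : LIP Z) :
    ∃ F : LIP Y, (∀ z, F (e z) = f z) ∧ ‖F‖ ≤ ‖f‖ := by
  rcases isEmpty_or_nonempty Z with hZ | hZ
  · exact ⟨0, fun z => (hZ.false z).elim, by rw [norm_zero]; exact norm_nonneg f⟩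
  have hinv : ∀ z, Function.invFun e (e z) = z := Function.leftInverse_invFun he.injective
  have hL : LipschitzOnWith ‖f‖₊ (fun y => f (Function.invFun e y)) (range e) := by
    refine LipschitzOnWith.of_dist_le_mul ?_
    rintro _ ⟨z, rfl⟩ _ ⟨w, rfl⟩
    rw [hinv, hinv, he.dist_eq]
    exact f.abs_sub_le_norm z w
  -- McShane extension keeps the Lipschitz bound `‖f‖` but not the sup bound; truncation to `[-‖f‖,
  -- ‖f‖]` restores the latter without changing the values on the image of `e`.
  obtain ⟨g, hg, hgf⟩ := hL.extend_real
  have hg' : ∀ x y, |max (-‖f‖) (min ‖f‖ (g x)) - max (-‖f‖) (min ‖f‖ (g y))| ≤ ‖f‖ * dist x y :=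
    fun x y => (abs_clamp_sub_clamp_le _ _ _).trans (hg.dist_le_mul x y)
  have hb : ∀ x, |max (-‖f‖) (min ‖f‖ (g x))| ≤ ‖f‖ := fun x => abs_clamp_le (norm_nonneg f) _
  refine ⟨ofBound _ _ _ hg' hb, fun z => ?_, norm_le (norm_nonneg f) hg' hb⟩
  have : g (e z) = f z := (hgf (mem_range_self z)).symm.trans (congrArg f (hinv z))
  rw [ofBound_apply, this, clamp_of_abs_le (f.abs_le_norm z)]

/-- Needed for the uniform boundedness principle. The sup and Lipschitz bounds on `u N - u n`
survive the pointwise limit in `n`. -/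
instance : CompleteSpace (LIP Y) := by
  refine Metric.complete_of_cauchySeq_tendsto fun u hu => ?_
  have hpt : ∀ x, CauchySeq fun n => u n x := fun x => by
    obtain ⟨b, hb0, hb, hb1⟩ := cauchySeq_iff_le_tendsto_0.1 hu
    refine cauchySeq_of_le_tendsto_0 b (fun m n N hm hn => le_trans ?_ (hb m n N hm hn)) hb1
    rw [Real.dist_eq, dist_eq_norm]
    exact (u m - u n).abs_le_norm x
  choose g hg using fun x => cauchySeq_tendsto_of_complete (hpt x)
  obtain ⟨b, hb0, hb, hb1⟩ := cauchySeq_iff_le_tendsto_0.1 hu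
  have h1 : ∀ N x y, |(u N x - g x) - (u N y - g y)| ≤ b N * dist x y := fun N x y => by
    refine le_of_tendsto (((tendsto_const_nhds.sub (hg x)).sub
      (tendsto_const_nhds.sub (hg y))).abs) ?_
    filter_upwards [eventually_ge_atTop N] with n hn
    have := (u N - u n).abs_sub_le_norm x y
    refine this.trans (mul_le_mul_of_nonneg_right ?_ dist_nonneg)
    rw [← dist_eq_norm]; exact hb _ _ _ le_rfl hn
  have h2 : ∀ N x, |u N x - g x| ≤ b N := fun N x => by
    refine le_of_tendsto ((tendsto_const_nhds.sub (hg x)).abs) ?_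
    filter_upwards [eventually_ge_atTop N] with n hn
    refine ((u N - u n).abs_le_norm x).trans ?_
    rw [← dist_eq_norm]; exact hb _ _ _ le_rfl hn
  let d : ℕ → LIP Y := fun N => ofBound (fun x => u N x - g x) _ _ (h1 N) (h2 N)
  -- Writing the pointwise limit as `u 0 - d 0` shows at once that it is bounded and Lipschitz.
  refine ⟨u 0 - d 0, tendsto_iff_norm_sub_tendsto_zero.2 ?_⟩
  refine squeeze_zero (fun _ => norm_nonneg _) (fun N => ?_) hb1
  have : u N - (u 0 - d 0) = d N := ext fun x => by simp [d]
  rw [this]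
  exact norm_le (hb0 N) (h1 N) (h2 N)

end LIP

/-- A multilinear map takes the same value at `a` and `b` if it vanishes whenever one argument is the
difference of the corresponding arguments in `a` and `b`. -/
theorem multilinear_congr {ι : Type*} [Fintype ι] [LinearOrder ι] {M : ι → Type*}
    [∀ i, AddCommGroup (M i)] [∀ i, Module ℝ (M i)] {N : Type*} [AddCommGroup N] [Module ℝ N]
    (F : MultilinearMap ℝ M N) (a b : ∀ i, M i)
    (h : ∀ i (c : ∀ i, M i), c i = a i - b i → F c = 0) : F a = F b := by
  -- Telescoping from `b` to `a` one coordinate at a time: each summand has a difference `a i - b i`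
  -- in one position.
  have := F.map_piecewise_sub_map_piecewise a b 0 Finset.univ
  rw [Finset.piecewise_univ, Finset.piecewise_univ] at this
  rw [← sub_eq_zero, this]
  exact Finset.sum_eq_zero fun i _ => h i _ (by simp)

/-! ### Currents localized by a Lipschitz function with compact support -/

section LocalizedCurrents

variable {X : Type u} [MetricSpace X] {k : ℕ}

/-- A sequence with uniformly bounded Lipschitz constants and with uniform convergence. -/
theorem LIPTendsto.of_abs_sub_le {fs : ℕ → LIP X} {f : LIP X} (C : ℝ) (hC : ∀ n, lipConst (fs n) ≤ C)
    {ε : ℕ → ℝ} (hε : Tendsto ε atTop (𝓝 0)) (h : ∀ n x, |fs n x - f x| ≤ ε n) :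
    LIPTendsto fs f := by
  refine ⟨⟨C, by rintro _ ⟨n, rfl⟩; exact hC n⟩, fun K _ => ?_⟩
  refine (Metric.tendstoUniformly_iff.2 fun δ hδ => ?_).tendstoUniformlyOn
  filter_upwards [hε.eventually (gt_mem_nhds hδ)] with n hn x
  rw [dist_comm]
  exact (h n x).trans_lt hn

/-- A current vanishes if one of the functions `π₁, …, π_k` is constant on the support of `π₀`. -/
theorem Current.apply_eq_zero_of_const (T : Current k X) (f : LIPc X) (g : Fin k → LIP X) (i : Fin k)
    (c : ℝ) (h : ∀ x ∈ tsupport f.1, g i x = c) : T.1 f g = 0 := by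
  have hε : ∀ n : ℕ, (0 : ℝ) < 1 / ((n : ℝ) + 1) := fun n => by positivity
  let d : LIP X := g i - LIP.const X c
  have hd : ∀ x, d x = g i x - c := fun _ => rfl
  -- Locality needs a constant on a neighbourhood of the support. Subtracting from `g i` the
  -- truncation of `g i - c` at height `1/(n+1)` makes it equal to `c` on the open set `|g i - c| <
  -- 1/(n+1)`, moves it by at most `1/(n+1)` and keeps the Lipschitz constants bounded.
  let e : ℕ → LIP X := fun n => LIP.clamp _ (hε n).le d
  let gs : ℕ → Fin k → LIP X := fun n => Function.update g i (g i - e n)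
  have hz : ∀ n, T.1 f (gs n) = 0 := fun n => by
    refine T.2.2 _ _ ⟨i, c, ?_⟩
    have ho : IsOpen {x | |d x| < 1 / ((n : ℝ) + 1)} := isOpen_lt d.continuous.abs continuous_const
    filter_upwards [ho.mem_nhdsSet.2 fun x hx => by
      rw [mem_ofPred_eq, hd, h x hx, sub_self, abs_zero]; exact hε n] with x hx
    have : e n x = d x := LIP.clamp_apply_of_le _ _ _ (le_of_lt hx)
    simp only [gs, Function.update_self, LIP.sub_apply, this, hd, sub_sub_cancel]
  have hlim := T.2.1 (fun _ => f) f gs g (LIPcTendsto.const f) fun j => by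
    rcases eq_or_ne j i with rfl | hj
    · simp only [gs, Function.update_self]
      refine LIPTendsto.of_abs_sub_le (lipConst (g j) + lipConst d) (fun n => ?_)
        (tendsto_one_div_add_atTop_nhds_zero_nat (𝕜 := ℝ)) fun n x => ?_
      · rw [sub_eq_add_neg]
        refine (LIP.lipConst_add_le _ _).trans ?_
        rw [LIP.lipConst_neg]
        exact add_le_add le_rfl (LIP.lipConst_clamp_le _ _ _)
      · rw [LIP.sub_apply, sub_sub_cancel_left, abs_neg]
        exact LIP.abs_clamp_apply_le _ _ _ _
    · simp only [gs, Function.update_of_ne hj]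
      exact LIPTendsto.const _
  simp only [hz] at hlim
  exact tendsto_nhds_unique hlim tendsto_const_nhds

/-- A current depends only on the values of `π₁, …, π_k` on the support of `π₀`. -/
theorem Current.apply_congr (T : Current k X) (f : LIPc X) (g g' : Fin k → LIP X)
    (h : ∀ i, ∀ x ∈ tsupport f.1, g i x = g' i x) : T.1 f g = T.1 f g' :=
  multilinear_congr _ _ _ fun i c hc => Current.apply_eq_zero_of_const T f c i 0 fun x hx => by
    rw [hc, LIP.sub_apply, h i x hx, sub_self]

/-- Multiplication by a Lipschitz function with compact support. -/
def mulc (φ : LIPc X) : LIP X →ₗ[ℝ] LIPc X where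
  toFun g := ⟨LIP.mul φ.1 g, HasCompactSupport.mul_right φ.2⟩
  map_add' _ _ := Subtype.ext (map_add _ _ _)
  map_smul' _ _ := Subtype.ext (map_smul _ _ _)

@[simp] theorem mulc_apply (φ : LIPc X) (g : LIP X) (x : X) : (mulc φ g).1 x = φ.1 x * g x := rfl

theorem LIPc.ext {f g : LIPc X} (h : ∀ x, f.1 x = g.1 x) : f = g := Subtype.ext (LIP.ext h)

theorem tsupport_mulc_subset (φ : LIPc X) (g : LIP X) : tsupport (mulc φ g).1 ⊆ tsupport φ.1 :=
  closure_mono fun x hx h => hx (by rw [mulc_apply, h, zero_mul])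

theorem tsupport_mulc_subset_right (φ : LIPc X) (g : LIP X) : tsupport (mulc φ g).1 ⊆ tsupport g :=
  closure_mono fun x hx h => hx (by rw [mulc_apply, h, mul_zero])

theorem mulc_add_left (φ ψ : LIPc X) (g : LIP X) : mulc (φ + ψ) g = mulc φ g + mulc ψ g :=
  LIPc.ext fun _ => add_mul _ _ _

/-- The multilinear functional `(π₀, …, π_k) ↦ T (φ π₀, π₁, …, π_k)` on bounded Lipschitz functions. -/
def localize (T : TupleFunctional k X) (φ : LIPc X) :
    MultilinearMap ℝ (fun _ : Fin (k + 1) => LIP X) ℝ :=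
  LinearMap.uncurryLeft (M := fun _ : Fin (k + 1) => LIP X) (T.comp (mulc φ))

theorem localize_apply (T : TupleFunctional k X) (φ : LIPc X) (g : Fin (k + 1) → LIP X) :
    localize T φ g = T (mulc φ (g 0)) (Fin.tail g) := rfl

theorem localize_cons (T : TupleFunctional k X) (φ : LIPc X) (f : LIP X) (g : Fin k → LIP X) :
    localize T φ (Fin.cons f g) = T (mulc φ f) g := by
  rw [localize_apply, Fin.cons_zero, Fin.tail_cons]

/-- Bounded sequences of tuples of bounded Lipschitz functions have subsequences that converge
uniformly on a given compact set. -/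
theorem exists_subseq_tendsto {ι : Type*} [Fintype ι] {V : Set X} (hV : IsCompact V)
    (π : ℕ → ι → LIP X) (B : ℝ) (hB : 0 ≤ B) (hπ : ∀ n i, ‖π n i‖ ≤ B) :
    ∃ (σ : ℕ → ℕ) (G : ι → LIP X) (ε : ℕ → ℝ), StrictMono σ ∧ (∀ n, 0 ≤ ε n) ∧
      Tendsto ε atTop (𝓝 0) ∧ ∀ n i, ∀ x ∈ V, |π (σ n) i x - G i x| ≤ ε n := by
  have : CompactSpace V := isCompact_iff_compactSpace.1 hV
  -- Arzelà–Ascoli for functions on `V` with common Lipschitz and sup bound `B`. Compactness of the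
  -- finite power of `closure A` yields one subsequence for all indices.
  let A : Set (BoundedContinuousFunction V ℝ) :=
    {f | (∀ x y, |f x - f y| ≤ B * dist x y) ∧ ∀ x, |f x| ≤ B}
  have hA : IsCompact (closure A) := by
    refine BoundedContinuousFunction.arzela_ascoli (Icc (-B) B) isCompact_Icc A
      (fun f x hf => abs_le.1 (hf.2 x)) ?_
    refine (LipschitzWith.uniformEquicontinuous _ B.toNNReal fun f => ?_).equicontinuous
    refine LipschitzWith.of_dist_le_mul fun x y => (f.2.1 x y).trans ?_
    rw [Real.coe_toNNReal _ hB]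
  let a : ℕ → ι → BoundedContinuousFunction V ℝ := fun n i =>
    BoundedContinuousFunction.mkOfCompact ⟨fun x : V => π n i x,
      (π n i).continuous.comp continuous_subtype_val⟩
  have ha : ∀ n i (x : V), a n i x = π n i x := fun _ _ _ => rfl
  have haA : ∀ n, a n ∈ univ.pi fun _ : ι => closure A := fun n i _ => subset_closure
    ⟨fun x y => ((π n i).abs_sub_le_norm x y).trans
      (mul_le_mul_of_nonneg_right (hπ n i) dist_nonneg),
      fun x => ((π n i).abs_le_norm x).trans (hπ n i)⟩
  obtain ⟨b, hb, σ, hσ, hlim⟩ := (isCompact_univ_pi fun _ : ι => hA).tendsto_subseq haA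
  have hpt : ∀ i (x : V), Tendsto (fun n => π (σ n) i x) atTop (𝓝 (b i x)) := fun i x =>
    ((continuous_eval_const (F := BoundedContinuousFunction V ℝ) x).tendsto _).comp
      ((tendsto_pi_nhds.1 hlim) i)
  -- The limits on `V` inherit both bounds, so they extend to bounded Lipschitz functions on `X`.
  choose G hG hGn using fun i => LIP.exists_extension (Subtype.val : V → X) isometry_subtype_coe
    (LIP.ofBound (b i) B B
      (fun x y => le_of_tendsto (((hpt i x).sub (hpt i y)).abs) (Eventually.of_forall fun n =>
        ((π (σ n) i).abs_sub_le_norm x y).trans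
          (mul_le_mul_of_nonneg_right (hπ _ i) dist_nonneg)))
      (fun x => le_of_tendsto (hpt i x).abs (Eventually.of_forall fun n =>
        ((π (σ n) i).abs_le_norm x).trans (hπ _ i))))
  refine ⟨σ, G, fun n => dist (a (σ n)) b, hσ, fun n => dist_nonneg,
    tendsto_iff_dist_tendsto_zero.1 hlim, fun n i x hx => ?_⟩
  rw [hG i ⟨x, hx⟩, LIP.ofBound_apply]
  exact ((BoundedContinuousFunction.dist_coe_le_dist (f := a (σ n) i) (g := b i) ⟨x, hx⟩)).trans
    (dist_le_pi_dist (a (σ n)) b i)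

/-- Along a bounded sequence of tuples, a localized current converges after passing to a subsequence,
and the limit is its value at a tuple that is the pointwise limit on the support of `φ`. -/
theorem exists_subseq_tendsto_localize (T : Current k X) (φ : LIPc X)
    (π : ℕ → Fin (k + 1) → LIP X) (B : ℝ) (hπ : ∀ n i, ‖π n i‖ ≤ B) :
    ∃ (σ : ℕ → ℕ) (G : Fin (k + 1) → LIP X), StrictMono σ ∧
      (∀ i, ∀ x ∈ tsupport φ.1, Tendsto (fun n => π (σ n) i x) atTop (𝓝 (G i x))) ∧
      Tendsto (fun n => localize T.1 φ (π (σ n))) atTop (𝓝 (localize T.1 φ G)) := by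
  have hB : 0 ≤ B := (norm_nonneg _).trans (hπ 0 0)
  obtain ⟨σ, G, ε, hσ, hε0, hε, hG⟩ := exists_subseq_tendsto φ.2 π B hB hπ
  refine ⟨σ, G, hσ, fun i x hx => ?_, ?_⟩
  · exact tendsto_iff_dist_tendsto_zero.2
      (squeeze_zero (fun _ => dist_nonneg) (fun n => hG n i x hx) hε)
  -- The functions `π (σ n) i.succ` converge only on `spt φ`, while sequential continuity asks for
  -- convergence on every compact set. Truncating their difference to `G` at height `ε n` changes
  -- nothing on `spt φ`, hence not the value of `T`, and forces uniform convergence on all of `X`.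
  let h : ℕ → Fin k → LIP X := fun n i =>
    G i.succ + LIP.clamp (ε n) (hε0 n) (π (σ n) i.succ - G i.succ)
  have e : ∀ n, localize T.1 φ (π (σ n)) = T.1 (mulc φ (π (σ n) 0)) (h n) := fun n => by
    refine Current.apply_congr T _ _ _ fun i x hx => ?_
    have := LIP.clamp_apply_of_le (ε n) (hε0 n) (π (σ n) i.succ - G i.succ)
      (hG n i.succ x (tsupport_mulc_subset _ _ hx))
    rw [LIP.add_apply, this, LIP.sub_apply, add_sub_cancel]
    rfl
  simp only [e]
  refine T.2.1 _ _ _ _ ⟨⟨2 * ‖φ.1‖ * B, ?_⟩, ?_, ?_⟩ fun i => ?_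
  · rintro _ ⟨n, rfl⟩
    refine (LIP.lipConst_le_norm _).trans ((LIP.norm_mul_le _ _).trans ?_)
    exact mul_le_mul_of_nonneg_left (hπ _ _) (by positivity)
  · exact φ.2.of_isClosed_subset isClosed_closure
      (closure_minimal (iUnion_subset fun n => tsupport_mulc_subset _ _) (isClosed_tsupport _))
  · refine Metric.tendstoUniformly_iff.2 fun δ hδ => ?_
    have : Tendsto (fun n => ‖φ.1‖ * ε n) atTop (𝓝 0) := by simpa using hε.const_mul ‖φ.1‖
    filter_upwards [this.eventually (gt_mem_nhds hδ)] with n hn x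
    refine lt_of_le_of_lt ?_ hn
    rw [dist_comm, Real.dist_eq, mulc_apply, mulc_apply, ← mul_sub, abs_mul]
    by_cases hx : x ∈ tsupport φ.1
    · exact mul_le_mul (φ.1.abs_le_norm x) (hG n 0 x hx) (abs_nonneg _) (norm_nonneg _)
    · rw [image_eq_zero_of_notMem_tsupport hx, abs_zero, zero_mul]
      exact mul_nonneg (norm_nonneg _) (hε0 n)
  · refine LIPTendsto.of_abs_sub_le (lipConst (G i.succ) + (B + ‖G i.succ‖)) (fun n => ?_) hε
      fun n x => ?_
    · refine (LIP.lipConst_add_le _ _).trans (add_le_add le_rfl ?_)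
      refine (LIP.lipConst_clamp_le _ _ _).trans ((LIP.lipConst_le_norm _).trans ?_)
      exact (norm_sub_le _ _).trans (add_le_add (hπ _ _) le_rfl)
    · rw [LIP.add_apply, show Fin.tail G i = G i.succ from rfl, add_sub_cancel_left]
      exact LIP.abs_clamp_apply_le _ _ _ _

theorem norm_normalize_le (f : LIP X) : ‖(‖f‖⁻¹ : ℝ) • f‖ ≤ 1 := by
  rw [norm_smul, norm_inv, norm_norm]
  exact inv_mul_le_one

theorem norm_smul_normalize (f : LIP X) : ‖f‖ • ((‖f‖⁻¹ : ℝ) • f) = f := by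
  rcases eq_or_ne f 0 with rfl | hf
  · simp
  · rw [smul_inv_smul₀ (norm_ne_zero_iff.2 hf)]

theorem localize_normalize (T : TupleFunctional k X) (φ : LIPc X) (g : Fin (k + 1) → LIP X) :
    localize T φ g = (∏ i, ‖g i‖) * localize T φ fun i => (‖g i‖⁻¹ : ℝ) • g i := by
  conv_lhs => rw [show g = fun i => ‖g i‖ • ((‖g i‖⁻¹ : ℝ) • g i) from
    funext fun i => (norm_smul_normalize _).symm]
  rw [MultilinearMap.map_smul_univ, smul_eq_mul]

/-- Localized currents are bounded multilinear functionals. -/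
theorem exists_bound_localize (T : Current k X) (φ : LIPc X) :
    ∃ C : ℝ, ∀ g, |localize T.1 φ g| ≤ C * ∏ i, ‖g i‖ := by
  by_contra! H
  choose g hg using fun n : ℕ => H n
  -- If no bound holds, normalized tuples have values exceeding `n` in modulus, yet some subsequence
  -- of the values converges.
  let π : ℕ → Fin (k + 1) → LIP X := fun n i => (‖g n i‖⁻¹ : ℝ) • g n i
  have hlt : ∀ n : ℕ, (n : ℝ) < |localize T.1 φ (π n)| := fun n => by
    have h := hg n
    rw [localize_normalize, abs_mul, abs_of_nonneg (Finset.prod_nonneg fun _ _ => norm_nonneg _),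
      mul_comm (n : ℝ)] at h
    exact lt_of_mul_lt_mul_left h (Finset.prod_nonneg fun _ _ => norm_nonneg _)
  obtain ⟨σ, G, hσ, -, hlim⟩ := exists_subseq_tendsto_localize T φ π 1 fun n i =>
    norm_normalize_le _
  refine not_tendsto_atTop_of_tendsto_nhds hlim.abs ?_
  refine tendsto_atTop_mono (fun n => ?_) tendsto_natCast_atTop_atTop
  exact (Nat.cast_le.2 (hσ.id_le n)).trans (hlt (σ n)).le

/-- If the norm products of a sequence of tuples are bounded and the products of the values on the
support of `φ` tend to zero, then so do the values of a current localized by `φ`. -/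
theorem tendsto_localize_zero (T : Current k X) (φ : LIPc X) (π : ℕ → Fin (k + 1) → LIP X) (t : ℝ)
    (ht : ∀ n, ∏ i, ‖π n i‖ ≤ t)
    (h0 : ∀ x : Fin (k + 1) → X, (∀ i, x i ∈ tsupport φ.1) →
      Tendsto (fun n => ∏ i, π n i (x i)) atTop (𝓝 0)) :
    Tendsto (fun n => localize T.1 φ (π n)) atTop (𝓝 0) := by
  refine tendsto_of_subseq_tendsto fun τ hτ => ?_
  -- Only the product of the norms is bounded, not each factor. By multilinearity the whole product
  -- is moved to position `0` and the other entries are normalized. This preserves the value and the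
  -- pointwise products, and bounds all entries by `max 1 t`.
  let c : ℕ → Fin (k + 1) → ℝ := fun n => Fin.cons (∏ i, ‖π n i‖) fun _ => 1
  let ρ : ℕ → Fin (k + 1) → LIP X := fun n i => c n i • ((‖π n i‖⁻¹ : ℝ) • π n i)
  have hc : ∀ n, ∏ i, c n i = ∏ i, ‖π n i‖ := fun n => by simp [c, Fin.prod_univ_succ]
  have hρ : ∀ n, localize T.1 φ (π n) = localize T.1 φ (ρ n) := fun n => by
    rw [localize_normalize, ← hc, ← smul_eq_mul, ← MultilinearMap.map_smul_univ]
  have hρx : ∀ n (x : Fin (k + 1) → X), ∏ i, ρ n i (x i) = ∏ i, π n i (x i) := fun n x => by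
    simp only [ρ, LIP.smul_apply]
    rw [Finset.prod_mul_distrib, hc, ← Finset.prod_mul_distrib]
    refine Finset.prod_congr rfl fun i _ => ?_
    exact DFunLike.congr_fun (norm_smul_normalize (π n i)) (x i)
  have hρn : ∀ n i, ‖ρ n i‖ ≤ max 1 t := fun n i => by
    have hci : |c n i| ≤ max 1 t := by
      cases i using Fin.cases with
      | zero =>
        rw [show c n 0 = ∏ i, ‖π n i‖ from rfl,
          abs_of_nonneg (Finset.prod_nonneg fun _ _ => norm_nonneg _)]
        exact (ht n).trans (le_max_right _ _)
      | succ i => simp [c]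
    rw [norm_smul, Real.norm_eq_abs]
    simpa using mul_le_mul hci (norm_normalize_le (π n i)) (norm_nonneg _) (by positivity)
  obtain ⟨σ, G, hσ, hG, hlim⟩ := exists_subseq_tendsto_localize T φ (fun n => ρ (τ n)) _
    fun n => hρn (τ n)
  refine ⟨σ, ?_⟩
  simp only [hρ]
  suffices localize T.1 φ G = 0 by rwa [this] at hlim
  -- The points `x i` vary independently, so if `∏ G i (x i)` always vanishes, then a single factor
  -- vanishes on all of `spt φ`.
  have hz : ∃ i, ∀ x ∈ tsupport φ.1, G i x = 0 := by
    by_contra! H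
    choose x hx hne using H
    have hne' : ∏ i, G i (x i) ≠ 0 := Finset.prod_ne_zero_iff.2 fun i _ => hne i
    refine hne' (tendsto_nhds_unique (tendsto_finsetProd _ fun i _ => hG i (x i) (hx i)) ?_)
    simp only [hρx]
    exact (h0 x hx).comp (hτ.comp hσ.tendsto_atTop)
  obtain ⟨i, hi⟩ := hz
  rw [localize_apply]
  cases i using Fin.cases with
  | zero =>
    have : mulc φ (G 0) = 0 := LIPc.ext fun x => by
      rw [mulc_apply]
      by_cases hx : x ∈ tsupport φ.1
      · rw [hi x hx, mul_zero]; rfl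
      · rw [image_eq_zero_of_notMem_tsupport hx, zero_mul]; rfl
    rw [this, map_zero]; rfl
  | succ i =>
    exact Current.apply_eq_zero_of_const T _ _ i 0 fun x hx => hi x (tsupport_mulc_subset _ _ hx)

end LocalizedCurrents

/-! ### Representations of polylipschitz functions -/

section Representation

open UniformSpace (Completion)

variable {Y : Type u} [MetricSpace Y] {k : ℕ}

/-- Elementary tensors as a multilinear map. -/
def jmathMulti (k : ℕ) (Y : Type u) [MetricSpace Y] :
    MultilinearMap ℝ (fun _ : Fin (k + 1) => LIP Y) (Poly k Y) :=
  (Completion.toComplL (𝕜 := ℝ) (E := ⨂[ℝ] _i : Fin (k + 1), LIP Y)).toLinearMap.compMultilinearMap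
    (PiTensorProduct.tprod ℝ)

theorem norm_jmath_le (f : Fin (k + 1) → LIP Y) : ‖jmath f‖ ≤ ∏ i, ‖f i‖ := by
  rw [jmath, Completion.norm_coe]
  exact PiTensorProduct.projectiveSeminorm_tprod_le _

/-- The series of elementary tensors of a sequence of tuples with summable norm products converges. -/
theorem summable_jmath {ι : Type*} {p : ι → Fin (k + 1) → LIP Y}
    (hp : Summable fun j => ∏ i, ‖p j i‖) : Summable fun j => jmath (p j) :=
  Summable.of_norm_bounded hp fun _ => norm_jmath_le _

section Completion

variable {E : Fin (k + 1) → Type u} [∀ i, SeminormedAddCommGroup (E i)] [∀ i, NormedSpace ℝ (E i)]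

/-- Elementary tensors in the completed projective tensor product. -/
def ctprod (p : ∀ i, E i) : Completion (⨂[ℝ] i, E i) :=
  ((PiTensorProduct.tprod ℝ p : ⨂[ℝ] i, E i) : Completion _)

theorem norm_ctprod_le (p : ∀ i, E i) : ‖ctprod p‖ ≤ ∏ i, ‖p i‖ := by
  rw [ctprod, Completion.norm_coe]
  exact PiTensorProduct.projectiveSeminorm_tprod_le _

/-- The scalars are absorbed into position `0`, and the finite sum is padded by zero tuples. These
contribute nothing because there is at least one tensor factor. -/
theorem exists_hasSum_of_list (l : List (ℝ × ∀ i, E i)) :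
    ∃ p : ℕ → ∀ i, E i,
      HasSum (fun j => ∏ i, ‖p j i‖) (l.map fun q => ‖q.1‖ * ∏ i, ‖q.2 i‖).sum ∧
      HasSum (fun j => ctprod (p j)) ((l.map fun q => q.1 • PiTensorProduct.tprod ℝ q.2).sum :
        ⨂[ℝ] i, E i) := by
  induction l with
  | nil =>
    refine ⟨fun _ => 0, ?_, ?_⟩
    · simp
    · have h : ctprod (0 : ∀ i, E i) = 0 := by
        rw [ctprod, MultilinearMap.map_zero, Completion.coe_zero]
      rw [List.map_nil, List.sum_nil, Completion.coe_zero]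
      have h' : (fun _ : ℕ => ctprod (0 : ∀ i, E i)) = fun _ => 0 := funext fun _ => h
      exact h'.symm ▸ hasSum_zero
  | cons q l ih =>
    obtain ⟨p, h1, h2⟩ := ih
    let p₀ : ∀ i, E i := Function.update q.2 0 (q.1 • q.2 0)
    let p' : ℕ → ∀ i, E i := fun j => Nat.casesOn j p₀ p
    have hz : ∏ i, ‖p₀ i‖ = ‖q.1‖ * ∏ i, ‖q.2 i‖ := by
      simp [p₀, Fin.prod_univ_succ, norm_smul, mul_assoc]
    have hj : ctprod p₀ = ((q.1 • PiTensorProduct.tprod ℝ q.2 : ⨂[ℝ] i, E i) : Completion _) := by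
      simp only [p₀, ctprod, MultilinearMap.map_update_smul, Function.update_eq_self]
    refine ⟨p', ?_, ?_⟩
    · rw [List.map_cons, List.sum_cons, ← hz]
      exact HasSum.zero_add (f := fun j => ∏ i, ‖p' j i‖) h1
    · rw [List.map_cons, List.sum_cons, Completion.coe_add, ← hj]
      exact HasSum.zero_add (f := fun j => ctprod (p' j)) h2

/-- The projective norm is an infimum over finite representations, so some representation comes
within `ε` of it. -/
theorem exists_hasSum_coe (x : ⨂[ℝ] i, E i) {ε : ℝ} (hε : 0 < ε) :
    ∃ p : ℕ → ∀ i, E i, (Summable fun j => ∏ i, ‖p j i‖) ∧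
      ∑' j, ∏ i, ‖p j i‖ ≤ ‖x‖ + ε ∧ HasSum (fun j => ctprod (p j)) (x : Completion _) := by
  obtain ⟨⟨l, hl⟩, hlt⟩ := exists_lt_of_ciInf_lt
    ((PiTensorProduct.norm_def x).symm.trans_lt (lt_add_of_pos_right ‖x‖ hε))
  obtain ⟨p, h1, h2⟩ := exists_hasSum_of_list l.toList
  rw [(PiTensorProduct.mem_lifts_iff x l).1 hl] at h2
  exact ⟨p, h1.summable, h1.tsum_eq.trans_le hlt.le, h2⟩

/-- Every element of a completed projective tensor product is the sum of an absolutely convergent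
series of elementary tensors. -/
theorem exists_hasSum_ctprod (π : Completion (⨂[ℝ] i, E i)) :
    ∃ p : ℕ → ∀ i, E i, (Summable fun j => ∏ i, ‖p j i‖) ∧ HasSum (fun j => ctprod (p j)) π := by
  let j : (⨂[ℝ] i, E i) →+ Completion (⨂[ℝ] i, E i) := Completion.toCompl
  have hb : ∀ n : ℕ, (0 : ℝ) < (1 / 2) ^ n := fun n => by positivity
  -- Density writes `π` as a series of algebraic tensors `g n` with `‖g n‖ < 2⁻ⁿ` for `n ≥ 1`. Each
  -- `g n` is expanded with norm loss at most `2⁻ⁿ`, and the double series is then enumerated by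
  -- `ℕ`.
  obtain ⟨g, hg, -, hgb⟩ := controlled_sum_of_mem_closure_range (j := j) (b := π)
    (f := fun n => (1 / 2) ^ n) (Completion.denseRange_coe π) hb
  have hgn : ∀ n, 0 < n → ‖g n‖ < (1 / 2) ^ n := fun n hn => by
    have := hgb n hn
    rwa [show j (g n) = (g n : Completion _) from rfl, Completion.norm_coe] at this
  choose p hp1 hp2 hp3 using fun n => exists_hasSum_coe (g n) (hb n)
  have hs : Summable fun n => ∑' m, ∏ i, ‖p n m i‖ := by
    have hgeo : Summable fun n : ℕ => 2 * (1 / 2 : ℝ) ^ n :=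
      (summable_geometric_of_lt_one (by norm_num) (by norm_num)).mul_left 2
    -- The term `g 0` has no norm control, so the comparison starts at index `1`.
    refine (summable_nat_add_iff 1).1 (Summable.of_nonneg_of_le
      (fun n => tsum_nonneg fun m => Finset.prod_nonneg fun _ _ => norm_nonneg _) (fun n => ?_)
      ((summable_nat_add_iff 1).2 hgeo))
    have h := hgn (n + 1) n.succ_pos
    have h' := hp2 (n + 1)
    linarith
  have hs2 : Summable fun nm : ℕ × ℕ => ∏ i, ‖p nm.1 nm.2 i‖ :=
    (summable_prod_of_nonneg fun nm => Finset.prod_nonneg fun _ _ => norm_nonneg _).2 ⟨hp1, hs⟩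
  have hsum := (Summable.of_norm_bounded hs2 fun nm => norm_ctprod_le (p nm.1 nm.2)).hasSum
  have hg' := hsum.prod_fiberwise hp3
  have hπ : ∑' nm : ℕ × ℕ, ctprod (p nm.1 nm.2) = π :=
    tendsto_nhds_unique (hg'.tendsto_sum_nat.comp (tendsto_add_atTop_nat 1)) hg
  rw [hπ] at hsum
  exact ⟨fun m => p (Nat.pairEquiv.symm m).1 (Nat.pairEquiv.symm m).2,
    (Nat.pairEquiv.symm.summable_iff (f := fun nm : ℕ × ℕ => ∏ i, ‖p nm.1 nm.2 i‖)).2 hs2,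
    (Nat.pairEquiv.symm.hasSum_iff (f := fun nm : ℕ × ℕ => ctprod (p nm.1 nm.2))).2 hsum⟩

end Completion

end Representation

/-! ### Uniform boundedness of multilinear maps -/

/-- The uniform boundedness principle for multilinear maps in finitely many variables. -/
theorem multilinear_banach_steinhaus {ι : Type*} {E : Type u} [NormedAddCommGroup E]
    [NormedSpace ℝ E] [CompleteSpace E] {n : ℕ}
    (F : ι → ContinuousMultilinearMap ℝ (fun _ : Fin n => E) ℝ)
    (h : ∀ x, ∃ C, ∀ j, ‖F j x‖ ≤ C) : ∃ C, ∀ j, ‖F j‖ ≤ C := by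
  induction n with
  | zero =>
    obtain ⟨C, hC⟩ := h 0
    refine ⟨C, fun j => ContinuousMultilinearMap.opNorm_le_bound ((norm_nonneg _).trans (hC j))
      fun m => ?_⟩
    rw [Subsingleton.elim m 0]
    simpa using hC j
  | succ n ih =>
    -- Separate the first variable: the induction hypothesis bounds the curried maps at each fixed
    -- `x`, and the linear Banach–Steinhaus theorem makes this uniform in `x`.
    obtain ⟨C, hC⟩ := banach_steinhaus (g := fun j => (F j).curryLeft) fun x =>
      ih (fun j => (F j).curryLeft x) fun y => h (Fin.cons x y)
    exact ⟨C, fun j => by rw [← (F j).curryLeft_norm]; exact hC j⟩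

/-! ### Localized currents as functionals on homogeneous polylipschitz functions -/

/-- A multilinear map that vanishes as soon as one argument is in the kernel of `q i` descends along
the surjections `q i`. -/
theorem exists_descend {ι : Type*} [Fintype ι] [LinearOrder ι] {A : Type*} [AddCommGroup A]
    [Module ℝ A] {B : ι → Type*} [∀ i, AddCommGroup (B i)] [∀ i, Module ℝ (B i)]
    (q : ∀ i, A →ₗ[ℝ] B i) (hq : ∀ i, Function.Surjective (q i))
    (F : MultilinearMap ℝ (fun _ : ι => A) ℝ) (hF : ∀ i g, q i (g i) = 0 → F g = 0) :
    ∃ F' : MultilinearMap ℝ B ℝ, ∀ g, F' (fun i => q i (g i)) = F g := by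
  have hc : ∀ a b : ι → A, (∀ i, q i (a i) = q i (b i)) → F a = F b := fun a b h =>
    multilinear_congr F a b fun i c hci => hF i c (by rw [hci, map_sub, h i, sub_self])
  choose s hs using hq
  -- The sections `s i` need not be linear; `hc` makes the value independent of the lifts, and this
  -- restores multilinearity.
  refine ⟨{ toFun := fun m => F fun i => s i (m i), map_update_add' := ?_, map_update_smul' := ?_ },
    fun g => hc _ _ fun i => hs i _⟩
  · intro inst m i x y
    have e : ∀ z, F (fun j => s j (Function.update m i z j)) =
        F (Function.update (fun j => s j (m j)) i (s i z)) := fun z =>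
      hc _ _ fun j => by rcases eq_or_ne j i with rfl | hj <;> simp [*]
    rw [e, e, e, ← F.map_update_add]
    refine hc _ _ fun j => ?_
    rcases eq_or_ne j i with rfl | hj <;> simp [*]
  · intro inst m i c x
    have e : ∀ z, F (fun j => s j (Function.update m i z j)) =
        F (Function.update (fun j => s j (m j)) i (s i z)) := fun z =>
      hc _ _ fun j => by rcases eq_or_ne j i with rfl | hj <;> simp [*]
    rw [e, e, ← F.map_update_smul]
    refine hc _ _ fun j => ?_
    rcases eq_or_ne j i with rfl | hj <;> simp [*]

section Localize

open UniformSpace (Completion)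

variable {X Z W : Type u} [MetricSpace X] [MetricSpace Z] [MetricSpace W] {k : ℕ}

/-- The loss `δ` comes only from the quotient norm, an infimum that need not be attained; extension
from `Z` to `X` costs nothing. -/
theorem Slot.exists_lift (e : Z → X) (he : Isometry e) (i : Fin (k + 1)) (s : Slot Z i) {δ : ℝ}
    (hδ : 0 < δ) :
    ∃ G : LIP X, Slot.q Z i (LIP.comp e he.lipschitz G) = s ∧ ‖G‖ ≤ ‖s‖ + δ := by
  have key : ∃ f : LIP Z, Slot.q Z i f = s ∧ ‖f‖ ≤ ‖s‖ + δ := by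
    rcases i with ⟨_ | i, hi⟩
    · exact ⟨s, rfl, le_add_of_nonneg_right hδ.le⟩
    · obtain ⟨f, hf, hlt⟩ := Submodule.Quotient.norm_mk_lt
        (S := LinearMap.range (LIP.const Z)) s hδ
      exact ⟨f, hf, hlt.le⟩
  obtain ⟨f, hf, hle⟩ := key
  obtain ⟨G, hG, hGf⟩ := LIP.exists_extension e he f
  refine ⟨G, ?_, hGf.trans hle⟩
  rw [show LIP.comp e he.lipschitz G = f from LIP.ext hG, hf]

/-- Every homogeneous polylipschitz function is the sum of an absolutely convergent series of elementary
tensors of bounded Lipschitz functions. -/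
theorem exists_hasSum_jmathBar (f : PolyBar k Z) :
    ∃ p : ℕ → Fin (k + 1) → LIP Z, (Summable fun j => ∏ i, ‖p j i‖) ∧
      HasSum (fun j => jmathBar (p j)) f := by
  obtain ⟨s, hs, hsum⟩ := exists_hasSum_ctprod (E := fun i : Fin (k + 1) => Slot Z i) f
  have key : ∀ j, ∃ p : Fin (k + 1) → LIP Z, (∀ i, Slot.q Z i (p i) = s j i) ∧
      ∏ i, ‖p i‖ ≤ ∏ i, ‖s j i‖ + (1 / 2) ^ j := fun j => by
    -- The error must be small for the product of norms, not for each factor; continuity of the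
    -- product at `δ = 0` supplies a suitable `δ`, depending on `j`.
    have hlim : Tendsto (fun δ : ℝ => ∏ i, (‖s j i‖ + δ)) (𝓝[>] 0) (𝓝 (∏ i, (‖s j i‖ + 0))) :=
      (tendsto_finsetProd _ fun i _ => tendsto_const_nhds.add tendsto_id).mono_left
        nhdsWithin_le_nhds
    simp only [add_zero] at hlim
    obtain ⟨δ, hδ, hδ0⟩ := ((hlim.eventually (gt_mem_nhds (lt_add_of_pos_right _
      (by positivity : (0 : ℝ) < (1 / 2) ^ j)))).and self_mem_nhdsWithin).exists
    choose p hp hpn using fun i => Slot.exists_lift (fun z : Z => z) isometry_id i (s j i) hδ0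
    exact ⟨p, hp, (Finset.prod_le_prod (fun _ _ => norm_nonneg _) fun i _ => hpn i).trans hδ.le⟩
  choose p hp hpn using key
  refine ⟨p, Summable.of_nonneg_of_le (fun j => Finset.prod_nonneg fun _ _ => norm_nonneg _) hpn
    (hs.add (summable_geometric_of_lt_one (by norm_num) (by norm_num))), ?_⟩
  convert hsum using 2 with j
  rw [jmathBar_eq]
  simp only [hp]
  rfl

/-- This makes localization well defined on the homogeneous tensor product. In position `0` the
hypothesis gives `φ g₀ = 0`; in a later position it makes `g i` constant on the image of `e`, which
contains `spt φ`. -/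
theorem localize_eq_zero (T : Current k X) (φ : LIPc X) (e : Z → X) (he : Isometry e)
    (hφ : tsupport φ.1 ⊆ range e) (i : Fin (k + 1)) (g : Fin (k + 1) → LIP X)
    (h : Slot.q Z i (LIP.comp e he.lipschitz (g i)) = 0) : localize T.1 φ g = 0 := by
  cases i using Fin.cases with
  | zero =>
    have h' : LIP.comp e he.lipschitz (g 0) = 0 := h
    have : mulc φ (g 0) = 0 := LIPc.ext fun x => by
      rw [mulc_apply]
      by_cases hx : x ∈ tsupport φ.1
      · obtain ⟨z, rfl⟩ := hφ hx
        have : g 0 (e z) = 0 := DFunLike.congr_fun h' z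
        rw [this, mul_zero]; rfl
      · rw [image_eq_zero_of_notMem_tsupport hx, zero_mul]; rfl
    rw [localize_apply, this, map_zero]; rfl
  | succ i =>
    obtain ⟨c, hc⟩ := (Submodule.Quotient.mk_eq_zero (LinearMap.range (LIP.const Z))).1 h
    rw [localize_apply]
    refine Current.apply_eq_zero_of_const T _ _ i c fun x hx => ?_
    obtain ⟨z, rfl⟩ := hφ (tsupport_mulc_subset _ _ hx)
    exact (DFunLike.congr_fun hc z).symm

/-- The localized current descends to the slots by `localize_eq_zero`. Almost norm-preserving lifts,
with `δ → 0`, carry its bound to the quotient norms. The universal property of the projective norm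
and extension to the completion do the rest. -/
theorem exists_localizeBar (T : Current k X) (φ : LIPc X) (e : Z → X) (he : Isometry e)
    (hφ : tsupport φ.1 ⊆ range e) :
    ∃ Λ : PolyBar k Z →L[ℝ] ℝ, ∀ g : Fin (k + 1) → LIP X,
      Λ (jmathBar fun i => LIP.comp e he.lipschitz (g i)) = localize T.1 φ g := by
  obtain ⟨F, hF⟩ := exists_descend (B := fun i : Fin (k + 1) => Slot Z i)
    (fun i => (Slot.q Z i).toLinearMap ∘ₗ (LIP.comp e he.lipschitz).toLinearMap)
    (fun i s => (Slot.exists_lift e he i s one_pos).imp fun _ h => h.1) (localize T.1 φ)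
    fun i g h => localize_eq_zero T φ e he hφ i g h
  obtain ⟨C, hC⟩ := exists_bound_localize T φ
  have hC' : ∀ g, |localize T.1 φ g| ≤ max C 0 * ∏ i, ‖g i‖ := fun g => (hC g).trans
    (mul_le_mul_of_nonneg_right (le_max_left _ _) (Finset.prod_nonneg fun _ _ => norm_nonneg _))
  have hb : ∀ s, ‖F s‖ ≤ max C 0 * ∏ i, ‖s i‖ := fun s => by
    have hlim : Tendsto (fun δ : ℝ => max C 0 * ∏ i, (‖s i‖ + δ)) (𝓝[>] 0)
        (𝓝 (max C 0 * ∏ i, (‖s i‖ + 0))) :=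
      ((tendsto_finsetProd _ fun i _ => tendsto_const_nhds.add tendsto_id).const_mul _).mono_left
        nhdsWithin_le_nhds
    simp only [add_zero] at hlim
    refine ge_of_tendsto hlim ?_
    filter_upwards [self_mem_nhdsWithin] with δ hδ
    choose G hG hGn using fun i => Slot.exists_lift e he i (s i) hδ
    have : F s = localize T.1 φ G := by rw [← hF]; exact congrArg F (funext fun i => (hG i).symm)
    rw [this]
    exact (hC' G).trans (mul_le_mul_of_nonneg_left
      (Finset.prod_le_prod (fun _ _ => norm_nonneg _) fun i _ => hGn i) (le_max_right _ _))
  let Λ₀ : (⨂[ℝ] i : Fin (k + 1), Slot Z i) →L[ℝ] ℝ :=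
    PiTensorProduct.liftIsometry ℝ _ _ (F.mkContinuous _ hb)
  refine ⟨Λ₀.extend Completion.toComplL, fun g => ?_⟩
  rw [jmathBar_eq, ← hF]
  refine (Λ₀.extend_eq (e := Completion.toComplL (𝕜 := ℝ)) Completion.denseRange_coe
    (Completion.isUniformInducing_coe _) _).trans ?_
  simp only [Λ₀, PiTensorProduct.liftIsometry_apply_apply]
  exact PiTensorProduct.lift.tprod _

/-- The functional `π₀ ⊗ π₁ ⊗ ⋯ ⊗ π_k ↦ T (φ π₀, π₁, …, π_k)` on the homogeneous polylipschitz functions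
of an isometrically embedded space that contains the support of `φ`. -/
def localizeBar (T : Current k X) (φ : LIPc X) (e : Z → X) (he : Isometry e)
    (hφ : tsupport φ.1 ⊆ range e) : PolyBar k Z →L[ℝ] ℝ :=
  (exists_localizeBar T φ e he hφ).choose

theorem localizeBar_jmathBar (T : Current k X) (φ : LIPc X) (e : Z → X) (he : Isometry e)
    (hφ : tsupport φ.1 ⊆ range e) (g : Fin (k + 1) → LIP X) :
    localizeBar T φ e he hφ (jmathBar fun i => LIP.comp e he.lipschitz (g i)) = localize T.1 φ g :=
  (exists_localizeBar T φ e he hφ).choose_spec g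

/-- Continuous linear maps on homogeneous polylipschitz functions are determined by the elementary
tensors of restrictions. -/
theorem PolyBar.hom_ext_of_isometry (e : Z → X) (he : Isometry e) {F : Type*} [NormedAddCommGroup F]
    [NormedSpace ℝ F] {A B : PolyBar k Z →L[ℝ] F}
    (h : ∀ g : Fin (k + 1) → LIP X, A (jmathBar fun i => LIP.comp e he.lipschitz (g i)) =
      B (jmathBar fun i => LIP.comp e he.lipschitz (g i))) : A = B :=
  PolyBar.hom_ext fun f => by
    choose G hG _ using fun i => LIP.exists_extension e he (f i)
    obtain rfl : (fun i => LIP.comp e he.lipschitz (G i)) = f := funext fun i => LIP.ext (hG i)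
    exact h G

theorem localizeBar_add (T : Current k X) (φ ψ : LIPc X) (e : Z → X) (he : Isometry e)
    (hφ : tsupport φ.1 ⊆ range e) (hψ : tsupport ψ.1 ⊆ range e)
    (h : tsupport (φ + ψ).1 ⊆ range e) :
    localizeBar T (φ + ψ) e he h = localizeBar T φ e he hφ + localizeBar T ψ e he hψ := by
  refine PolyBar.hom_ext_of_isometry e he fun g => ?_
  rw [add_apply, localizeBar_jmathBar, localizeBar_jmathBar, localizeBar_jmathBar,
    localize_apply, mulc_add_left, map_add]
  rfl

/-- Shrinking the domain is harmless while it still contains `spt φ`: both sides are continuous in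
`f` and agree on tensors of restrictions of functions on `X`. -/
theorem localizeBar_comp (T : Current k X) (φ : LIPc X) (e : Z → X) (he : Isometry e)
    (hφ : tsupport φ.1 ⊆ range e) (ι : W → Z) (hι : LipschitzWith 1 ι)
    (hι' : Isometry fun w => e (ι w)) (hφ' : tsupport φ.1 ⊆ range fun w => e (ι w))
    (f : PolyBar k Z) :
    localizeBar T φ _ hι' hφ' (PolyBar.comp ι hι k f) = localizeBar T φ e he hφ f := by
  refine DFunLike.congr_fun (F := PolyBar k Z →L[ℝ] ℝ)
    (f := (localizeBar T φ _ hι' hφ').comp (PolyBar.comp ι hι k)) ?_ f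
  refine PolyBar.hom_ext_of_isometry e he fun g => ?_
  rw [ContinuousLinearMap.comp_apply, PolyBar.comp_jmathBar, localizeBar_jmathBar]
  exact localizeBar_jmathBar T φ _ hι' hφ' g

end Localize

/-! ### Sequential continuity of localized currents on homogeneous polylipschitz functions -/

section Convergence

variable {X Z : Type u} [MetricSpace X] [MetricSpace Z] {k : ℕ}

theorem LIP.abs_le_supNorm_restrict (f : LIP Z) {V : Set Z} {x : Z} (hx : x ∈ V) :
    |f x| ≤ supNorm fun y : V => f y :=
  le_ciSup (f := fun y : V => |f y|)
    ⟨‖f‖, by rintro _ ⟨y, rfl⟩; exact f.abs_le_norm _⟩ ⟨x, hx⟩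

theorem LIP.supNorm_restrict_le (f : LIP Z) (V : Set Z) : (supNorm fun y : V => f y) ≤ ‖f‖ :=
  supNorm_le (norm_nonneg f) fun y => f.abs_le_norm y

theorem LIP.supNorm_restrict_nonneg (f : LIP Z) (V : Set Z) : 0 ≤ supNorm fun y : V => f y :=
  Real.iSup_nonneg fun _ => abs_nonneg _

/-- Localized currents are sequentially continuous on homogeneous polylipschitz functions. -/
theorem tendsto_localizeBar (T : Current k X) (φ : LIPc X) (e : Z → X) (he : Isometry e)
    (hφ : tsupport φ.1 ⊆ range e) (cs : ℕ → PolyBar k Z) (h : PolyBarTendsto cs 0) :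
    Tendsto (fun n => localizeBar T φ e he hφ (cs n)) atTop (𝓝 0) := by
  obtain ⟨ρs, ρ, hρs, hρ, hP⟩ := h
  obtain ⟨p, hp, ⟨t, ht, hpt⟩, hlim⟩ := hP (fun _ => e ⁻¹' tsupport φ.1) fun _ =>
    (he.isEmbedding.isInducing.isCompact_preimage_iff hφ).2 φ.2
  obtain ⟨C, hC⟩ := exists_bound_localize T φ
  choose G hG hGn using fun n j i => LIP.exists_extension e he (p n j i)
  have hGp : ∀ n j, (fun i => LIP.comp e he.lipschitz (G n j i)) = p n j := fun n j =>
    funext fun i => LIP.ext (hG n j i)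
  have hGt : ∀ n j, ∏ i, ‖G n j i‖ ≤ t j := fun n j =>
    (Finset.prod_le_prod (fun _ _ => norm_nonneg _) fun i _ => hGn n j i).trans (hpt j n)
  have hsum : ∀ n, HasSum (fun j => localize T.1 φ (G n j)) (localizeBar T φ e he hφ (cs n)) :=
    fun n => by
      have h1 := ((localizeBar T φ e he hφ).comp (Q k Z)).hasSum (hp n).2
      rw [map_sub, ContinuousLinearMap.comp_apply, ContinuousLinearMap.comp_apply, hρs, hρ,
        map_zero, sub_zero] at h1
      convert h1 using 2 with j
      rw [← localizeBar_jmathBar T φ e he hφ, hGp]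
      rfl
  have hbound : ∀ n j, ‖localize T.1 φ (G n j)‖ ≤ max C 0 * t j := fun n j =>
    ((hC _).trans (mul_le_mul_of_nonneg_right (le_max_left C 0)
      (Finset.prod_nonneg fun _ _ => norm_nonneg _))).trans
      (mul_le_mul_of_nonneg_left (hGt n j) (le_max_right _ _))
  have hsup0 : ∀ n j, 0 ≤ ∏ i, supNorm fun x : e ⁻¹' tsupport φ.1 => p n j i x := fun n j =>
    Finset.prod_nonneg fun _ _ => LIP.supNorm_restrict_nonneg _ _
  have hsups : ∀ n, Summable fun j => ∏ i, supNorm fun x : e ⁻¹' tsupport φ.1 => p n j i x :=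
    fun n => Summable.of_nonneg_of_le (hsup0 n) (fun j => (Finset.prod_le_prod
      (fun _ _ => LIP.supNorm_restrict_nonneg _ _) fun i _ =>
        LIP.supNorm_restrict_le _ _).trans (hpt j n)) ht
  -- For fixed `j` the product of sup norms is one nonnegative term of a sum tending to zero, so the
  -- values on `spt φ` satisfy the hypothesis of `tendsto_localize_zero`.
  have hj : ∀ j, Tendsto (fun n => localize T.1 φ (G n j)) atTop (𝓝 0) := fun j => by
    refine tendsto_localize_zero T φ (fun n => G n j) (t j) (fun n => hGt n j) fun x hx => ?_
    choose z hz using fun i => hφ (hx i)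
    refine squeeze_zero_norm (fun n => ?_) hlim
    refine le_trans ?_ ((hsups n).le_tsum j fun j' _ => hsup0 n j')
    rw [norm_prod]
    refine Finset.prod_le_prod (fun _ _ => norm_nonneg _) fun i _ => ?_
    rw [← hz i, hG]
    exact LIP.abs_le_supNorm_restrict _ (by rw [mem_preimage, hz]; exact hx i)
  -- The bounds `max C 0 * t j` do not depend on `n`, so termwise convergence gives convergence of
  -- the sums.
  have := tendsto_tsum_of_dominated_convergence (ht.mul_left (max C 0)) hj
    (Eventually.of_forall fun n => hbound n)
  rw [tsum_zero] at this
  exact this.congr fun n => (hsum n).tsum_eq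

end Convergence

/-! ### Localization over open sets, Lipschitz partitions and dependence on germs -/

section LocalizeOn

variable {X : Type u} [MetricSpace X] {k : ℕ}

/-- The functional `π₀ ⊗ π₁ ⊗ ⋯ ⊗ π_k ↦ T (φ π₀, π₁, …, π_k)` over an open set that contains the support
of `φ`. -/
def localizeOn (T : Current k X) (φ : LIPc X) (U : Opens X) (h : tsupport φ.1 ⊆ U) :
    PolyBar k U →L[ℝ] ℝ :=
  localizeBar T φ (Subtype.val : U → X) isometry_subtype_coe (by rwa [Subtype.range_coe])

theorem localizeOn_tensorOn (T : Current k X) (φ : LIPc X) (U : Opens X) (h : tsupport φ.1 ⊆ U)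
    (g : Fin (k + 1) → LIP X) : localizeOn T φ U h (tensorOn U g) = localize T.1 φ g :=
  localizeBar_jmathBar T φ (Subtype.val : U → X) isometry_subtype_coe _ g

theorem localizeOn_add (T : Current k X) (φ ψ : LIPc X) (U : Opens X) (hφ : tsupport φ.1 ⊆ U)
    (hψ : tsupport ψ.1 ⊆ U) (h : tsupport (φ + ψ).1 ⊆ U) (f : PolyBar k U) :
    localizeOn T (φ + ψ) U h f = localizeOn T φ U hφ f + localizeOn T ψ U hψ f :=
  DFunLike.congr_fun (localizeBar_add T φ ψ _ _ _ _ _) f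

theorem localizeOn_res (T : Current k X) (φ : LIPc X) {U V : Opens X} (hUV : U ≤ V)
    (hU : tsupport φ.1 ⊆ U) (hV : tsupport φ.1 ⊆ V) (f : PolyBar k V) :
    localizeOn T φ U hU (res k hUV f) = localizeOn T φ V hV f :=
  localizeBar_comp T φ (Subtype.val : V → X) isometry_subtype_coe _ (Set.inclusion hUV)
    (LipschitzWith.mk_one fun _ _ => le_rfl) isometry_subtype_coe _ f

theorem localizeOn_zero (T : Current k X) (U : Opens X) (h : tsupport (0 : LIPc X).1 ⊆ U)
    (f : PolyBar k U) : localizeOn T 0 U h f = 0 := by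
  have := localizeOn_add T 0 0 U h h (by simpa using h) f
  simpa using this

variable [LocallyCompactSpace X]

/-- Lipschitz cut-off functions that are `1` in a neighbourhood of a compact set. -/
theorem exists_cutoff_nhds {K V : Set X} (hK : IsCompact K) (hV : IsOpen V) (hKV : K ⊆ V) :
    ∃ f : LIPc X, (∀ x ∈ K, ∀ᶠ y in 𝓝 x, f.1 y = 1) ∧ tsupport f.1 ⊆ V := by
  obtain ⟨L, hL, hKL, hLV⟩ := exists_compact_between hK hV hKV
  obtain ⟨f, hf, hfV⟩ := exists_cutoff hL hV hLV
  refine ⟨f, fun x hx => ?_, hfV⟩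
  filter_upwards [isOpen_interior.mem_nhds (hKL hx)] with y hy
  exact hf y (interior_subset hy)

/-- Partition of a Lipschitz function with compact support along a finite open cover, as an induction
principle. -/
theorem LIPc.induction_finset {ι : Type*} (K : Set X) (P : LIPc X → Prop) (zero : P 0)
    (add : ∀ φ ψ : LIPc X, tsupport φ.1 ⊆ K → tsupport ψ.1 ⊆ K → P φ → P ψ → P (φ + ψ))
    (s : Finset ι) (D : ι → Set X) (hD : ∀ i ∈ s, IsOpen (D i))
    (hP : ∀ i ∈ s, ∀ φ : LIPc X, tsupport φ.1 ⊆ K → tsupport φ.1 ⊆ D i → P φ) (φ : LIPc X)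
    (hφ : tsupport φ.1 ⊆ K) (hs : tsupport φ.1 ⊆ ⋃ i ∈ s, D i) : P φ := by
  classical
  induction s using Finset.induction_on generalizing φ with
  | empty =>
    have h0 : tsupport φ.1 = ∅ := subset_empty_iff.1 (by simpa using hs)
    have : φ = 0 := LIPc.ext fun x => congrFun (tsupport_eq_empty_iff.1 h0) x
    rw [this]
    exact zero
  | insert a s ha ih =>
    rw [Finset.set_biUnion_insert] at hs
    have ho : IsOpen (⋃ i ∈ s, D i) := isOpen_biUnion fun i hi => hD i (Finset.mem_insert_of_mem hi)
    -- Split `φ = ψφ + (φ - ψφ)` with `spt ψ ⊆ D a` and `ψ = 1` near the part of `spt φ` missed by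
    -- the other sets. Since supports are closures, `ψ` must equal `1` on a neighbourhood for the
    -- second summand to be supported in the other sets.
    obtain ⟨ψ, hψ1, hψa⟩ := exists_cutoff_nhds (φ.2.diff ho)
      (hD a (Finset.mem_insert_self a s)) (fun x hx => (hs hx.1).resolve_right hx.2)
    have h1 : tsupport (mulc ψ φ.1).1 ⊆ tsupport φ.1 := tsupport_mulc_subset_right _ _
    have h2 : tsupport (φ - mulc ψ φ.1).1 ⊆ tsupport φ.1 := by
      refine closure_mono fun x hx h => hx ?_
      show φ.1 x - ψ.1 x * φ.1 x = 0
      rw [h, mul_zero, sub_zero]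
    have h3 : tsupport (φ - mulc ψ φ.1).1 ⊆ ⋃ i ∈ s, D i := fun x hx => by
      by_contra hxs
      refine notMem_tsupport_iff_eventuallyEq.2 ?_ hx
      filter_upwards [hψ1 x ⟨h2 hx, hxs⟩] with y hy
      show φ.1 y - ψ.1 y * φ.1 y = 0
      rw [hy, one_mul, sub_self]
    have h := add (mulc ψ φ.1) (φ - mulc ψ φ.1) (h1.trans hφ) (h2.trans hφ)
      (hP a (Finset.mem_insert_self a s) _ (h1.trans hφ) ((tsupport_mulc_subset _ _).trans hψa))
      (ih (fun i hi => hD i (Finset.mem_insert_of_mem hi))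
        (fun i hi => hP i (Finset.mem_insert_of_mem hi)) _ (h2.trans hφ) h3)
    rwa [add_sub_cancel] at h

/-- A property of Lipschitz functions with support in a compact set that is closed under addition holds
if it holds locally. -/
theorem LIPc.induction {K : Set X} (hK : IsCompact K) (P : LIPc X → Prop) (zero : P 0)
    (add : ∀ φ ψ : LIPc X, tsupport φ.1 ⊆ K → tsupport ψ.1 ⊆ K → P φ → P ψ → P (φ + ψ))
    (hP : ∀ x ∈ K, ∃ D : Set X, IsOpen D ∧ x ∈ D ∧
      ∀ φ : LIPc X, tsupport φ.1 ⊆ K → tsupport φ.1 ⊆ D → P φ) (φ : LIPc X)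
    (hφ : tsupport φ.1 ⊆ K) : P φ := by
  choose! D hDo hxD hDP using hP
  obtain ⟨s, hsK, hs⟩ := hK.elim_nhds_subcover D fun x hx => (hDo x hx).mem_nhds (hxD x hx)
  exact LIPc.induction_finset K P zero add s D (fun x hx => hDo x (hsK x hx))
    (fun x hx => hDP x (hsK x hx)) φ hφ (hφ.trans hs)

/-- A localized current vanishes on the elements whose germs at the points of the support of the
localizing function vanish. -/
theorem localizeOn_eq_zero (T : Current k X) (φ : LIPc X) (U : Opens X) (h : tsupport φ.1 ⊆ U)
    (f : PolyBar k U) (hf : ∀ x (hx : x ∈ U), x ∈ tsupport φ.1 → germ U x hx f = 0) :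
    localizeOn T φ U h f = 0 := by
  -- A vanishing germ means a vanishing restriction to a small open set, so the claim holds for
  -- localizing functions with small support; additivity in `φ` does the rest.
  refine LIPc.induction (K := tsupport φ.1) φ.2
    (fun ψ => ∀ hψ : tsupport ψ.1 ⊆ U, localizeOn T ψ U hψ f = 0)
    (fun hψ => localizeOn_zero T U hψ f) (fun ψ χ hψ hχ h1 h2 h3 => ?_) (fun x hx => ?_) φ
    Subset.rfl h
  · rw [localizeOn_add T ψ χ U (hψ.trans h) (hχ.trans h), h1, h2, add_zero]
  · have h0 : germ U x (h hx) f = germ U x (h hx) 0 := (hf x (h hx) hx).trans (map_zero _).symm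
    obtain ⟨D, hxD, hD1, _, hres⟩ := germ_eq_iff.1 h0
    refine ⟨D, D.isOpen, hxD, fun ψ _ hψD hψ => ?_⟩
    rw [← localizeOn_res T ψ hD1 hψD hψ, hres, map_zero, map_zero]

theorem localizeOn_congr (T : Current k X) (φ : LIPc X) (U : Opens X) (h : tsupport φ.1 ⊆ U)
    (f f' : PolyBar k U) (hf : ∀ x (hx : x ∈ U), germ U x hx f = germ U x hx f') :
    localizeOn T φ U h f = localizeOn T φ U h f' := by
  rw [← sub_eq_zero, ← map_sub]
  exact localizeOn_eq_zero T φ U h _ fun x hx _ => by rw [map_sub, hf, sub_self]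

end LocalizeOn

/-! ### Multiplication of polylipschitz forms by functions -/

section Mul

variable {Y Z : Type u} [MetricSpace Y] [MetricSpace Z] {k : ℕ}

/-- Multiplication by a function in position `0` and the identity in the other positions. -/
def Slot.mul (a : LIP Y) : {k : ℕ} → (i : Fin (k + 1)) → Slot Y i →L[ℝ] Slot Y i
  | _, ⟨0, _⟩ => LIP.mul a
  | _, ⟨_ + 1, _⟩ => ContinuousLinearMap.id ℝ (LIPBar Y)

/-- Multiplication of homogeneous polylipschitz functions by a function,
`π₀ ⊗ π₁ ⊗ ⋯ ⊗ π_k ↦ a π₀ ⊗ π₁ ⊗ ⋯ ⊗ π_k`. -/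
def mulBar (k : ℕ) (a : LIP Y) : PolyBar k Y →L[ℝ] PolyBar k Y :=
  (PiTensorProduct.mapL fun i : Fin (k + 1) => Slot.mul a i).completion

theorem mulBar_jmathBar (a : LIP Y) (f : Fin (k + 1) → LIP Y) :
    mulBar k a (jmathBar f) = jmathBar (Fin.cons (LIP.mul a (f 0)) (Fin.tail f)) := by
  rw [jmathBar_eq, jmathBar_eq]
  simp only [mulBar, ContinuousLinearMap.completion_apply_coe, PiTensorProduct.mapL_apply,
    PiTensorProduct.map_tprod]
  congr 1
  refine congrArg (PiTensorProduct.tprod ℝ) (funext fun i => ?_)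
  cases i using Fin.cases <;> rfl

theorem comp_mulBar (φ : Z → Y) (hφ : LipschitzWith 1 φ) (a : LIP Y) (f : PolyBar k Y) :
    PolyBar.comp φ hφ k (mulBar k a f) = mulBar k (LIP.comp φ hφ a) (PolyBar.comp φ hφ k f) := by
  refine DFunLike.congr_fun (F := PolyBar k Y →L[ℝ] PolyBar k Z)
    (f := (PolyBar.comp φ hφ k).comp (mulBar k a))
    (g := (mulBar k (LIP.comp φ hφ a)).comp (PolyBar.comp φ hφ k)) (PolyBar.hom_ext fun g => ?_) f
  simp only [ContinuousLinearMap.comp_apply, mulBar_jmathBar, PolyBar.comp_jmathBar]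
  congr 1
  funext i
  cases i using Fin.cases <;> rfl

/-- Homogeneous elementary tensors as a multilinear map. -/
def jmathBarMulti (k : ℕ) (Y : Type u) [MetricSpace Y] :
    MultilinearMap ℝ (fun _ : Fin (k + 1) => LIP Y) (PolyBar k Y) :=
  (Q k Y).toLinearMap.compMultilinearMap (jmathMulti k Y)

theorem mulBar_add (a b : LIP Y) : mulBar k (a + b) = mulBar k a + mulBar k b := by
  refine PolyBar.hom_ext fun f => ?_
  rw [add_apply, mulBar_jmathBar, mulBar_jmathBar, mulBar_jmathBar]
  have h : LIP.mul (a + b) (f 0) = LIP.mul a (f 0) + LIP.mul b (f 0) :=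
    LIP.ext fun x => add_mul _ _ _
  rw [h]
  exact (jmathBarMulti k Y).cons_add (Fin.tail f) _ _

theorem mulBar_one (a : LIP Y) (h : ∀ x, a x = 1) (f : PolyBar k Y) : mulBar k a f = f := by
  refine DFunLike.congr_fun (F := PolyBar k Y →L[ℝ] PolyBar k Y)
    (g := ContinuousLinearMap.id ℝ _) (PolyBar.hom_ext fun g => ?_) f
  have h' : LIP.mul a (g 0) = g 0 := LIP.ext fun x => by rw [LIP.mul_apply, h, one_mul]
  rw [mulBar_jmathBar, h', Fin.cons_self_tail]
  rfl

theorem mulBar_zero (f : PolyBar k Y) : mulBar k (0 : LIP Y) f = 0 := by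
  have := DFunLike.congr_fun (mulBar_add (k := k) (0 : LIP Y) 0) f
  simpa using this

end Mul

section MulStalk

variable {X : Type u} [MetricSpace X] {k : ℕ}

theorem res_mulBar {U V : Opens X} (h : U ≤ V) (a : LIP X) (f : PolyBar k V) :
    res k h (mulBar k (restrict V a) f) = mulBar k (restrict U a) (res k h f) :=
  comp_mulBar _ _ _ f

/-- Multiplication by a function on stalks, `[f]_x ↦ [a f]_x`. -/
def mulStalk (a : LIP X) (x : X) : Stalk k x →ₗ[ℝ] Stalk k x :=
  DirectLimit.Module.lift ℝ (OpenNhdsOf x)ᵒᵈ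
    (fun U : (OpenNhdsOf x)ᵒᵈ => PolyBar k (OrderDual.ofDual U).toOpens)
    (fun U V h => nhdsRes k x U V h)
    (fun U => (germ (OrderDual.ofDual U).toOpens x (OrderDual.ofDual U).mem).comp
      (mulBar k (restrict (OrderDual.ofDual U).toOpens a)).toLinearMap)
    fun U V h p => by
      have h' : (OrderDual.ofDual V).toOpens ≤ (OrderDual.ofDual U).toOpens := h
      exact (congrArg (germ _ x (OrderDual.ofDual V).mem) (res_mulBar h' a p).symm).trans
        (germ_res h' (OrderDual.ofDual V).mem (mulBar k _ p))

theorem mulStalk_germ (a : LIP X) {U : Opens X} {x : X} (hx : x ∈ U) (f : PolyBar k U) :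
    mulStalk a x (germ U x hx f) = germ U x hx (mulBar k (restrict U a) f) := rfl

theorem mulStalk_add (a b : LIP X) (x : X) (s : Stalk k x) :
    mulStalk (a + b) x s = mulStalk a x s + mulStalk b x s := by
  obtain ⟨U, hx, f, rfl⟩ := exists_germ s
  rw [mulStalk_germ, mulStalk_germ, mulStalk_germ, ← map_add, map_add (restrict U), mulBar_add]
  rfl

theorem exists_germ_of_eventually {x : X} {p : X → Prop} (hp : ∀ᶠ y in 𝓝 x, p y) (s : Stalk k x) :
    ∃ (U : Opens X) (hx : x ∈ U) (f : PolyBar k U), germ U x hx f = s ∧ ∀ y ∈ U, p y := by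
  obtain ⟨U, hx, f, rfl⟩ := exists_germ s
  obtain ⟨W, hW, hWo, hxW⟩ := mem_nhds_iff.1 hp
  exact ⟨U ⊓ ⟨W, hWo⟩, ⟨hx, hxW⟩, res k inf_le_left f, germ_res _ _ _, fun y hy => hW hy.2⟩

theorem mulStalk_one (a : LIP X) (x : X) (h : ∀ᶠ y in 𝓝 x, a y = 1) (s : Stalk k x) :
    mulStalk a x s = s := by
  obtain ⟨U, hx, f, rfl, hU⟩ := exists_germ_of_eventually h s
  rw [mulStalk_germ, mulBar_one (restrict U a) fun y : U => hU y y.2]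

theorem mulStalk_zero (a : LIP X) (x : X) (h : ∀ᶠ y in 𝓝 x, a y = 0) (s : Stalk k x) :
    mulStalk a x s = 0 := by
  obtain ⟨U, hx, f, rfl, hU⟩ := exists_germ_of_eventually h s
  have h0 : restrict U a = 0 := LIP.ext fun y => hU y y.2
  rw [mulStalk_germ, h0, mulBar_zero, map_zero]

end MulStalk

/-! ### Forms that are sums of series -/

section Series

variable {X : Type u} [MetricSpace X] {k : ℕ}

theorem tensorOn_eq_zero {U : Opens X} {g : Fin (k + 1) → LIP X} (i : Fin (k + 1))
    (h : Slot.q U i (restrict U (g i)) = 0) : tensorOn U g = 0 := by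
  rw [tensorOn, jmathBar_eq, MultilinearMap.map_coord_zero _ i h, UniformSpace.Completion.coe_zero]

theorem tensorOn_cons_eq_zero {U : Opens X} {f : LIP X} {g : Fin k → LIP X} (h : ∀ x ∈ U, f x = 0) :
    tensorOn U (Fin.cons f g : Fin (k + 1) → LIP X) = 0 :=
  tensorOn_eq_zero 0 (LIP.ext fun y => h y y.2)

/-- The form `ω` is given by the absolutely convergent series `∑_j h_j ⊗ g_{j,1} ⊗ ⋯ ⊗ g_{j,k}` of tuples
such that the supports of the functions `h_j` lie in `K`. -/
structure IsSeries (K : Set X) (h : ℕ → LIPc X) (g : ℕ → Fin k → LIP X) (ω : PolyForm k X) : Prop where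
  support : ∀ j, tsupport (h j).1 ⊆ K
  summable : Summable fun j => ‖(h j).1‖ * ∏ i, ‖g j i‖
  germ_eq : ∀ x, ω.1 x = germ ⊤ x (Opens.mem_top x)
    (∑' j, tensorOn ⊤ (Fin.cons (h j).1 (g j) : Fin (k + 1) → LIP X))

theorem prod_norm_cons (h : LIP X) (g : Fin k → LIP X) :
    ∏ i, ‖(Fin.cons h g : Fin (k + 1) → LIP X) i‖ = ‖h‖ * ∏ i, ‖g i‖ := by
  simp [Fin.prod_univ_succ]

theorem prod_norm_restrict_le (U : Opens X) (g : Fin (k + 1) → LIP X) :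
    ∏ i, ‖restrict U (g i)‖ ≤ ∏ i, ‖g i‖ :=
  Finset.prod_le_prod (fun _ _ => norm_nonneg _) fun _ _ => LIP.norm_comp_le _ _ _

theorem summable_tensorOn {U : Opens X} {g : ℕ → Fin (k + 1) → LIP X}
    (hg : Summable fun j => ∏ i, ‖g j i‖) : Summable fun j => tensorOn U (g j) :=
  (Q k U).summable (summable_jmath (Summable.of_nonneg_of_le
    (fun _ => Finset.prod_nonneg fun _ _ => norm_nonneg _) (fun j => prod_norm_restrict_le U (g j)) hg))

theorem res_tsum_tensorOn {U : Opens X} {g : ℕ → Fin (k + 1) → LIP X}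
    (hg : Summable fun j => ∏ i, ‖g j i‖) :
    res k (le_top : U ≤ ⊤) (∑' j, tensorOn ⊤ (g j)) = ∑' j, tensorOn U (g j) := by
  rw [ContinuousLinearMap.map_tsum _ (summable_tensorOn hg)]
  simp only [res_tensorOn]

theorem mulBar_tensorOn (U : Opens X) (φ : LIPc X) (g : Fin (k + 1) → LIP X) :
    mulBar k (restrict U φ.1) (tensorOn U g) =
      tensorOn U (Fin.cons (mulc φ (g 0)).1 (Fin.tail g)) := by
  rw [tensorOn, mulBar_jmathBar, tensorOn]
  congr 1
  funext i
  cases i using Fin.cases <;> rfl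

/-- For every element `f` over an open set `U` there is a form that is the sum of a series, agrees with
`φ f` over `U` and vanishes outside of the support of `φ`. -/
theorem exists_isSeries (φ : LIPc X) (U : Opens X) (f : PolyBar k U) :
    ∃ (h : ℕ → LIPc X) (g : ℕ → Fin k → LIP X) (ω : PolyForm k X),
      IsSeries (tsupport φ.1) h g ω ∧
      (∀ x (hx : x ∈ U), ω.1 x = germ U x hx (mulBar k (restrict U φ.1) f)) ∧
      ∀ x ∉ tsupport φ.1, ω.1 x = 0 := by
  obtain ⟨p, hp, hpf⟩ := exists_hasSum_jmathBar f
  choose G hG hGn using fun j i =>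
    LIP.exists_extension (Subtype.val : U → X) isometry_subtype_coe (p j i)
  have hGp : ∀ j, tensorOn U (G j) = jmathBar (p j) := fun j =>
    congrArg jmathBar (funext fun i => LIP.ext (hG j i))
  -- The extensions of the entries of `f` to `X` are arbitrary outside `U`. Multiplying position `0`
  -- by `φ` makes every term vanish off `spt φ`, and over `U` it gives `φ f`.
  let H : ℕ → Fin (k + 1) → LIP X := fun j => Fin.cons (mulc φ (G j 0)).1 (Fin.tail (G j))
  have hH : ∀ j, ∏ i, ‖H j i‖ = ‖(mulc φ (G j 0)).1‖ * ∏ i, ‖Fin.tail (G j) i‖ := fun j =>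
    prod_norm_cons _ _
  have hHs : Summable fun j => ∏ i, ‖H j i‖ := by
    refine Summable.of_nonneg_of_le (fun _ => Finset.prod_nonneg fun _ _ => norm_nonneg _)
      (fun j => ?_) (hp.mul_left (2 * ‖φ.1‖))
    have h1 : ∏ i, ‖G j i‖ ≤ ∏ i, ‖p j i‖ :=
      Finset.prod_le_prod (fun _ _ => norm_nonneg _) fun i _ => hGn j i
    rw [hH]
    refine le_trans ?_ (mul_le_mul_of_nonneg_left h1 (by positivity))
    rw [Fin.prod_univ_succ, ← mul_assoc]
    exact mul_le_mul_of_nonneg_right (LIP.norm_mul_le _ _)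
      (Finset.prod_nonneg fun _ _ => norm_nonneg _)
  let r : PolyBar k (⊤ : Opens X) := ∑' j, tensorOn ⊤ (H j)
  have hU : res k (le_top : U ≤ ⊤) r = mulBar k (restrict U φ.1) f := by
    have h1 := (mulBar k (restrict U φ.1)).hasSum hpf
    rw [res_tsum_tensorOn hHs, ← h1.tsum_eq]
    refine tsum_congr fun j => ?_
    rw [← hGp, mulBar_tensorOn]
  have h0 : ∀ x ∉ tsupport φ.1, germ ⊤ x (Opens.mem_top x) r = 0 := fun x hx => by
    let D : Opens X := ⟨(tsupport φ.1)ᶜ, (isClosed_tsupport _).isOpen_compl⟩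
    rw [← germ_res (le_top : D ≤ ⊤) hx, res_tsum_tensorOn hHs]
    have : ∀ j, tensorOn D (H j) = 0 := fun j => tensorOn_cons_eq_zero fun y hy =>
      image_eq_zero_of_notMem_tsupport fun hy' => hy (tsupport_mulc_subset _ _ hy')
    simp only [this, tsum_zero, map_zero]
  refine ⟨fun j => mulc φ (G j 0), fun j => Fin.tail (G j),
    ⟨fun x => germ ⊤ x (Opens.mem_top x) r,
      (continuous_section_iff _).2 fun x => ⟨⊤, r, Opens.mem_top x, fun _ _ => rfl⟩,
      φ.2.of_isClosed_subset isClosed_closure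
        (closure_minimal (fun x hx => by_contra fun hx' => hx (h0 x hx')) (isClosed_tsupport _))⟩,
    ⟨fun j => tsupport_mulc_subset _ _, ?_, fun x => rfl⟩, fun x hx => ?_, h0⟩
  · simpa only [hH] using hHs
  · show germ ⊤ x (Opens.mem_top x) r = _
    rw [← hU, germ_res]

variable [LocallyCompactSpace X]

/-- Every polylipschitz form with compact support is a finite sum of forms that are given by series. -/
theorem mem_span_isSeries (ω : PolyForm k X) :
    ω ∈ Submodule.span ℝ {η : PolyForm k X | ∃ K h g, IsCompact K ∧ IsSeries K h g η} := by
  obtain ⟨φ, hφ, -⟩ := exists_cutoff_nhds ω.2.2 isOpen_univ (subset_univ _)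
  let S := Submodule.span ℝ {η : PolyForm k X | ∃ K h g, IsCompact K ∧ IsSeries K h g η}
  -- Since `φ = 1` near `spt ω`, the form `φω` is `ω`. Partitioning `φ` reduces to cut-offs
  -- supported where one element `f` represents `ω`; there `exists_isSeries` applies.
  have key : ∃ η ∈ S, ∀ x, η.1 x = mulStalk φ.1 x (ω.1 x) := by
    refine LIPc.induction φ.2 (fun ψ => ∃ η ∈ S, ∀ x, η.1 x = mulStalk ψ.1 x (ω.1 x)) ?_ ?_ ?_ φ
      Subset.rfl
    · exact ⟨0, S.zero_mem, fun x =>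
        (mulStalk_zero _ _ (Eventually.of_forall fun _ => rfl) _).symm⟩
    · rintro ψ χ - - ⟨η, hη, hη'⟩ ⟨θ, hθ, hθ'⟩
      refine ⟨η + θ, S.add_mem hη hθ, fun x => ?_⟩
      show η.1 x + θ.1 x = mulStalk (ψ.1 + χ.1) x _
      rw [mulStalk_add, hη', hθ']
    · intro x _
      obtain ⟨U, f, hx, hf⟩ := (continuous_section_iff _).1 ω.2.1 x
      refine ⟨U, U.isOpen, hx, fun ψ _ hψ => ?_⟩
      obtain ⟨h, g, η, hη, h1, h2⟩ := exists_isSeries ψ U f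
      refine ⟨η, Submodule.subset_span ⟨_, h, g, ψ.2, hη⟩, fun y => ?_⟩
      by_cases hy : y ∈ tsupport ψ.1
      · rw [h1 y (hψ hy), hf y (hψ hy), mulStalk_germ]
      · rw [h2 y hy, mulStalk_zero]
        exact notMem_tsupport_iff_eventuallyEq.1 hy
  obtain ⟨η, hη, hη'⟩ := key
  have : η = ω := Subtype.ext (funext fun x => by
    rw [hη']
    by_cases hx : ω.1 x = 0
    · rw [hx, map_zero]
    · exact mulStalk_one _ _ (hφ x (subset_closure hx)) _)
  rwa [this] at hη

/-- Every polylipschitz form with compact support is given by an element over the whole space. -/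
theorem exists_global (ω : PolyForm k X) :
    ∃ r : PolyBar k (⊤ : Opens X), ∀ x, ω.1 x = germ ⊤ x (Opens.mem_top x) r := by
  induction mem_span_isSeries ω using Submodule.span_induction with
  | mem η h =>
    obtain ⟨K, h, g, -, hη⟩ := h
    exact ⟨_, hη.germ_eq⟩
  | zero => exact ⟨0, fun x => (map_zero _).symm⟩
  | add η θ _ _ ih1 ih2 =>
    obtain ⟨r, hr⟩ := ih1
    obtain ⟨s, hs⟩ := ih2
    exact ⟨r + s, fun x => by rw [map_add, ← hr, ← hs]; rfl⟩
  | smul c η _ ih =>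
    obtain ⟨r, hr⟩ := ih
    exact ⟨c • r, fun x => by rw [map_smul, ← hr]; rfl⟩

/-! ### Extension of currents to polylipschitz forms -/

/-- The function `φ - ψ` vanishes near every point where the germ of `r` is nonzero, so `r` has zero
germs on `spt (φ - ψ)` and `localizeOn_eq_zero` applies. This makes the extension independent of the
cut-off and of the representative. -/
theorem localizeOn_top_congr (T : Current k X) (φ ψ : LIPc X) (r s : PolyBar k (⊤ : Opens X))
    (hrs : ∀ x, germ ⊤ x (Opens.mem_top x) r = germ ⊤ x (Opens.mem_top x) s)
    (h : ∀ x, germ ⊤ x (Opens.mem_top x) r ≠ 0 → ∀ᶠ y in 𝓝 x, φ.1 y = ψ.1 y) :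
    localizeOn T φ ⊤ (subset_univ _) r = localizeOn T ψ ⊤ (subset_univ _) s := by
  rw [← localizeOn_congr T ψ ⊤ (subset_univ _) r s fun x _ => hrs x]
  have h1 : localizeOn T (φ - ψ) ⊤ (subset_univ _) r = 0 :=
    localizeOn_eq_zero T _ ⊤ _ r fun x _ hx => by
      by_contra h0
      refine notMem_tsupport_iff_eventuallyEq.2 ?_ hx
      filter_upwards [h x h0] with y hy
      exact sub_eq_zero.2 hy
  have h2 := localizeOn_add T (φ - ψ) ψ ⊤ (subset_univ _) (subset_univ _) (subset_univ _) r
  rw [h1, zero_add] at h2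
  rw [← h2]
  congr 2
  exact (sub_add_cancel φ ψ).symm

/-- Every current extends to a sequentially continuous functional on polylipschitz forms. -/
theorem exists_extension_current (T : Current k X) :
    ∃ S : FormDual k X, ∀ f g, S.1 (iota f g) = T.1 f g := by
  choose r hr using exists_global (k := k) (X := X)
  choose φ hφ _ using fun ω : PolyForm k X => exists_cutoff_nhds ω.2.2 isOpen_univ (subset_univ _)
  -- The representative and the cut-off are chosen arbitrarily; `hv` then allows any other choice,
  -- in particular one cut-off serving two forms at once in the proof of additivity.
  let v : PolyForm k X → ℝ := fun ω => localizeOn T (φ ω) ⊤ (subset_univ _) (r ω)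
  have hv : ∀ (ω : PolyForm k X) (s : PolyBar k (⊤ : Opens X)) (ψ : LIPc X),
      (∀ x, ω.1 x = germ ⊤ x (Opens.mem_top x) s) →
      (∀ x, ω.1 x ≠ 0 → ∀ᶠ y in 𝓝 x, ψ.1 y = 1) →
      v ω = localizeOn T ψ ⊤ (subset_univ _) s := fun ω s ψ hs hψ => by
    refine localizeOn_top_congr T _ _ _ _ (fun x => by rw [← hr, ← hs]) fun x hx => ?_
    rw [← hr] at hx
    filter_upwards [hφ ω x (subset_closure hx), hψ x hx] with y h1 h2
    rw [h1, h2]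
  let L : PolyForm k X →ₗ[ℝ] ℝ :=
    { toFun := v
      map_add' := fun ω η => by
        obtain ⟨ψ, hψ, -⟩ := exists_cutoff_nhds (ω.2.2.union η.2.2) isOpen_univ (subset_univ _)
        rw [hv ω _ ψ (hr ω) fun x hx => hψ x (Or.inl (subset_closure hx)),
          hv η _ ψ (hr η) fun x hx => hψ x (Or.inr (subset_closure hx)), ← map_add]
        refine hv _ _ _ (fun x => ?_) fun x hx => hψ x ?_
        · rw [map_add, ← hr, ← hr]; rfl
        · by_contra h0
          rw [mem_union, not_or] at h0
          refine hx ?_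
          have h1 : ω.1 x = 0 := by_contra fun h => h0.1 (subset_closure h)
          have h2 : η.1 x = 0 := by_contra fun h => h0.2 (subset_closure h)
          show ω.1 x + η.1 x = 0
          rw [h1, h2, add_zero]
      map_smul' := fun c ω => by
        have h := hv (c • ω) (c • r ω) (φ ω) (fun x => by rw [map_smul, ← hr]; rfl) fun x hx =>
          hφ ω x (subset_closure fun h0 => hx (by
            show c • ω.1 x = 0
            rw [h0, smul_zero]))
        rw [h, map_smul]
        rfl }
  refine ⟨⟨L, fun ωs ω h => ?_⟩, fun f g => ?_⟩
  · obtain ⟨K, 𝒰, c, hK, h𝒰, hc, hsupp, hlim⟩ := h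
    obtain ⟨ψ, hψ, -⟩ := exists_cutoff_nhds hK isOpen_univ (subset_univ _)
    suffices hL : Tendsto (fun n => L (ωs n - ω)) atTop (𝓝 0) by
      simpa using (hL.add_const (L ω)).congr fun n => by rw [map_sub, sub_add_cancel]
    have e : ∀ n, L (ωs n - ω) = localizeOn T ψ ⊤ (subset_univ _) (r (ωs n - ω)) := fun n =>
      hv _ _ _ (hr _) fun x hx => hψ x (hsupp n (subset_closure hx))
    simp only [e]
    -- The data `c n` converge only on members of the cover, so `ψ` is reduced to functions
    -- supported in one member `U`; there the global representative may be replaced by `c n U`.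
    refine LIPc.induction ψ.2 (fun χ => Tendsto (fun n =>
      localizeOn T χ ⊤ (subset_univ _) (r (ωs n - ω))) atTop (𝓝 0)) ?_ ?_ ?_ ψ Subset.rfl
    · simp only [localizeOn_zero]
      exact tendsto_const_nhds
    · intro χ θ _ _ h1 h2
      have := h1.add h2
      rw [add_zero] at this
      exact this.congr fun n => (localizeOn_add T χ θ ⊤ _ _ _ _).symm
    · intro x _
      obtain ⟨U, hU, hx⟩ := h𝒰.covers x
      refine ⟨U, U.isOpen, hx, fun χ _ hχ => ?_⟩
      refine (tendsto_localizeBar T χ (Subtype.val : U → X) isometry_subtype_coe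
        (by rwa [Subtype.range_coe]) _ (hlim U hU)).congr fun n => ?_
      rw [← localizeOn_res T χ (le_top : U ≤ ⊤) hχ]
      refine localizeOn_congr T χ U hχ _ _ fun y hy => ?_
      rw [germ_res, ← hr]
      -- Compatibility gives the germ at `y` only through some member `V`, possibly different from
      -- `U`; the overlap condition transfers it to `U`.
      obtain ⟨V, hV, hyV, hyc⟩ := (hc n).compatible y
      have hyUV : y ∈ U ⊓ V := ⟨hy, hyV⟩
      rw [hyc, ← germ_res (inf_le_left : U ⊓ V ≤ U) hyUV, (hc n).overlap U hU V hV ⟨y, hy, hyV⟩, germ_res]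
  · obtain ⟨ψ, hψ, -⟩ := exists_cutoff_nhds f.2 isOpen_univ (subset_univ _)
    have h0 : ∀ x ∉ tsupport f.1, (iota f g).1 x = 0 := fun x hx => by
      let D : Opens X := ⟨(tsupport f.1)ᶜ, (isClosed_tsupport _).isOpen_compl⟩
      show germ ⊤ x _ _ = 0
      rw [← germ_res (le_top : D ≤ ⊤) hx, res_tensorOn, tensorOn_cons_eq_zero fun y hy =>
        image_eq_zero_of_notMem_tsupport hy, map_zero]
    have h1 := hv (iota f g) (tensorOn ⊤ (Fin.cons f.1 g)) ψ (fun x => rfl) fun x hx => hψ x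
      (by_contra fun h => hx (h0 x h))
    refine h1.trans ?_
    rw [localizeOn_tensorOn, localize_cons]
    congr 1
    refine congrArg T.1 (LIPc.ext fun x => ?_)
    rw [mulc_apply]
    by_cases hx : x ∈ tsupport f.1
    · rw [(hψ x hx).self_of_nhds, one_mul]
    · rw [image_eq_zero_of_notMem_tsupport hx, mul_zero]

end Series

/-! ### Convergent sequences of polylipschitz forms -/

section FormConvergence

variable {X Y : Type u} [MetricSpace X] [MetricSpace Y] {k : ℕ}

/-- Paracompactness of metric spaces refines a cover by precompact neighbourhoods to a locally
finite one. -/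
theorem exists_isPrecompactCover (X : Type u) [MetricSpace X] [LocallyCompactSpace X] :
    ∃ 𝒰 : Set (Opens X), IsPrecompactCover 𝒰 := by
  have h : ∀ x : X, ∃ U : Set X, IsOpen U ∧ x ∈ U ∧ IsCompact (closure U) := fun x => by
    obtain ⟨K, hK, hxK⟩ := exists_compact_mem_nhds x
    exact ⟨interior K, isOpen_interior, mem_interior_iff_mem_nhds.2 hxK,
      hK.of_isClosed_subset isClosed_closure (closure_minimal interior_subset hK.isClosed)⟩
  choose U hU hxU hUc using h
  obtain ⟨v, hv, hcov, hfin, hvU⟩ := precise_refinement U hU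
    (iUnion_eq_univ_iff.2 fun x => ⟨x, hxU x⟩)
  let w : X → Opens X := fun x => ⟨v x, hv x⟩
  refine ⟨range w, ?_, fun x => ?_, ?_⟩
  · choose s hs using fun W : range w => W.2
    have hinj : Function.Injective s := fun W W' h => Subtype.ext (by rw [← hs, ← hs, h])
    refine (hfin.comp_injective hinj).subset fun W => ?_
    rw [← hs W]
    exact Subset.rfl
  · obtain ⟨y, hy⟩ := iUnion_eq_univ_iff.1 hcov x
    exact ⟨w y, mem_range_self y, hy⟩
  · rintro _ ⟨x, rfl⟩
    exact (hUc x).of_isClosed_subset isClosed_closure (closure_mono (hvU x))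

/-- Forms whose differences are given by elements over the whole space converge if these elements
converge over the precompact open sets. -/
theorem formTendsto_of_global [LocallyCompactSpace X] {ωs : ℕ → PolyForm k X} {ω : PolyForm k X}
    {K : Set X} (hK : IsCompact K) (r : ℕ → PolyBar k (⊤ : Opens X))
    (hr : ∀ n x, (ωs n - ω).1 x = germ ⊤ x (Opens.mem_top x) (r n))
    (hsupp : ∀ n, ∀ x ∉ K, (ωs n - ω).1 x = 0)
    (hlim : ∀ U : Opens X, IsCompact (closure (U : Set X)) →
      PolyBarTendsto (fun n => res k (le_top : U ≤ ⊤) (r n)) 0) : FormTendsto ωs ω := by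
  obtain ⟨𝒰, h𝒰⟩ := exists_isPrecompactCover X
  refine ⟨K, 𝒰, fun n U => res k le_top (r n), hK, h𝒰, fun n => ⟨fun x => ?_, fun U _ V _ _ => ?_⟩,
    fun n => closure_minimal (fun x hx => by_contra fun hx' => hx (hsupp n x hx')) hK.isClosed,
    fun U hU => hlim U (h𝒰.precompact U hU)⟩
  · obtain ⟨U, hU, hx⟩ := h𝒰.covers x
    exact ⟨U, hU, hx, by rw [germ_res, hr]⟩
  · rw [res_res, res_res]

/-- A criterion for convergence to zero in terms of representing series. -/
theorem polyBarTendsto_zero_of_series {πs : ℕ → PolyBar k Y} (p : ℕ → ℕ → Fin (k + 1) → LIP Y)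
    (t : ℕ → ℝ) (ht : Summable t) (hpt : ∀ n j, ∏ i, ‖p n j i‖ ≤ t j)
    (hp : ∀ n, HasSum (fun j => jmathBar (p n j)) (πs n))
    (hlim : ∀ V : Fin (k + 1) → Set Y,
      Tendsto (fun n => ∑' j, ∏ i, supNorm fun x : V i => p n j i x) atTop (𝓝 0)) :
    PolyBarTendsto πs 0 := by
  have hs : ∀ n, Summable fun j => ∏ i, ‖p n j i‖ := fun n =>
    Summable.of_nonneg_of_le (fun _ => Finset.prod_nonneg fun _ _ => norm_nonneg _) (hpt n) ht
  refine ⟨fun n => ∑' j, jmath (p n j), 0, fun n => ?_, map_zero _, fun V _ => ⟨p, fun n => ?_,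
    ⟨t, ht, fun j n => hpt n j⟩, hlim V⟩⟩
  · exact ((Q k Y).hasSum (summable_jmath (hs n)).hasSum).unique (hp n)
  · rw [sub_zero]
    exact ⟨hs n, (summable_jmath (hs n)).hasSum⟩

theorem prod_supNorm_le (f : Fin (k + 1) → LIP Y) (V : Fin (k + 1) → Set Y) :
    ∏ i, (supNorm fun x : V i => f i x) ≤ ∏ i, ‖f i‖ :=
  Finset.prod_le_prod (fun _ _ => LIP.supNorm_restrict_nonneg _ _) fun _ _ =>
    LIP.supNorm_restrict_le _ _

theorem prod_supNorm_nonneg (f : Fin (k + 1) → LIP Y) (V : Fin (k + 1) → Set Y) :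
    0 ≤ ∏ i, supNorm fun x : V i => f i x :=
  Finset.prod_nonneg fun _ _ => LIP.supNorm_restrict_nonneg _ _

theorem prod_norm_zero : ∏ i, ‖(0 : Fin (k + 1) → LIP Y) i‖ = 0 :=
  Finset.prod_eq_zero (Finset.mem_univ (0 : Fin (k + 1))) norm_zero

theorem prod_supNorm_zero (V : Fin (k + 1) → Set Y) :
    ∏ i, (supNorm fun x : V i => (0 : Fin (k + 1) → LIP Y) i x) = 0 := by
  exact le_antisymm ((prod_supNorm_le _ V).trans_eq prod_norm_zero) (prod_supNorm_nonneg _ V)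

/-- Convergence in `LIP_∞` bounds only the Lipschitz constants. The sup norms over `U` are bounded
because the convergence is uniform on the compact closure of `U`. -/
theorem LIPTendsto.restrict_bounded {fs : ℕ → LIP X} {f : LIP X} (h : LIPTendsto fs f) (U : Opens X)
    (hU : IsCompact (closure (U : Set X))) :
    (∃ B, ∀ n, ‖restrict U (fs n)‖ ≤ B) ∧
      Tendsto (fun n => supNorm (restrict U (fs n) - restrict U f)) atTop (𝓝 0) := by
  have hlim : Tendsto (fun n => supNorm (restrict U (fs n) - restrict U f)) atTop (𝓝 0) := by
    refine Metric.tendsto_atTop.2 fun ε hε => ?_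
    obtain ⟨N, hN⟩ := eventually_atTop.1
      (Metric.tendstoUniformlyOn_iff.1 (h.2 _ hU) (ε / 2) (half_pos hε))
    refine ⟨N, fun n hn => ?_⟩
    rw [Real.dist_eq, sub_zero, abs_of_nonneg (LIP.supNorm_nonneg _)]
    refine (LIP.supNorm_le (half_pos hε).le fun x => ?_).trans_lt (half_lt_self hε)
    have := hN n hn x (subset_closure x.2)
    rw [dist_comm] at this
    exact this.le
  refine ⟨?_, hlim⟩
  obtain ⟨C, hC⟩ := h.1
  obtain ⟨D, hD⟩ := hlim.bddAbove_range
  have hCn : ∀ n, lipConst (fs n) ≤ C := fun n => hC ⟨n, rfl⟩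
  refine ⟨max C (D + ‖f‖), fun n => LIP.norm_le ?_ (fun x y => ?_) fun x => ?_⟩
  · exact (LIP.lipConst_nonneg _).trans ((hCn n).trans (le_max_left _ _))
  · exact ((fs n).abs_sub_le x y).trans
      (mul_le_mul_of_nonneg_right ((hCn n).trans (le_max_left _ _)) dist_nonneg)
  · have h1 : |fs n x - f x| ≤ D :=
      (LIP.abs_le_supNorm (restrict U (fs n) - restrict U f) x).trans (hD ⟨n, rfl⟩)
    have h2 := f.abs_le_norm x
    have h3 := abs_add_le (fs n x - f x) (f x)
    rw [sub_add_cancel] at h3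
    exact le_trans (h3.trans (add_le_add h1 h2)) (le_max_right _ _)

theorem LIPcTendsto.lipTendsto {fs : ℕ → LIPc X} {f : LIPc X} (h : LIPcTendsto fs f) :
    LIPTendsto (fun n => (fs n).1) f.1 :=
  ⟨h.1, fun _ _ => h.2.2.tendstoUniformlyOn⟩

theorem LIPcTendsto.tsupport_subset {fs : ℕ → LIPc X} {f : LIPc X} (h : LIPcTendsto fs f) :
    tsupport f.1 ⊆ closure (⋃ n, tsupport (fs n).1) := by
  refine closure_minimal (fun x hx => ?_) isClosed_closure
  by_contra hx'
  refine hx (tendsto_nhds_unique (h.2.2.tendsto_at x) ?_)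
  have : ∀ n, (fs n).1 x = 0 := fun n => image_eq_zero_of_notMem_tsupport fun h =>
    hx' (subset_closure (mem_iUnion.2 ⟨n, h⟩))
  simp only [this]
  exact tendsto_const_nhds

/-- The elementary tensors of convergent sequences converge over precompact open sets. -/
theorem polyBarTendsto_tensorOn_sub {gs : ℕ → Fin (k + 1) → LIP X} {g : Fin (k + 1) → LIP X}
    (h : ∀ i, LIPTendsto (fun n => gs n i) (g i)) (U : Opens X) (hU : IsCompact (closure (U : Set X))) :
    PolyBarTendsto (fun n => tensorOn U (gs n) - tensorOn U g) 0 := by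
  choose B hB using fun i => ((h i).restrict_bounded U hU).1
  have hlim := fun i => ((h i).restrict_bounded U hU).2
  let M : ℝ := ∑ i, (|B i| + ‖restrict U (g i)‖)
  have hM : ∀ i, |B i| + ‖restrict U (g i)‖ ≤ M := fun i =>
    Finset.single_le_sum (f := fun i => |B i| + ‖restrict U (g i)‖) (fun i _ => by positivity)
      (Finset.mem_univ i)
  -- Telescoping terms: new entries before position `i`, the difference at `i`, old entries after
  -- `i`. The norm `L` of the difference is only bounded; its sup norm tends to zero, which is what
  -- this notion of convergence asks for.
  let q : ℕ → Fin (k + 1) → Fin (k + 1) → LIP U := fun n i l =>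
    if l < i then restrict U (gs n l) else
      if l = i then restrict U (gs n l) - restrict U (g l) else restrict U (g l)
  have hq : ∀ n i l, ‖q n i l‖ ≤ M := fun n i l => by
    have h1 := (hB l n).trans (le_abs_self _)
    have h2 := norm_nonneg (restrict U (g l))
    have h3 := abs_nonneg (B l)
    have h4 := hM l
    simp only [q]
    split_ifs
    · linarith
    · exact (norm_sub_le _ _).trans (by linarith)
    · linarith
  have hM0 : 0 ≤ M := (norm_nonneg _).trans (hq 0 0 0)
  have hqsum : ∀ n, tensorOn U (gs n) - tensorOn U g = ∑ i, jmathBar (q n i) := fun n => by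
    have := (jmathBarMulti k U).map_piecewise_sub_map_piecewise
      (fun i => restrict U (gs n i)) (fun i => restrict U (g i)) 0 Finset.univ
    rw [Finset.piecewise_univ, Finset.piecewise_univ] at this
    simp only [Finset.mem_univ, if_true] at this
    exact this
  -- Representations are infinite series, so the `k + 1` telescoping terms are padded by zero
  -- tuples.
  let p : ℕ → ℕ → Fin (k + 1) → LIP U := fun n j => if hj : j < k + 1 then q n ⟨j, hj⟩ else 0
  have hpq : ∀ n (i : Fin (k + 1)), p n i = q n i := fun n i => dif_pos i.2
  have hp0 : ∀ n j, j ∉ Finset.range (k + 1) → p n j = 0 := fun n j hj =>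
    dif_neg (by simpa using hj)
  refine polyBarTendsto_zero_of_series p (fun j => if j ∈ Finset.range (k + 1) then M ^ (k + 1) else 0)
    (summable_of_ne_finset_zero (s := Finset.range (k + 1)) fun j hj => if_neg hj) (fun n j => ?_)
    (fun n => ?_) fun V => ?_
  · by_cases hj : j ∈ Finset.range (k + 1)
    · rw [if_pos hj]
      obtain ⟨i, rfl⟩ : ∃ i : Fin (k + 1), (i : ℕ) = j := ⟨⟨j, Finset.mem_range.1 hj⟩, rfl⟩
      rw [hpq]
      simpa using Finset.prod_le_prod (s := Finset.univ) (fun l _ => norm_nonneg (q n i l))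
        fun l _ => hq n i l
    · rw [if_neg hj, hp0 n j hj]
      exact prod_norm_zero.le
  · rw [hqsum, ← Finset.sum_congr rfl fun i _ => congrArg jmathBar (hpq n i),
      ← Finset.sum_range fun j => jmathBar (p n j)]
    exact hasSum_sum_of_ne_finset_zero fun j hj => by
      rw [hp0 n j hj]; exact (jmathBarMulti k U).map_zero
  · have e : ∀ n, ∑' j, ∏ i, (supNorm fun x : V i => p n j i x) =
        ∑ l : Fin (k + 1), ∏ i, supNorm fun x : V i => q n l i x := fun n => by
      rw [tsum_eq_sum (s := Finset.range (k + 1)) fun j hj => by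
        rw [hp0 n j hj]; exact prod_supNorm_zero V, Finset.sum_range]
      simp only [hpq]
    simp only [e]
    rw [← Finset.sum_const_zero (s := (Finset.univ : Finset (Fin (k + 1))))]
    refine tendsto_finsetSum _ fun l _ => ?_
    have hbd : Tendsto (fun n => ∏ i : Fin (k + 1), if i = l then
        supNorm (restrict U (gs n l) - restrict U (g l)) else M) atTop
        (𝓝 (∏ i : Fin (k + 1), if i = l then 0 else M)) :=
      tendsto_finsetProd _ fun i _ => by
        split_ifs
        · exact hlim l
        · exact tendsto_const_nhds
    have h0 : ∏ i : Fin (k + 1), (if i = l then (0 : ℝ) else M) = 0 :=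
      Finset.prod_eq_zero (Finset.mem_univ l) (if_pos rfl)
    rw [h0] at hbd
    refine squeeze_zero (fun n => prod_supNorm_nonneg _ V) (fun n => ?_) hbd
    refine Finset.prod_le_prod (fun _ _ => LIP.supNorm_restrict_nonneg _ _) fun i _ => ?_
    split_ifs with hi
    · subst hi
      refine LIP.supNorm_le (LIP.supNorm_nonneg _) fun x => ?_
      simp only [q, lt_irrefl, if_true, if_false]
      exact LIP.abs_le_supNorm (restrict U (gs n i) - restrict U (g i)) _
    · exact (LIP.supNorm_restrict_le _ _).trans (hq n l i)

theorem iota_apply_eq_zero (f : LIPc X) (g : Fin k → LIP X) {x : X} (hx : x ∉ tsupport f.1) :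
    (iota f g).1 x = 0 := by
  let D : Opens X := ⟨(tsupport f.1)ᶜ, (isClosed_tsupport _).isOpen_compl⟩
  show germ ⊤ x _ _ = 0
  rw [← germ_res (le_top : D ≤ ⊤) hx, res_tensorOn, tensorOn_cons_eq_zero fun y hy =>
    image_eq_zero_of_notMem_tsupport hy, map_zero]

variable [LocallyCompactSpace X]

/-- This gives the sequential continuity of `S ∘ iota` for `S` in the dual, one of the two axioms of
a current. -/
theorem formTendsto_iota {fs : ℕ → LIPc X} {f : LIPc X} {gs : ℕ → Fin k → LIP X}
    {g : Fin k → LIP X} (hf : LIPcTendsto fs f) (hg : ∀ i, LIPTendsto (fun n => gs n i) (g i)) :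
    FormTendsto (fun n => iota (fs n) (gs n)) (iota f g) := by
  refine formTendsto_of_global hf.2.1 (fun n => tensorOn ⊤ (Fin.cons (fs n).1 (gs n)) -
    tensorOn ⊤ (Fin.cons f.1 g)) 
    (fun n x => (map_sub (germ ⊤ x (Opens.mem_top x)) _ _).symm) (fun n x hx => ?_) fun U hU => ?_
  · show (iota (fs n) (gs n)).1 x - (iota f g).1 x = 0
    rw [iota_apply_eq_zero _ _ fun h => hx (subset_closure (mem_iUnion.2 ⟨n, h⟩)),
      iota_apply_eq_zero _ _ fun h => hx (hf.tsupport_subset h), sub_zero]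
  · simp only [map_sub, res_tensorOn]
    refine polyBarTendsto_tensorOn_sub (fun i => ?_) U hU
    cases i using Fin.cases with
    | zero => exact hf.lipTendsto
    | succ i => exact hg i

/-- The partial sums of a series of tuples converge to the form that is given by the series. -/
theorem formTendsto_series {K : Set X} (hK : IsCompact K) {h : ℕ → LIPc X} {g : ℕ → Fin k → LIP X}
    {ω : PolyForm k X} (hω : IsSeries K h g ω) :
    FormTendsto (fun n => ω - ∑ j ∈ Finset.range n, iota (h j) (g j)) 0 := by
  let H : ℕ → Fin (k + 1) → LIP X := fun j => Fin.cons (h j).1 (g j)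
  have hH : ∀ j, ∏ i, ‖H j i‖ = ‖(h j).1‖ * ∏ i, ‖g j i‖ := fun j => prod_norm_cons _ _
  have hHs : Summable fun j => ∏ i, ‖H j i‖ := by simpa only [hH] using hω.summable
  -- The tail of the series, with the first `n` tuples replaced by zero so that one summable
  -- majorant serves all `n`; each fixed index is eventually zero.
  let p : ℕ → ℕ → Fin (k + 1) → LIP X := fun n j => if j ∈ Finset.range n then 0 else H j
  have hpH : ∀ n j, ∏ i, ‖p n j i‖ ≤ ∏ i, ‖H j i‖ := fun n j => by
    simp only [p]
    split_ifs
    · exact prod_norm_zero.trans_le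
        (Finset.prod_nonneg fun _ _ => norm_nonneg _)
    · exact le_rfl
  have hps : ∀ n, Summable fun j => ∏ i, ‖p n j i‖ := fun n =>
    Summable.of_nonneg_of_le (fun _ => Finset.prod_nonneg fun _ _ => norm_nonneg _) (hpH n) hHs
  have hz : ∀ U : Opens X, tensorOn U (0 : Fin (k + 1) → LIP X) = 0 := fun U =>
    tensorOn_eq_zero 0 (map_zero (restrict U))
  have hr : ∀ n x, (ω - ∑ j ∈ Finset.range n, iota (h j) (g j) - 0).1 x =
      germ ⊤ x (Opens.mem_top x) (∑' j, tensorOn ⊤ (p n j)) := fun n x => by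
    have h1 : HasSum (fun j => if j ∈ Finset.range n then tensorOn (⊤ : Opens X) (H j) else 0)
        (∑ j ∈ Finset.range n, if j ∈ Finset.range n then tensorOn (⊤ : Opens X) (H j) else 0) :=
      hasSum_sum_of_ne_finset_zero fun j hj => if_neg hj
    have h2 := (summable_tensorOn (U := ⊤) hHs).hasSum.sub h1
    have h3 : ∀ j, tensorOn (⊤ : Opens X) (p n j) = tensorOn ⊤ (H j) -
        if j ∈ Finset.range n then tensorOn ⊤ (H j) else 0 := fun j => by
      simp only [p]
      split_ifs
      · rw [sub_self]; exact hz ⊤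
      · rw [sub_zero]
    rw [tsum_congr h3, h2.tsum_eq, map_sub, ← hω.germ_eq,
      Finset.sum_congr rfl fun j hj => if_pos hj, map_sum, sub_zero, Submodule.coe_sub,
      Pi.sub_apply, AddSubmonoidClass.coe_finsetSum, Finset.sum_apply]
    rfl
  refine formTendsto_of_global hK (fun n => ∑' j, tensorOn ⊤ (p n j)) hr (fun n x hx => ?_)
    fun U _ => ?_
  · let D : Opens X := ⟨Kᶜ, hK.isClosed.isOpen_compl⟩
    rw [hr, ← germ_res (le_top : D ≤ ⊤) hx, res_tsum_tensorOn (hps n)]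
    have : ∀ j, tensorOn D (p n j) = 0 := fun j => by
      simp only [p]
      split_ifs
      · exact hz D
      · exact tensorOn_cons_eq_zero fun y hy =>
          image_eq_zero_of_notMem_tsupport fun hy' => hy (hω.support j hy')
    simp only [this, tsum_zero, map_zero]
  · have hpU : ∀ n j, ∏ i, ‖restrict U (p n j i)‖ ≤ ∏ i, ‖H j i‖ := fun n j =>
      (prod_norm_restrict_le U _).trans (hpH n j)
    refine polyBarTendsto_zero_of_series (fun n j i => restrict U (p n j i)) _ hHs hpU (fun n => ?_)
      fun V => ?_
    · rw [res_tsum_tensorOn (hps n)]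
      exact (summable_tensorOn (hps n)).hasSum
    · rw [← tsum_zero (α := ℝ) (β := ℕ)]
      refine tendsto_tsum_of_dominated_convergence hHs (fun j => ?_)
        (Eventually.of_forall fun n j => ?_)
      · refine tendsto_const_nhds.congr' ?_
        filter_upwards [eventually_gt_atTop j] with n hn
        have hp0 : p n j = 0 := if_pos (Finset.mem_range.2 hn)
        simp only [hp0]
        exact (prod_supNorm_zero V).symm
      · rw [Real.norm_of_nonneg (prod_supNorm_nonneg _ V)]
        exact (prod_supNorm_le _ V).trans (hpU n j)

end FormConvergence

/-! ### The restriction of functionals on forms to tuples -/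

section Restriction

variable {X : Type u} [MetricSpace X] {k : ℕ}

/-- Elementary tensors over an open set as a multilinear map. -/
def tensorMulti (k : ℕ) (U : Opens X) :
    MultilinearMap ℝ (fun _ : Fin (k + 1) => LIP X) (PolyBar k U) :=
  (jmathBarMulti k U).compLinearMap fun _ => (restrict U).toLinearMap

/-- The map `iota` as a multilinear map. -/
def iotaMulti (k : ℕ) (X : Type u) [MetricSpace X] :
    LIPc X →ₗ[ℝ] MultilinearMap ℝ (fun _ : Fin k => LIP X) (PolyForm k X) where
  toFun f :=
    { toFun := iota f
      map_update_add' := by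
        intro inst g i a b
        obtain rfl : inst = instDecidableEqFin k := Subsingleton.elim _ _
        refine Subtype.ext (funext fun x => ?_)
        have h := ((tensorMulti k (⊤ : Opens X)).curryLeft f.1).map_update_add g i a b
        exact (congrArg (germ ⊤ x (Opens.mem_top x)) h).trans (map_add _ _ _)
      map_update_smul' := by
        intro inst g i c a
        obtain rfl : inst = instDecidableEqFin k := Subsingleton.elim _ _
        refine Subtype.ext (funext fun x => ?_)
        have h := ((tensorMulti k (⊤ : Opens X)).curryLeft f.1).map_update_smul g i c a
        exact (congrArg (germ ⊤ x (Opens.mem_top x)) h).trans (map_smul _ _ _) }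
  map_add' f f' := MultilinearMap.ext fun g => Subtype.ext (funext fun x =>
    (congrArg (germ ⊤ x (Opens.mem_top x))
      ((tensorMulti k (⊤ : Opens X)).cons_add g f.1 f'.1)).trans (map_add _ _ _))
  map_smul' c f := MultilinearMap.ext fun g => Subtype.ext (funext fun x =>
    (congrArg (germ ⊤ x (Opens.mem_top x))
      ((tensorMulti k (⊤ : Opens X)).cons_smul g c f.1)).trans (map_smul _ _ _))

/-- Locality of `S ∘ iota`: near `spt f` the class of `g i` modulo constants is zero, and off `spt
f` the factor `f` is zero. -/
theorem iota_eq_zero_of_eventually (f : LIPc X) (g : Fin k → LIP X) (i : Fin k) (c : ℝ)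
    (h : ∀ᶠ x in 𝓝ˢ (tsupport f.1), g i x = c) : iota f g = 0 := by
  refine Subtype.ext (funext fun x => ?_)
  by_cases hx : x ∈ tsupport f.1
  · obtain ⟨V, hV, hfV, hVc⟩ := mem_nhdsSet_iff_exists.1 h
    let D : Opens X := ⟨V, hV⟩
    have hD : x ∈ D := hfV hx
    show germ ⊤ x _ _ = 0
    rw [← germ_res (le_top : D ≤ ⊤) hD, res_tensorOn, tensorOn_eq_zero i.succ, map_zero]
    rw [Fin.cons_succ, show restrict D (g i) = LIP.const D c from LIP.ext fun y => hVc y.2]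
    exact LIPBar.q_const c
  · exact iota_apply_eq_zero f g hx

/-- A pointwise convergent sequence of currents is uniformly bounded after localization. -/
theorem exists_uniform_bound_localize (Ts : ℕ → Current k X) (T : Current k X)
    (h : ∀ f g, Tendsto (fun n => (Ts n).1 f g) atTop (𝓝 (T.1 f g))) (φ : LIPc X) :
    ∃ C, ∀ n g, |localize (Ts n).1 φ g| ≤ C * ∏ i, ‖g i‖ := by
  choose B hB using fun n => exists_bound_localize (Ts n) φ
  -- Convergent real sequences are bounded, so the localized currents form a pointwise bounded
  -- family of bounded multilinear maps.
  obtain ⟨C, hC⟩ := multilinear_banach_steinhaus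
    (fun n => (localize (Ts n).1 φ).mkContinuous (B n) (hB n)) fun g => by
      obtain ⟨C, hC⟩ := (h (mulc φ (g 0)) (Fin.tail g)).norm.bddAbove_range
      exact ⟨C, fun n => hC ⟨n, rfl⟩⟩
  exact ⟨C, fun n g => ContinuousMultilinearMap.le_of_opNorm_le (hC n) g⟩

theorem mulc_eq_self {φ f : LIPc X} (h : ∀ x ∈ tsupport f.1, φ.1 x = 1) : mulc φ f.1 = f :=
  LIPc.ext fun x => by
    rw [mulc_apply]
    by_cases hx : x ∈ tsupport f.1
    · rw [h x hx, one_mul]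
    · rw [image_eq_zero_of_notMem_tsupport hx, mul_zero]

variable [LocallyCompactSpace X]

/-- The current `S ∘ iota` of a sequentially continuous functional `S` on forms. -/
def toCurrent (k : ℕ) (X : Type u) [MetricSpace X] [LocallyCompactSpace X] :
    FormDual k X →ₗ[ℝ] Current k X where
  toFun S := ⟨
    { toFun := fun f => S.1.compMultilinearMap (iotaMulti k X f)
      map_add' := fun f f' => by
        rw [map_add]
        exact MultilinearMap.ext fun _ => map_add S.1 _ _
      map_smul' := fun c f => by
        rw [map_smul]
        exact MultilinearMap.ext fun _ => map_smul S.1 _ _ },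
    fun _ _ _ _ hf hg => S.2 _ _ (formTendsto_iota hf hg), by
      rintro f g ⟨i, c, h⟩
      exact (congrArg S.1 (iota_eq_zero_of_eventually f g i c h)).trans (map_zero _)⟩
  map_add' _ _ := rfl
  map_smul' _ _ := rfl

theorem toCurrent_apply (S : FormDual k X) (f : LIPc X) (g : Fin k → LIP X) :
    (toCurrent k X S).1 f g = S.1 (iota f g) := rfl

/-- The value of a sequentially continuous functional at a form that is given by a series. -/
theorem tendsto_sum_toCurrent (S : FormDual k X) {K : Set X} (hK : IsCompact K) {h : ℕ → LIPc X}
    {g : ℕ → Fin k → LIP X} {ω : PolyForm k X} (hω : IsSeries K h g ω) :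
    Tendsto (fun n => ∑ j ∈ Finset.range n, (toCurrent k X S).1 (h j) (g j)) atTop (𝓝 (S.1 ω)) := by
  have h1 := S.2 _ _ (formTendsto_series hK hω)
  simp only [map_sub, map_sum, map_zero] at h1
  have h2 := h1.const_sub (S.1 ω)
  simp only [sub_sub_cancel, sub_zero] at h2
  exact h2

/-- On a form given by a series, a functional is the limit of its values on partial sums, which its
current determines; such forms span. -/
theorem toCurrent_injective : Function.Injective (toCurrent k X) := fun S S' h => by
  refine Subtype.ext (LinearMap.ext fun ω => ?_)
  have hmem : ω ∈ LinearMap.eqLocus S.1 S'.1 := by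
    refine Submodule.span_le.2 ?_ (mem_span_isSeries ω)
    rintro η ⟨K, p, g, hK, hη⟩
    have h1 := tendsto_sum_toCurrent S hK hη
    rw [h] at h1
    exact tendsto_nhds_unique h1 (tendsto_sum_toCurrent S' hK hη)
  exact hmem

theorem toCurrent_surjective : Function.Surjective (toCurrent k X) := fun T => by
  obtain ⟨S, hS⟩ := exists_extension_current T
  exact ⟨S, Subtype.ext (LinearMap.ext fun f => MultilinearMap.ext fun g => hS f g)⟩

/-- The linear isomorphism between currents and sequentially continuous functionals on forms. -/
def currentEquiv (k : ℕ) (X : Type u) [MetricSpace X] [LocallyCompactSpace X] :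
    Current k X ≃ₗ[ℝ] FormDual k X :=
  (LinearEquiv.ofBijective (toCurrent k X) ⟨toCurrent_injective, toCurrent_surjective⟩).symm

theorem toCurrent_currentEquiv (T : Current k X) : toCurrent k X (currentEquiv k X T) = T :=
  (LinearEquiv.ofBijective (toCurrent k X) ⟨toCurrent_injective, toCurrent_surjective⟩).apply_symm_apply T

theorem currentEquiv_iota (T : Current k X) (f : LIPc X) (g : Fin k → LIP X) :
    (currentEquiv k X T).1 (iota f g) = T.1 f g := by
  rw [← toCurrent_apply, toCurrent_currentEquiv]

theorem eq_currentEquiv (T : Current k X) (S : FormDual k X)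
    (h : ∀ f g, S.1 (iota f g) = T.1 f g) : S = currentEquiv k X T :=
  toCurrent_injective <| by
    rw [toCurrent_currentEquiv]
    exact Subtype.ext (LinearMap.ext fun f => MultilinearMap.ext fun g => h f g)

/-! ### Sequential continuity of the extension -/

/-- On a form given by a series the extension is the sum of the values of the current on the tuples.
The uniform bound on localized currents supplies a majorant independent of `n`, and linearity treats
the span. -/
theorem tendsto_currentEquiv (Ts : ℕ → Current k X) (T : Current k X)
    (h : ∀ f g, Tendsto (fun n => (Ts n).1 f g) atTop (𝓝 (T.1 f g))) (ω : PolyForm k X) :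
    Tendsto (fun n => (currentEquiv k X (Ts n)).1 ω) atTop (𝓝 ((currentEquiv k X T).1 ω)) := by
  induction mem_span_isSeries ω using Submodule.span_induction with
  | mem η hη =>
    obtain ⟨K, p, g, hK, hη⟩ := hη
    -- All `p j` are supported in `K`, so `φ * p j = p j`, and one localizing function handles the
    -- whole series.
    obtain ⟨φ, hφ, -⟩ := exists_cutoff hK isOpen_univ (subset_univ _)
    obtain ⟨C, hC⟩ := exists_uniform_bound_localize Ts T h φ
    have hb : ∀ n j, ‖(Ts n).1 (p j) (g j)‖ ≤ C * (‖(p j).1‖ * ∏ i, ‖g j i‖) := fun n j => by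
      have h1 := hC n (Fin.cons (p j).1 (g j))
      rw [localize_cons, mulc_eq_self fun x hx => hφ x (hη.support j hx)] at h1
      rwa [prod_norm_cons] at h1
    have hb' : ∀ j, ‖T.1 (p j) (g j)‖ ≤ C * (‖(p j).1‖ * ∏ i, ‖g j i‖) := fun j =>
      le_of_tendsto (h (p j) (g j)).norm (Eventually.of_forall fun n => hb n j)
    have key : ∀ S : Current k X, (∀ j, ‖S.1 (p j) (g j)‖ ≤ C * (‖(p j).1‖ * ∏ i, ‖g j i‖)) →
        (currentEquiv k X S).1 η = ∑' j, S.1 (p j) (g j) := fun S hS => by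
      have h1 := tendsto_sum_toCurrent (currentEquiv k X S) hK hη
      rw [toCurrent_currentEquiv] at h1
      exact tendsto_nhds_unique h1
        (Summable.of_norm_bounded (hη.summable.mul_left C) hS).hasSum.tendsto_sum_nat
    rw [key T hb']
    simp only [fun n => key (Ts n) (hb n)]
    exact tendsto_tsum_of_dominated_convergence (hη.summable.mul_left C) (fun j => h (p j) (g j))
      (Eventually.of_forall hb)
  | zero => simp
  | add η θ _ _ ih1 ih2 => simpa only [map_add] using ih1.add ih2
  | smul c η _ ih => simpa only [map_smul] using ih.const_smul c

end Restriction

/-! ### The exterior derivative and the boundary -/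

section Boundary

variable {X Y : Type u} [MetricSpace X] [MetricSpace Y] {k : ℕ}

/-- Inserting `1` in a later position is killed by `Q`, so insertion in position `0` alone lifts
`dBar`. Unlike the alternating sum `dPoly`, it sends each elementary tensor of a representation to a
single one. -/
theorem Q_insertOne_zero (p : Poly k Y) : Q (k + 1) Y (insertOne k Y 0 p) = dBar k Y (Q k Y p) := by
  refine DFunLike.congr_fun (F := Poly k Y →L[ℝ] PolyBar (k + 1) Y)
    (f := (Q (k + 1) Y).comp (insertOne k Y 0)) (g := (dBar k Y).comp (Q k Y))
    (Poly.hom_ext fun f => ?_) p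
  rw [ContinuousLinearMap.comp_apply, ContinuousLinearMap.comp_apply, insertOne_jmath]
  refine Eq.trans ?_ (dBar_jmathBar f).symm
  rw [Fin.insertNth_zero']
  rfl

/-- Prefixing `1` to each tuple of a representation does not increase norm products or products of
sup norms, so the old majorant and the old limit still serve. -/
theorem PolyBarTendsto.dBar {πs : ℕ → PolyBar k Y} {π : PolyBar k Y} (h : PolyBarTendsto πs π) :
    PolyBarTendsto (fun n => dBar k Y (πs n)) (dBar k Y π) := by
  obtain ⟨ρs, ρ, h1, h2, h3⟩ := h
  refine ⟨fun n => insertOne k Y 0 (ρs n), insertOne k Y 0 ρ, fun n => ?_, ?_, fun V hV => ?_⟩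
  · rw [Q_insertOne_zero, h1]
  · rw [Q_insertOne_zero, h2]
  · obtain ⟨p, hp, ⟨t, ht, hpt⟩, hlim⟩ := h3 (fun i => V i.succ) fun i => hV i.succ
    let q : ℕ → ℕ → Fin (k + 2) → LIP Y := fun n j => Fin.cons (LIP.const Y 1) (p n j)
    -- Only an inequality, since this norm is `0` when `Y` is empty.
    have h1le : ‖LIP.const Y 1‖ ≤ 1 := (LIP.norm_const_le 1).trans_eq abs_one
    have hq : ∀ n j, ∏ i, ‖q n j i‖ ≤ ∏ i, ‖p n j i‖ := fun n j => by
      rw [prod_norm_cons]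
      exact mul_le_of_le_one_left (Finset.prod_nonneg fun _ _ => norm_nonneg _) h1le
    have hqs : ∀ n j, ∏ i, (supNorm fun x : V i => q n j i x) ≤
        ∏ i, supNorm fun x : V (Fin.succ i) => p n j i x := fun n j => by
      rw [Fin.prod_univ_succ]
      exact mul_le_of_le_one_left (prod_supNorm_nonneg _ fun i => V (Fin.succ i))
        ((LIP.supNorm_restrict_le _ _).trans h1le)
    have hps : ∀ n, Summable fun j => ∏ i, supNorm fun x : V (Fin.succ i) => p n j i x := fun n =>
      Summable.of_nonneg_of_le (fun j => prod_supNorm_nonneg _ fun i => V (Fin.succ i))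
        (fun j => (prod_supNorm_le _ _).trans (hpt j n)) ht
    refine ⟨q, fun n => ⟨?_, ?_⟩, ⟨t, ht, fun j n => (hq n j).trans (hpt j n)⟩, ?_⟩
    · exact Summable.of_nonneg_of_le (fun _ => Finset.prod_nonneg fun _ _ => norm_nonneg _) (hq n)
        (hp n).1
    · rw [← map_sub]
      convert (insertOne k Y 0).hasSum (hp n).2 using 2 with j
      rw [insertOne_jmath, Fin.insertNth_zero']
    · refine squeeze_zero (fun n => tsum_nonneg fun j => prod_supNorm_nonneg _ V) (fun n => ?_) hlim
      exact Summable.tsum_le_tsum (hqs n) (Summable.of_nonneg_of_le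
        (fun j => prod_supNorm_nonneg _ V) (hqs n) (hps n)) (hps n)

theorem FormTendsto.dForm {ωs : ℕ → PolyForm k X} {ω : PolyForm k X} (h : FormTendsto ωs ω) :
    FormTendsto (fun n => dForm k X (ωs n)) (dForm k X ω) := by
  obtain ⟨K, 𝒰, c, hK, h𝒰, hc, hsupp, hlim⟩ := h
  have e : ∀ n x, (Polylip.dForm k X (ωs n) - Polylip.dForm k X ω).1 x =
      dStalk k x ((ωs n - ω).1 x) := fun n x => ((dStalk k x).map_sub _ _).symm
  refine ⟨K, 𝒰, fun n U => Polylip.dBar k U (c n U), hK, h𝒰, fun n => ⟨fun x => ?_, ?_⟩,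
    fun n => ?_, fun U hU => ?_⟩
  · obtain ⟨U, hU, hx, hUx⟩ := (hc n).compatible x
    exact ⟨U, hU, hx, by rw [e, hUx, dStalk_germ]⟩
  · intro U hU V hV hUV
    rw [res_dBar, res_dBar, (hc n).overlap U hU V hV hUV]
  · refine Subset.trans (closure_mono fun x hx => ?_) (hsupp n)
    rw [mem_ofPred_eq, e] at hx
    exact fun h0 => hx (by rw [h0, map_zero])
  · have := (hlim U hU).dBar
    rwa [map_zero] at this

theorem dBar_tensorOn (U : Opens X) (g : Fin (k + 1) → LIP X) :
    dBar k U (tensorOn U g) = tensorOn U (Fin.cons (LIP.const X 1) g) := by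
  rw [tensorOn, dBar_jmathBar, tensorOn]
  congr 1
  funext i
  cases i using Fin.cases <;> rfl

/-- The exterior derivative of `f ⊗ g₁ ⊗ ⋯ ⊗ g_k` is `φ ⊗ f ⊗ g₁ ⊗ ⋯ ⊗ g_k` if `φ` is `1` in a
neighbourhood of the support of `f`. -/
theorem dForm_iota (f φ : LIPc X) (g : Fin k → LIP X)
    (hφ : ∀ x ∈ tsupport f.1, ∀ᶠ y in 𝓝 x, φ.1 y = 1) :
    dForm k X (iota f g) = iota φ (Fin.cons f.1 g) := by
  refine Subtype.ext (funext fun x => ?_)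
  have h1 : (dForm k X (iota f g)).1 x = germ ⊤ x (Opens.mem_top x)
      (tensorOn ⊤ (Fin.cons (LIP.const X 1) (Fin.cons f.1 g : Fin (k + 1) → LIP X))) := by
    rw [← dBar_tensorOn]
    rfl
  rw [h1]
  show _ = germ ⊤ x _ (tensorOn ⊤ _)
  -- Near `spt f` the functions `1` and `φ` coincide; off `spt f` both tensors vanish because `f`,
  -- now in position `1`, restricts to zero.
  by_cases hx : x ∈ tsupport f.1
  · obtain ⟨V, hV, hVo, hxV⟩ := mem_nhds_iff.1 (hφ x hx)
    let D : Opens X := ⟨V, hVo⟩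
    have hD : x ∈ D := hxV
    rw [← germ_res (le_top : D ≤ ⊤) hD, ← germ_res (le_top : D ≤ ⊤) hD, res_tensorOn, res_tensorOn]
    congr 1
    refine congrArg jmathBar (funext fun i => ?_)
    cases i using Fin.cases with
    | zero => exact LIP.ext fun y => (hV y.2).symm
    | succ i => rfl
  · let D : Opens X := ⟨(tsupport f.1)ᶜ, (isClosed_tsupport _).isOpen_compl⟩
    have hD : x ∈ D := hx
    have hf : restrict D f.1 = 0 := LIP.ext fun y => image_eq_zero_of_notMem_tsupport (f := f.1) y.2
    have h0 : ∀ a : LIP X,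
        tensorOn D (Fin.cons a (Fin.cons f.1 g : Fin (k + 1) → LIP X) : Fin (k + 2) → LIP X) = 0 :=
      fun a => tensorOn_eq_zero (Fin.succ 0) (by
        rw [Fin.cons_succ, Fin.cons_zero, hf, map_zero])
    rw [← germ_res (le_top : D ≤ ⊤) hD, ← germ_res (le_top : D ≤ ⊤) hD, res_tensorOn, res_tensorOn,
      h0, h0]

variable [LocallyCompactSpace X]

/-- The right-hand side is sequentially continuous in `ω` and agrees with `∂T` on tuples, so
uniqueness of the extension identifies it with the left-hand side. -/
theorem currentEquiv_boundary (T : Current (k + 1) X) (ω : PolyForm k X) :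
    (currentEquiv k X (boundary T)).1 ω = (currentEquiv (k + 1) X T).1 (dForm k X ω) := by
  let S : FormDual k X := ⟨(currentEquiv (k + 1) X T).1 ∘ₗ dForm k X, fun _ _ h =>
    (currentEquiv (k + 1) X T).2 _ _ h.dForm⟩
  have hS : S = currentEquiv k X (boundary T) := eq_currentEquiv _ _ fun f g => by
    obtain ⟨φ, hφ, -⟩ := exists_cutoff_nhds f.2 isOpen_univ (subset_univ _)
    show (currentEquiv (k + 1) X T).1 (dForm k X (iota f g)) = _
    rw [dForm_iota f φ g hφ, currentEquiv_iota,
      boundary_apply T f φ g fun x hx => (hφ x hx).self_of_nhds]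
  rw [← hS]
  rfl

end Boundary

end Polylip

end

theorem theorem1p1 {X : Type*} [MetricSpace X] [LocallyCompactSpace X] :
    ∃ hat : ∀ k : ℕ, Current k X →ₗ[ℝ] FormDual k X,
      -- existence and uniqueness of the extension of each current
      (∀ (k : ℕ) (T : Current k X),
        (∀ (f : LIPc X) (g : Fin k → LIP X), (hat k T).1 (iota f g) = T.1 f g) ∧
        ∀ S : FormDual k X, (∀ (f : LIPc X) (g : Fin k → LIP X), S.1 (iota f g) = T.1 f g) →
          S = hat k T) ∧
      -- the extension map is bijective
      (∀ k : ℕ, Function.Bijective (hat k)) ∧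
      -- the extension map is sequentially continuous
      (∀ (k : ℕ) (Ts : ℕ → Current k X) (T : Current k X),
        (∀ (f : LIPc X) (g : Fin k → LIP X),
          Tendsto (fun n => (Ts n).1 f g) atTop (𝓝 (T.1 f g))) →
        ∀ ω : PolyForm k X,
          Tendsto (fun n => (hat k (Ts n)).1 ω) atTop (𝓝 ((hat k T).1 ω))) ∧
      -- the boundary is dual to the exterior derivative
      (∀ (k : ℕ) (T : Current (k + 1) X) (ω : PolyForm k X),
        (hat k (boundary T)).1 ω = (hat (k + 1) T).1 (dForm k X ω)) :=
  ⟨fun k => (currentEquiv k X).toLinearMap,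
    fun _ T => ⟨currentEquiv_iota T, eq_currentEquiv T⟩,
    fun k => (currentEquiv k X).bijective,
    fun _ Ts T h ω => tendsto_currentEquiv Ts T h ω,
    fun _ T ω => currentEquiv_boundary T ω⟩
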